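/- A funnel polygon is a simple polygon $P$ with vertices $v_1,\dots,v_n$ in clockwise order such that $v_nv_1$ is a convex edge (both its endpoints are convex vertices) and the rest of the boundary consists of two reflex chains $v_1,\dots,v_t$ and $v_t,\dots,v_n$ with $1<t<n$, i.e. every $v_i$ with $i\notin\{1,t,n\}$ is strictly reflex. Two points see each other if the segment between them lies in the closed region $P$. A hidden vertex set of $P$ is a set of vertices of $P$ no two of which see each other; a convex cover of the vertices of $P$ is a finite set of convex polygons contained in $P$ whose union contains every vertex of $P$. Theorem 2. There is an algorithm (a program for the real RAM, counting each primitive operation as one step) which, given the list of vertices of any funnel polygon $P$ with $n$ vertices, outputs within $O(n)$ steps a hidden vertex set $H$ of $P$ and a convex cover $C$ of the vertices of $P$ with $|H|=|C|$; each polygon of $C$ is given by a list of vertices of $P$ whose convex hull it is. Consequently, for every funnel polygon, the maximum size of a hidden vertex set equals the minimum size of a convex cover of the vertices. -/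

import Mathlib

open scoped Topology

/-! ## Polygons in the plane -/

namespace Funnel

/-- The plane; the coordinates of `p` are `p.1` and `p.2`. -/
abbrev Plane := ℝ × ℝ

/-- Orientation test: positive iff `p, q, r` makes a left (counter-clockwise) turn at `q`,
negative iff it makes a right (clockwise) turn, zero iff the three points are collinear. -/
def orient (p q r : Plane) : ℝ :=
  (q.1 - p.1) * (r.2 - p.2) - (q.2 - p.2) * (r.1 - p.1)

/-- The `i`-th edge of the closed polygonal chain `v 0, v 1, …, v (n-1)`. The indices are cyclic:
addition on `Fin n` is modulo `n`, so the last edge joins `v (-1) = v (n-1)` to `v 0`. -/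
def edge {n : ℕ} [NeZero n] (v : Fin n → Plane) (i : Fin n) : Set Plane :=
  segment ℝ (v i) (v (i + 1))

/-- The boundary curve of the polygon with vertices `v`. -/
def boundary {n : ℕ} [NeZero n] (v : Fin n → Plane) : Set Plane :=
  ⋃ i, edge v i

/-- The polygon as a closed region: its boundary curve together with the bounded
components of the complement of that curve. -/
def region {n : ℕ} [NeZero n] (v : Fin n → Plane) : Set Plane :=
  boundary v ∪
    {x | x ∈ (boundary v)ᶜ ∧ Bornology.IsBounded (connectedComponentIn (boundary v)ᶜ x)}

/-- A simple polygon: at least three vertices, all distinct; two consecutive edges meet only in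
their common vertex, and any two other distinct edges are disjoint. -/
structure IsSimplePolygon {n : ℕ} [NeZero n] (v : Fin n → Plane) : Prop where
  three_le : 3 ≤ n
  injective : Function.Injective v
  consecutive : ∀ i, edge v i ∩ edge v (i + 1) = {v (i + 1)}
  disjoint : ∀ i j, i ≠ j → j ≠ i + 1 → i ≠ j + 1 → Disjoint (edge v i) (edge v j)

/-- The vertices are listed in clockwise order: the polygon lies to the right of each of its
directed edges, i.e. from the midpoint of the edge one enters the polygon when moving along the
right-hand normal `(dy, -dx)` of the direction `(dx, dy)` of the edge. -/
def IsClockwise {n : ℕ} [NeZero n] (v : Fin n → Plane) : Prop :=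
  ∀ i, ∀ᶠ s : ℝ in 𝓝[>] 0,
    midpoint ℝ (v i) (v (i + 1)) +
      s • (((v (i + 1)).2 - (v i).2, -((v (i + 1)).1 - (v i).1)) : Plane) ∈ region v

/-- In clockwise order, a strictly convex vertex is one where the boundary turns right. -/
def IsConvexVertex {n : ℕ} [NeZero n] (v : Fin n → Plane) (i : Fin n) : Prop :=
  orient (v (i - 1)) (v i) (v (i + 1)) < 0

/-- In clockwise order, a strictly reflex vertex is one where the boundary turns left. -/
def IsReflexVertex {n : ℕ} [NeZero n] (v : Fin n → Plane) (i : Fin n) : Prop :=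
  0 < orient (v (i - 1)) (v i) (v (i + 1))

/-- A funnel polygon, with vertices in clockwise order: the edge from the last vertex `v (-1)` to
the first vertex `v 0` is convex (both its endpoints are convex vertices), and the rest of the
boundary consists of two chains `v 0, …, v t` and `v t, …, v (-1)`, all of whose inner vertices are
strictly reflex. -/
structure IsFunnel {n : ℕ} [NeZero n] (v : Fin n → Plane) : Prop where
  simple : IsSimplePolygon v
  clockwise : IsClockwise v
  convex_first : IsConvexVertex v 0
  convex_last : IsConvexVertex v (-1)
  chains : ∃ t : Fin n, t ≠ 0 ∧ t ≠ -1 ∧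
    ∀ i, i ≠ 0 → i ≠ -1 → i ≠ t → IsReflexVertex v i

/-! ## Hidden vertex sets and convex covers of the vertices -/

/-- Two points see each other in the polygon if the segment between them lies in it. -/
def Sees {n : ℕ} [NeZero n] (v : Fin n → Plane) (p q : Plane) : Prop :=
  segment ℝ p q ⊆ region v

/-- A set of vertices (given by their indices) no two of which see each other. -/
def IsHiddenVertexSet {n : ℕ} [NeZero n] (v : Fin n → Plane) (H : Finset (Fin n)) : Prop :=
  ∀ i ∈ H, ∀ j ∈ H, i ≠ j → ¬ Sees v (v i) (v j)

/-- A (non-degenerate) convex polygon, as a region. -/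
def IsConvexPolygon (S : Set Plane) : Prop :=
  (interior S).Nonempty ∧ ∃ F : Set Plane, F.Finite ∧ S = convexHull ℝ F

/-- A finite set of convex polygons inside the polygon `v` that together contain all vertices. -/
structure IsVertexConvexCover {n : ℕ} [NeZero n] (v : Fin n → Plane) (C : Set (Set Plane)) :
    Prop where
  finite : C.Finite
  convex : ∀ S ∈ C, IsConvexPolygon S
  inside : ∀ S ∈ C, S ⊆ region v
  covers : ∀ i, ∃ S ∈ C, v i ∈ S

/-- The convex polygon spanned by a list of vertices of `v`. -/
def piece {n : ℕ} (v : Fin n → Plane) (l : List (Fin n)) : Set Plane :=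
  convexHull ℝ {p | ∃ i ∈ l, p = v i}

end Funnel

/-! ## A real random access machine

The machine has one memory of natural numbers and one memory of real numbers. Both are addressed
by natural numbers, and every address may be computed (indirect addressing). The primitive
operations are constants, memory access, addition and (truncated) subtraction of natural numbers,
addition, subtraction and multiplication of reals, comparisons, assignments, and writing a natural
number to the output. Each primitive operation counts as one step. There is no division, no
rounding and no other transfer of data from the reals to the natural numbers than through
comparisons. Programs are finite and are built with sequencing, branching and `while` loops. -/

namespace RealRAM

/-- Natural number expressions; `mem a` is the content of the cell with address `a`. -/
inductive IExpr where
  | const (k : ℕ)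
  | mem (a : IExpr)
  | add (a b : IExpr)
  | sub (a b : IExpr)

/-- Real expressions; `mem a` is the content of the real cell with address `a`. -/
inductive RExpr where
  | const (k : ℤ)
  | mem (a : IExpr)
  | add (a b : RExpr)
  | sub (a b : RExpr)
  | mul (a b : RExpr)

/-- Tests. -/
inductive Test where
  | ilt (a b : IExpr)
  | rlt (a b : RExpr)
  | not (p : Test)
  | and (p q : Test)

/-- Programs. -/
inductive Prog where
  | setI (addr val : IExpr)
  | setR (addr : IExpr) (val : RExpr)
  | write (val : IExpr)
  | seq (P Q : Prog)
  | ite (b : Test) (P Q : Prog)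
  | while (b : Test) (P : Prog)

/-- A machine state: the two memories and the output written so far. -/
structure State where
  I : ℕ → ℕ
  R : ℕ → ℝ
  out : List ℕ

def IExpr.eval (s : State) : IExpr → ℕ
  | .const k => k
  | .mem a => s.I (a.eval s)
  | .add a b => a.eval s + b.eval s
  | .sub a b => a.eval s - b.eval s

def RExpr.eval (s : State) : RExpr → ℝ
  | .const k => k
  | .mem a => s.R (a.eval s)
  | .add a b => a.eval s + b.eval s
  | .sub a b => a.eval s - b.eval s
  | .mul a b => a.eval s * b.eval s

def Test.eval (s : State) : Test → Prop
  | .ilt a b => a.eval s < b.eval s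
  | .rlt a b => a.eval s < b.eval s
  | .not p => ¬ p.eval s
  | .and p q => p.eval s ∧ q.eval s

/-! The number of primitive operations in the evaluation of an expression or test. -/

def IExpr.cost : IExpr → ℕ
  | .const _ => 1
  | .mem a => a.cost + 1
  | .add a b => a.cost + b.cost + 1
  | .sub a b => a.cost + b.cost + 1

def RExpr.cost : RExpr → ℕ
  | .const _ => 1
  | .mem a => a.cost + 1
  | .add a b => a.cost + b.cost + 1
  | .sub a b => a.cost + b.cost + 1
  | .mul a b => a.cost + b.cost + 1

def Test.cost : Test → ℕ
  | .ilt a b => a.cost + b.cost + 1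
  | .rlt a b => a.cost + b.cost + 1
  | .not p => p.cost + 1
  | .and p q => p.cost + q.cost + 1

/-- `Exec P s k s'`: started in state `s`, the program `P` halts after exactly `k` steps in the
state `s'`. The machine is deterministic, see `Exec.deterministic`. -/
inductive Exec : Prog → State → ℕ → State → Prop where
  | setI (a e : IExpr) (s : State) :
      Exec (.setI a e) s (a.cost + e.cost + 1)
        { s with I := Function.update s.I (a.eval s) (e.eval s) }
  | setR (a : IExpr) (e : RExpr) (s : State) :
      Exec (.setR a e) s (a.cost + e.cost + 1)
        { s with R := Function.update s.R (a.eval s) (e.eval s) }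
  | write (e : IExpr) (s : State) :
      Exec (.write e) s (e.cost + 1) { s with out := s.out ++ [e.eval s] }
  | seq {P Q : Prog} {s₁ s₂ s₃ : State} {k l : ℕ} :
      Exec P s₁ k s₂ → Exec Q s₂ l s₃ → Exec (.seq P Q) s₁ (k + l) s₃
  | ite_true {b : Test} {P Q : Prog} {s s' : State} {k : ℕ} :
      b.eval s → Exec P s k s' → Exec (.ite b P Q) s (b.cost + 1 + k) s'
  | ite_false {b : Test} {P Q : Prog} {s s' : State} {k : ℕ} :
      ¬ b.eval s → Exec Q s k s' → Exec (.ite b P Q) s (b.cost + 1 + k) s'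
  | while_true {b : Test} {P : Prog} {s₁ s₂ s₃ : State} {k l : ℕ} :
      b.eval s₁ → Exec P s₁ k s₂ → Exec (.while b P) s₂ l s₃ →
        Exec (.while b P) s₁ (b.cost + 1 + k + l) s₃
  | while_false {b : Test} {P : Prog} {s : State} :
      ¬ b.eval s → Exec (.while b P) s (b.cost + 1) s

theorem Exec.deterministic {P : Prog} {s s₁ s₂ : State} {k₁ k₂ : ℕ}
    (h₁ : Exec P s k₁ s₁) (h₂ : Exec P s k₂ s₂) : k₁ = k₂ ∧ s₁ = s₂ := by
  induction h₁ generalizing k₂ s₂ with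
  | setI a e s => cases h₂; exact ⟨rfl, rfl⟩
  | setR a e s => cases h₂; exact ⟨rfl, rfl⟩
  | write e s => cases h₂; exact ⟨rfl, rfl⟩
  | seq _ _ ih ih' =>
    cases h₂ with
    | seq g g' =>
      obtain ⟨rfl, rfl⟩ := ih g
      obtain ⟨rfl, rfl⟩ := ih' g'
      exact ⟨rfl, rfl⟩
  | ite_true hb _ ih =>
    cases h₂ with
    | ite_true _ g => obtain ⟨rfl, rfl⟩ := ih g; exact ⟨rfl, rfl⟩
    | ite_false hb' _ => exact absurd hb hb'
  | ite_false hb _ ih =>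
    cases h₂ with
    | ite_true hb' _ => exact absurd hb' hb
    | ite_false _ g => obtain ⟨rfl, rfl⟩ := ih g; exact ⟨rfl, rfl⟩
  | while_true hb _ _ ih ih' =>
    cases h₂ with
    | while_true _ g g' =>
      obtain ⟨rfl, rfl⟩ := ih g
      obtain ⟨rfl, rfl⟩ := ih' g'
      exact ⟨rfl, rfl⟩
    | while_false hb' => exact absurd hb hb'
  | while_false hb =>
    cases h₂ with
    | while_true hb' _ _ => exact absurd hb' hb
    | while_false _ => exact ⟨rfl, rfl⟩

/-- The initial state on input a list of `n` points: the natural number cell `0` contains `n`, the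
real cells `2 * i` and `2 * i + 1` contain the coordinates of the `i`-th point (`i < n`), all other
cells contain `0`, and nothing has been written. -/
noncomputable def initState {n : ℕ} (v : Fin n → ℝ × ℝ) : State where
  I := Function.update (fun _ => 0) 0 n
  R := fun m =>
    if h : m / 2 < n then (if m % 2 = 0 then (v ⟨m / 2, h⟩).1 else (v ⟨m / 2, h⟩).2) else 0
  out := []

/-- Output format for one list of indices: each index increased by one, then the end mark `0`. -/
def encodeList {n : ℕ} (l : List (Fin n)) : List ℕ :=
  l.map (fun i => (i : ℕ) + 1) ++ [0]

/-- Output format for a list `H` of indices followed by a list `C` of lists of indices. -/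
def encodeOutput {n : ℕ} (H : List (Fin n)) (C : List (List (Fin n))) : List ℕ :=
  encodeList H ++ C.flatMap encodeList

end RealRAM

/-!
Why a funnel polygon has a hidden vertex set and a convex cover of the same size.

*Coordinates.* The directions of the chords `vert v i, vert v k` of the chain from `v 0` to `v (-1)`
depend continuously on their endpoints, as in Hopf's theorem on the turning of a simple closed
curve. A lift of these angles that starts in `(0, π)` with the first edge, seen from the base, ends
in `(-π, 0)` with the last one. As the chain turns left except at the apex, it rises strictly up to
the apex and then falls strictly (`monotone_of_left_turns`, `IsFunnel.height_monotone`). Written as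
functions of the height, the two chains are graphs that bend towards each other and meet at the apex
(`IsFunnel.chainPair`), and the region is what lies between them. A point beyond the lines of
all edges of a chain is outside the region, and a convex polygon is inside if its vertices are on
the inner sides of one edge of each chain (`not_mem_region_of_left`, `convexHull_subset_region`).

*Order.* A vertex `k` other than the apex is below a vertex `l` if `l` lies strictly beyond the line
through `k` and the next vertex on the chain of `k`. For vertices on the same chain this means that
`l` is higher and not adjacent to `k`. The relation is transitive (`Below.trans`), and comparable
vertices do not see each other (`not_sees_of_below`), so chains of this order are hidden sets. As in
Mirsky's theorem, the vertices are partitioned into levels, each consisting of the minimal elements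
among the vertices that remain. A level contains at most the two lowest vertices of each chain of
the funnel, so that four orientation tests find it (`next`), and its vertices lie in one convex
polygon inside the region (`levelPiece`, `isGoodPiece_level`); if they are collinear, another vertex
makes the polygon non-degenerate. The apex and its neighbours span the last polygon. A chain of the
order that meets all levels is built downwards from the apex (`pick`, `pick_spec`).

*Optimality.* A convex polygon inside the region contains at most one vertex of a hidden set
(`card_le_ncard`). Hence the two sets are optimal, and the pieces are pairwise distinct.

*The algorithm.* The program finds the apex as the first vertex that is not reflex, computes and
stores the states of the greedy partition, and then writes the picked vertices and the pieces. Every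
loop runs for at most `n` rounds, as each round of the partition removes a vertex. Its correctness
is proved with weakest preconditions for the bodies of the loops (`wp`, `runs_while`).
-/

namespace Funnel

/-! ### Turning angles along a polygonal arc above its chord -/

theorem eq_of_angle_coe_eq {x y : ℝ} (h : (x : Real.Angle) = y) (hxy : |x - y| < 2 * Real.pi) :
    x = y := by
  obtain ⟨k, hk⟩ := Real.Angle.angle_eq_iff_two_pi_dvd_sub.1 h
  rw [hk, abs_mul, abs_of_pos Real.two_pi_pos] at hxy
  have h1 : |(k : ℝ)| < 1 := by
    by_contra hc
    push Not at hc
    nlinarith [Real.pi_pos]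
  have h2 : |k| < 1 := by exact_mod_cast h1
  have h3 : k = 0 := Int.abs_lt_one_iff.1 h2
  rw [h3] at hk
  simp at hk
  linarith

theorem arg_div_eq_sub {a b : ℂ} (ha : a ≠ 0) (hb : b ≠ 0)
    (h : |Complex.arg b - Complex.arg a| < Real.pi) :
    Complex.arg (b / a) = Complex.arg b - Complex.arg a := by
  apply eq_of_angle_coe_eq
  · rw [Complex.arg_div_coe_angle hb ha, Real.Angle.coe_sub]
  · have h1 := Complex.arg_mem_Ioc (b / a)
    rw [abs_lt] at h ⊢
    constructor <;> linarith [h1.1, h1.2]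

theorem div_sub_mem_slitPlane {a b x : ℂ} (hx : x ∉ segment ℝ a b) :
    (b - x) / (a - x) ∈ Complex.slitPlane := by
  have hax : a - x ≠ 0 := by
    intro h
    apply hx
    rw [← sub_eq_zero.1 h]
    exact left_mem_segment ℝ a b
  by_contra hc
  rw [Complex.mem_slitPlane_iff, not_or, not_lt, not_not] at hc
  obtain ⟨hre, him⟩ := hc
  set r : ℝ := -((b - x) / (a - x)).re with hr
  have hr0 : 0 ≤ r := by rw [hr]; linarith
  have e : (b - x) / (a - x) = ((-r : ℝ) : ℂ) := by
    apply Complex.ext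
    · simp [hr]
    · rw [him]; simp
  rw [div_eq_iff hax] at e
  apply hx
  have h1 : (1 + r : ℝ) ≠ 0 := by positivity
  have h1c : (1 + (r : ℂ)) ≠ 0 := by exact_mod_cast h1
  refine ⟨r / (1 + r), 1 / (1 + r), by positivity, by positivity, ?_, ?_⟩
  · field_simp; ring
  · rw [Complex.real_smul, Complex.real_smul]
    push_cast at e ⊢
    field_simp
    linear_combination e

/-- For two disjoint segments `pp'` and `qq'`, the difference of a point of the second and a point
of the first never vanishes; so its direction has no monodromy around the unit square of
parameters. -/
theorem arg_square {p p' q q' : ℂ} (h : Disjoint (segment ℝ p p') (segment ℝ q q')) :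
    Complex.arg ((q' - p) / (q - p)) + Complex.arg ((q' - p') / (q' - p)) =
      Complex.arg ((q - p') / (q - p)) + Complex.arg ((q' - p') / (q - p')) := by
  set P : ℝ → ℂ := fun s => p + (s : ℂ) * (p' - p) with hP
  have hPc : Continuous P := by fun_prop
  have hPmem : ∀ s ∈ Set.Icc (0 : ℝ) 1, segment ℝ p (P s) ⊆ segment ℝ p p' := by
    intro s hs
    refine (convex_segment p p').segment_subset (left_mem_segment ℝ _ _) ?_
    refine ⟨1 - s, s, by linarith [hs.2], hs.1, by ring, ?_⟩
    simp only [hP, Complex.real_smul]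
    push_cast
    ring
  have hPm : ∀ s ∈ Set.Icc (0 : ℝ) 1, P s ∈ segment ℝ p p' := fun s hs =>
    hPmem s hs (right_mem_segment ℝ _ _)
  have hq0 : q ∉ segment ℝ p p' := fun hq => Set.disjoint_left.1 h hq (left_mem_segment ℝ _ _)
  have hq1 : q' ∉ segment ℝ p p' := fun hq => Set.disjoint_left.1 h hq (right_mem_segment ℝ _ _)
  -- orient the quotients so that they avoid the branch cut
  have slit1 : ∀ x ∉ segment ℝ p p', ∀ s ∈ Set.Icc (0 : ℝ) 1,
      (x - P s) / (x - p) ∈ Complex.slitPlane := by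
    intro x hx s hs
    have := div_sub_mem_slitPlane (fun hc => hx (hPmem s hs hc))
    rwa [← neg_div_neg_eq, neg_sub, neg_sub] at this
  have slit2 : ∀ s ∈ Set.Icc (0 : ℝ) 1, (q' - P s) / (q - P s) ∈ Complex.slitPlane := by
    intro s hs
    exact div_sub_mem_slitPlane (fun hc => Set.disjoint_left.1 h (hPm s hs) hc)
  have ne1 : ∀ x ∉ segment ℝ p p', ∀ s ∈ Set.Icc (0 : ℝ) 1, x - P s ≠ 0 := by
    intro x hx s hs hc
    exact hx ((sub_eq_zero.1 hc) ▸ hPm s hs)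
  have hP0 : P 0 = p := by simp [hP]
  have hP1 : P 1 = p' := by simp [hP]
  set f : ℝ → ℝ := fun s =>
    (Complex.arg ((q' - p) / (q - p)) + Complex.arg ((q' - P s) / (q' - p))) -
      (Complex.arg ((q - P s) / (q - p)) + Complex.arg ((q' - P s) / (q - P s))) with hf
  have m0 : (0 : ℝ) ∈ Set.Icc (0 : ℝ) 1 := by simp
  have nq : q - p ≠ 0 := by have := ne1 q hq0 0 m0; rwa [hP0] at this
  have nq' : q' - p ≠ 0 := by have := ne1 q' hq1 0 m0; rwa [hP0] at this
  have hfc : ContinuousOn f (Set.Icc 0 1) := by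
    intro s hs
    apply ContinuousAt.continuousWithinAt
    have c1 : ContinuousAt (fun s => Complex.arg ((q' - P s) / (q' - p))) s :=
      ContinuousAt.comp (g := Complex.arg) (Complex.continuousAt_arg (slit1 q' hq1 s hs))
        (by fun_prop)
    have c2 : ContinuousAt (fun s => Complex.arg ((q - P s) / (q - p))) s :=
      ContinuousAt.comp (g := Complex.arg) (Complex.continuousAt_arg (slit1 q hq0 s hs))
        (by fun_prop)
    have c3 : ContinuousAt (fun s => Complex.arg ((q' - P s) / (q - P s))) s := by
      refine ContinuousAt.comp (g := Complex.arg) (Complex.continuousAt_arg (slit2 s hs)) ?_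
      exact ContinuousAt.div (by fun_prop) (by fun_prop) (ne1 q hq0 s hs)
    exact (continuousAt_const.add c1).sub (c2.add c3)
  have hf0 : f 0 = 0 := by
    simp only [hf, hP0]
    rw [div_self nq', div_self nq]
    simp
  have hfa : ∀ s ∈ Set.Icc (0 : ℝ) 1, ((f s : ℝ) : Real.Angle) = 0 := by
    intro s hs
    simp only [hf, Real.Angle.coe_sub, Real.Angle.coe_add]
    rw [Complex.arg_div_coe_angle nq' nq, Complex.arg_div_coe_angle (ne1 q' hq1 s hs) nq',
      Complex.arg_div_coe_angle (ne1 q hq0 s hs) nq,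
      Complex.arg_div_coe_angle (ne1 q' hq1 s hs) (ne1 q hq0 s hs)]
    abel
  have key : ∀ y : ℝ, (y = Real.pi ∨ y = -Real.pi) → y ∉ f '' Set.Icc 0 1 := by
    rintro y hy ⟨s, hs, rfl⟩
    have := hfa s hs
    rcases hy with hy | hy
    · rw [hy] at this; exact Real.Angle.pi_ne_zero this
    · rw [hy, Real.Angle.coe_neg, neg_eq_zero] at this; exact Real.Angle.pi_ne_zero this
  have hsub := intermediate_value_uIcc (f := f) (a := 0) (b := 1)
    (by rwa [Set.uIcc_of_le zero_le_one])
  rw [Set.uIcc_of_le (zero_le_one (α := ℝ)), hf0] at hsub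
  have hlt : |f 1 - 0| < 2 * Real.pi := by
    by_contra hc
    push Not at hc
    rw [sub_zero] at hc
    rcases le_total 0 (f 1) with h0 | h0
    · rw [abs_of_nonneg h0] at hc
      refine key Real.pi (Or.inl rfl) (hsub ?_)
      rw [Set.uIcc_of_le h0]
      exact ⟨Real.pi_pos.le, by linarith [Real.pi_pos]⟩
    · rw [abs_of_nonpos h0] at hc
      refine key (-Real.pi) (Or.inr rfl) (hsub ?_)
      rw [Set.uIcc_of_ge h0]
      exact ⟨by linarith [Real.pi_pos], by linarith [Real.pi_pos]⟩
  have h1 : f 1 = 0 := eq_of_angle_coe_eq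
    (by rw [hfa 1 (by simp), Real.Angle.coe_zero]) hlt
  simp only [hf, hP1] at h1
  linarith

/-- The degenerate case of `arg_square` at a common vertex of two consecutive edges `d` and `e`. -/
theorem arg_triangle {d e : ℂ} (hd : d ≠ 0) (h : e / d ∈ Complex.slitPlane) :
    Complex.arg ((d + e) / d) + Complex.arg (e / (d + e)) = Complex.arg (e / d) := by
  set r := e / d with hr
  have he : e = r * d := by rw [hr]; field_simp
  have hr0 : r ≠ 0 := Complex.slitPlane_ne_zero h
  have h1r : 1 + r ≠ 0 := by
    intro hc
    have : r = -1 := by linear_combination hc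
    rw [this, Complex.mem_slitPlane_iff] at h
    norm_num at h
  have e1 : (d + e) / d = 1 + r := by rw [he]; field_simp
  have e2 : e / (d + e) = r / (1 + r) := by
    rw [he, show d + r * d = (1 + r) * d by ring, mul_div_mul_right _ _ hd]
  rw [e1, e2]
  have hne : r / (1 + r) ≠ 0 := div_ne_zero hr0 h1r
  have him : (r / (1 + r)).im = r.im / Complex.normSq (1 + r) := by
    rw [Complex.div_im]
    simp
    ring
  have hns : 0 < Complex.normSq (1 + r) := Complex.normSq_pos.2 h1r
  have hang : ((Complex.arg (1 + r) + Complex.arg (r / (1 + r)) : ℝ) : Real.Angle)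
      = Complex.arg r := by
    rw [Real.Angle.coe_add, Complex.arg_div_coe_angle hr0 h1r]
    abel
  refine eq_of_angle_coe_eq hang ?_
  have b1 := Complex.arg_mem_Ioc (1 + r)
  have b2 := Complex.arg_mem_Ioc (r / (1 + r))
  have b3 := Complex.arg_mem_Ioc r
  have hpi := Real.pi_pos
  rcases lt_trichotomy r.im 0 with hi | hi | hi
  · have a1 : Complex.arg (1 + r) < 0 := Complex.arg_neg_iff.2 (by simpa using hi)
    have a2 : Complex.arg (r / (1 + r)) < 0 :=
      Complex.arg_neg_iff.2 (by rw [him]; exact div_neg_of_neg_of_pos hi hns)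
    have a3 : Complex.arg r < 0 := Complex.arg_neg_iff.2 hi
    rw [abs_lt]; constructor <;> linarith [b1.1, b2.1, b3.1]
  · have hre : 0 < r.re := by
      rcases Complex.mem_slitPlane_iff.1 h with h | h
      · exact h
      · exact absurd hi h
    have hrr : r = (r.re : ℂ) := by apply Complex.ext <;> simp [hi]
    have a1 : Complex.arg (1 + r) = 0 := by
      rw [hrr, show (1 + (r.re : ℂ)) = ((1 + r.re : ℝ) : ℂ) by push_cast; rfl]
      exact Complex.arg_ofReal_of_nonneg (by positivity)
    have a2 : Complex.arg (r / (1 + r)) = 0 := by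
      rw [hrr, show ((r.re : ℂ) / (1 + (r.re : ℂ))) = ((r.re / (1 + r.re) : ℝ) : ℂ) by push_cast; rfl]
      exact Complex.arg_ofReal_of_nonneg (by positivity)
    have a3 : Complex.arg r = 0 := by rw [hrr]; exact Complex.arg_ofReal_of_nonneg hre.le
    rw [a1, a2, a3]; simpa using hpi
  · have a1 : 0 ≤ Complex.arg (1 + r) := Complex.arg_nonneg_iff.2 (by simpa using hi.le)
    have a2 : 0 ≤ Complex.arg (r / (1 + r)) :=
      Complex.arg_nonneg_iff.2 (by rw [him]; exact (div_pos hi hns).le)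
    have a3 : 0 < Complex.arg r := by
      rcases (Complex.arg_nonneg_iff.2 hi.le).lt_or_eq with h | h
      · exact h
      · exact absurd (Complex.arg_eq_zero_iff.1 h.symm).2 hi.ne'
    rw [abs_lt]; constructor <;> linarith [b1.2, b2.2, b3.2]

/-- The total turning of the arc `z 0, …, z k` at its inner vertices `z 1, …, z i`, lifted so that
it starts with the principal argument of the first edge: a lift of the direction angle of the
`i`-th edge. -/
noncomputable def edgeAngle (z : ℕ → ℂ) : ℕ → ℝ
  | 0 => Complex.arg (z 1 - z 0)
  | i + 1 => edgeAngle z i + Complex.arg ((z (i + 2) - z (i + 1)) / (z (i + 1) - z i))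

/-- A lift of the direction angle of the chord from `z i` to `z (i + 1 + m)`, continued from the
one of the `i`-th edge. -/
noncomputable def chordAngle (z : ℕ → ℂ) (i : ℕ) : ℕ → ℝ
  | 0 => edgeAngle z i
  | m + 1 => chordAngle z i m +
      Complex.arg ((z (i + m + 2) - z i) / (z (i + m + 1) - z i))

theorem edgeAngle_coe {z : ℕ → ℂ} {N : ℕ} (hne : ∀ i < N, z (i + 1) - z i ≠ 0) :
    ∀ i < N, (edgeAngle z i : Real.Angle) = Complex.arg (z (i + 1) - z i) := by
  intro i
  induction i with
  | zero => intro _; rfl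
  | succ i ih =>
    intro hi
    rw [edgeAngle, Real.Angle.coe_add, ih (by omega),
      Complex.arg_div_coe_angle (hne _ hi) (hne _ (by omega))]
    abel

theorem chordAngle_succ_left {z : ℕ → ℂ} {N : ℕ}
    (hdis : ∀ i k, i + 1 < k → k < N →
      Disjoint (segment ℝ (z i) (z (i + 1))) (segment ℝ (z k) (z (k + 1))))
    (hne : ∀ i < N, z (i + 1) - z i ≠ 0)
    (hturn : ∀ i, i + 1 < N → (z (i + 2) - z (i + 1)) / (z (i + 1) - z i) ∈ Complex.slitPlane)
    (i m : ℕ) (h : i + m + 1 < N) :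
    chordAngle z (i + 1) m = chordAngle z i (m + 1) +
      Complex.arg ((z (i + m + 2) - z (i + 1)) / (z (i + m + 2) - z i)) := by
  induction m with
  | zero =>
    simp only [chordAngle, edgeAngle, add_zero]
    have := arg_triangle (hne i (by omega)) (hturn i (by omega))
    rw [show z (i + 1) - z i + (z (i + 2) - z (i + 1)) = z (i + 2) - z i by ring] at this
    linarith
  | succ m ih =>
    rw [chordAngle, ih (by omega)]
    conv_rhs => rw [chordAngle]
    have := arg_square (hdis i (i + m + 2) (by omega) (by omega))
    rw [show i + 1 + m + 2 = i + m + 3 by ring, show i + 1 + m + 1 = i + m + 2 by ring,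
      show i + (m + 1) + 2 = i + m + 3 by ring, show i + (m + 1) + 1 = i + m + 2 by ring]
    linarith

/-- A simple polygonal arc that starts at the left end and stops at the right end of a horizontal
chord, runs above the chord in between, and turns left at all its inner vertices but one, rises up
to that vertex and falls behind it. The reason is Hopf's theorem on turning tangents: the angle
swept by the edges equals the angle swept by the chords, first those from the initial vertex, then
those to the final one. -/
theorem monotone_of_left_turns {z : ℕ → ℂ} {N t : ℕ} (ht0 : 0 < t) (htN : t < N)
    (hdis : ∀ i k, i + 1 < k → k < N →
      Disjoint (segment ℝ (z i) (z (i + 1))) (segment ℝ (z k) (z (k + 1))))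
    (hne : ∀ i < N, z (i + 1) - z i ≠ 0)
    (hturn : ∀ i, i + 1 < N → (z (i + 2) - z (i + 1)) / (z (i + 1) - z i) ∈ Complex.slitPlane)
    (hleft : ∀ i, i + 1 < N → i + 1 ≠ t →
      0 < ((z (i + 2) - z (i + 1)) / (z (i + 1) - z i)).im)
    (hre : 0 < (z N - z 0).re) (him : (z N - z 0).im = 0)
    (habove : ∀ i, 0 < i → i < N → 0 < (z i - z 0).im) :
    (∀ i < t, 0 < (z (i + 1) - z i).im) ∧ ∀ i, t ≤ i → i < N → (z (i + 1) - z i).im < 0 := by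
  have hpi := Real.pi_pos
  -- the directions of the chords from the initial vertex
  have argpos : ∀ {w : ℂ}, 0 < w.im → 0 < Complex.arg w ∧ Complex.arg w < Real.pi := by
    intro w hw
    refine ⟨?_, Complex.arg_lt_pi_iff.2 (Or.inr hw.ne')⟩
    rcases (Complex.arg_nonneg_iff.2 hw.le).lt_or_eq with h | h
    · exact h
    · exact absurd (Complex.arg_eq_zero_iff.1 h.symm).2 hw.ne'
  have argneg : ∀ {w : ℂ}, w.im < 0 → -Real.pi < Complex.arg w ∧ Complex.arg w < 0 := fun hw =>
    ⟨Complex.neg_pi_lt_arg _, Complex.arg_neg_iff.2 hw⟩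
  have argN : Complex.arg (z N - z 0) = 0 := Complex.arg_eq_zero_iff.2 ⟨hre.le, him⟩
  have b0 : ∀ k, 0 < k → k ≤ N → z k - z 0 ≠ 0 ∧ 0 ≤ Complex.arg (z k - z 0) ∧
      Complex.arg (z k - z 0) < Real.pi := by
    intro k hk hkN
    rcases hkN.lt_or_eq with h | rfl
    · have := habove k hk h
      exact ⟨fun hc => by rw [hc] at this; simp at this, (argpos this).1.le, (argpos this).2⟩
    · exact ⟨fun hc => by rw [hc] at hre; simp at hre, argN.ge, argN ▸ hpi⟩
  have row0 : ∀ m, m + 1 ≤ N → chordAngle z 0 m = Complex.arg (z (m + 1) - z 0) := by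
    intro m
    induction m with
    | zero => intro _; rfl
    | succ m ih =>
      intro hm
      rw [chordAngle, ih (by omega), zero_add]
      obtain ⟨n1, l1, u1⟩ := b0 (m + 1) (by omega) (by omega)
      obtain ⟨n2, l2, u2⟩ := b0 (m + 2) (by omega) (by omega)
      rw [arg_div_eq_sub n1 n2 (by rw [abs_lt]; constructor <;> linarith)]
      ring
  -- the directions of the chords to the final vertex
  have bN : ∀ i < N, z N - z i ≠ 0 ∧ -Real.pi < Complex.arg (z N - z i) ∧
      Complex.arg (z N - z i) ≤ 0 := by
    intro i hi
    rcases Nat.eq_zero_or_pos i with rfl | h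
    · exact ⟨fun hc => by rw [hc] at hre; simp at hre, by rw [argN]; linarith, argN.le⟩
    · have h1 := habove i h hi
      have h2 : (z N - z i).im < 0 := by
        simp only [Complex.sub_im] at him h1 ⊢; linarith
      exact ⟨fun hc => by rw [hc] at h2; simp at h2, (argneg h2).1, (argneg h2).2.le⟩
  have colN : ∀ i m, i + m + 1 = N → chordAngle z i m = Complex.arg (z N - z i) := by
    intro i
    induction i with
    | zero =>
      intro m hm
      rw [row0 m (by omega)]
      congr 3
      omega
    | succ i ih =>
      intro m hm
      rw [chordAngle_succ_left hdis hne hturn i m (by omega), ih (m + 1) (by omega),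
        show i + m + 2 = N by omega]
      obtain ⟨n1, l1, u1⟩ := bN i (by omega)
      obtain ⟨n2, l2, u2⟩ := bN (i + 1) (by omega)
      rw [arg_div_eq_sub n1 n2 (by rw [abs_lt]; constructor <;> linarith)]
      ring
  obtain ⟨M, rfl⟩ : ∃ M, N = M + 1 := ⟨N - 1, by omega⟩
  have hlast : edgeAngle z M < 0 := by
    have h1 := colN M 0 rfl
    rw [chordAngle] at h1
    rw [h1]
    have h2 := habove M (by omega) (by omega)
    refine (argneg ?_).2
    simp only [Complex.sub_im] at him h2 ⊢; linarith
  have hfirst : 0 < edgeAngle z 0 := by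
    rw [edgeAngle]
    exact (argpos (habove 1 (by omega) (by omega))).1
  have step : ∀ i, i + 1 < M + 1 → i + 1 ≠ t → edgeAngle z i < edgeAngle z (i + 1) := by
    intro i h1 h2
    rw [edgeAngle]
    linarith [(argpos (hleft i h1 h2)).1]
  have up : ∀ i, i < t → 0 < edgeAngle z i := by
    intro i
    induction i with
    | zero => intro _; exact hfirst
    | succ i ih =>
      intro hi
      exact (ih (by omega)).trans (step i (by omega) (by omega))
  have down : ∀ m i, i + m = M → t ≤ i → edgeAngle z i < 0 := by
    intro m
    induction m with
    | zero => intro i hi _; rw [show i = M by omega]; exact hlast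
    | succ m ih =>
      intro i hi hti
      exact (step i (by omega) (by omega)).trans (ih (i + 1) (by omega) (by omega))
  obtain ⟨s, rfl⟩ : ∃ s, t = s + 1 := ⟨t - 1, by omega⟩
  have hapex : edgeAngle z s < edgeAngle z (s + 1) + Real.pi := by
    conv_rhs => rw [edgeAngle]
    linarith [Complex.neg_pi_lt_arg ((z (s + 2) - z (s + 1)) / (z (s + 1) - z s))]
  have hd := down (M - (s + 1)) (s + 1) (by omega) le_rfl
  have hu := up s (by omega)
  have up' : ∀ m i, i + m = s → edgeAngle z i < Real.pi := by
    intro m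
    induction m with
    | zero => intro i hi; rw [show i = s by omega]; linarith
    | succ m ih => intro i hi; exact (step i (by omega) (by omega)).trans (ih (i + 1) (by omega))
  have down' : ∀ m, s + 1 + m < M + 1 → -Real.pi < edgeAngle z (s + 1 + m) := by
    intro m
    induction m with
    | zero => intro _; simp only [add_zero]; linarith
    | succ m ih => intro hi; exact (ih (by omega)).trans (step (s + 1 + m) (by omega) (by omega))
  have him_sin : ∀ i < M + 1, (z (i + 1) - z i).im = ‖z (i + 1) - z i‖ * Real.sin (edgeAngle z i) := by
    intro i hi
    rw [← Real.Angle.sin_coe, edgeAngle_coe hne i hi, Real.Angle.sin_coe, Complex.norm_mul_sin_arg]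
  constructor
  · intro i hi
    rw [him_sin i (by omega)]
    exact mul_pos (norm_pos_iff.2 (hne i (by omega)))
      (Real.sin_pos_of_pos_of_lt_pi (up i hi) (up' (s - i) i (by omega)))
  · intro i hti hi
    rw [him_sin i hi]
    refine mul_neg_of_pos_of_neg (norm_pos_iff.2 (hne i hi)) ?_
    refine Real.sin_neg_of_neg_of_neg_pi_lt (down (M - i) i (by omega) hti) ?_
    have := down' (i - (s + 1)) (by omega)
    rwa [show s + 1 + (i - (s + 1)) = i by omega] at this

/-! ### Points outside the polygon and supporting lines -/

section region
variable {n : ℕ} [NeZero n] {v : Fin n → Plane}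

theorem not_mem_region_of_ray {x w : Plane} (hw : w ≠ 0)
    (h : ∀ s : ℝ, 0 ≤ s → x + s • w ∉ boundary v) : x ∉ region v := by
  have hx : x ∉ boundary v := by simpa using h 0 le_rfl
  rintro (hb | ⟨-, hb⟩)
  · exact hx hb
  have hray : (fun s : ℝ => x + s • w) '' Set.Ici 0 ⊆ connectedComponentIn (boundary v)ᶜ x := by
    refine IsPreconnected.subset_connectedComponentIn ?_ ⟨0, Set.self_mem_Ici, by simp⟩ ?_
    · exact isPreconnected_Ici.image _ (by fun_prop)
    · rintro _ ⟨s, hs, rfl⟩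
      exact h s hs
  obtain ⟨c, hc⟩ := (hb.subset hray).exists_norm_le
  have hwn : 0 < ‖w‖ := norm_pos_iff.2 hw
  have hc0 : 0 ≤ c := (norm_nonneg _).trans (hc _ ⟨0, Set.self_mem_Ici, rfl⟩)
  have h1 := hc _ ⟨(c + ‖x‖ + 1) / ‖w‖, by simp only [Set.mem_Ici]; positivity, rfl⟩
  have h2 : ‖((c + ‖x‖ + 1) / ‖w‖) • w‖ = c + ‖x‖ + 1 := by
    rw [norm_smul, Real.norm_of_nonneg (by positivity)]
    field_simp
  have h3 : ‖((c + ‖x‖ + 1) / ‖w‖) • w‖ ≤ ‖x + ((c + ‖x‖ + 1) / ‖w‖) • w‖ + ‖x‖ := by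
    have := norm_sub_le (x + ((c + ‖x‖ + 1) / ‖w‖) • w) x
    simpa using this
  simp only at h1
  linarith

theorem mem_region_of_isPreconnected {S : Set Plane} (hS : IsPreconnected S)
    (hd : Disjoint S (boundary v)) {x y : Plane} (hx : x ∈ S) (hy : y ∈ S) (h : x ∈ region v) :
    y ∈ region v := by
  have hsub : S ⊆ (boundary v)ᶜ := Set.disjoint_left.1 hd
  rcases h with h | ⟨-, h⟩
  · exact absurd h (hsub hx)
  · refine Or.inr ⟨hsub hy, ?_⟩
    rwa [← connectedComponentIn_eq (hS.subset_connectedComponentIn hx hsub hy)]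

theorem le_of_mem_boundary {a b c : ℝ} (h : ∀ i, a * (v i).1 + b * (v i).2 ≤ c) {x : Plane}
    (hx : x ∈ boundary v) : a * x.1 + b * x.2 ≤ c := by
  obtain ⟨i, s, t, hs, ht, hst, rfl⟩ := Set.mem_iUnion.1 hx
  have h1 := mul_le_mul_of_nonneg_left (h i) hs
  have h2 := mul_le_mul_of_nonneg_left (h (i + 1)) ht
  have h3 : s * c + t * c = c := by rw [← add_mul, hst, one_mul]
  simp only [Prod.fst_add, Prod.smul_fst, Prod.snd_add, Prod.smul_snd, smul_eq_mul]
  linarith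

theorem orient_combination (p q x y : Plane) {s t : ℝ} (h : s + t = 1) :
    orient p q (s • x + t • y) = s * orient p q x + t * orient p q y := by
  simp only [orient, Prod.fst_add, Prod.smul_fst, Prod.snd_add, Prod.smul_snd, smul_eq_mul]
  obtain rfl : t = 1 - s := by linarith
  ring

theorem isCompact_edge (v : Fin n → Plane) (i : Fin n) : IsCompact (edge v i) := by
  rw [edge, segment_eq_image_lineMap]
  exact isCompact_Icc.image (by fun_prop)

/-- At a vertex on a supporting line a clockwise polygon does not turn left. Otherwise a point of
the polygon next to the midpoint of the outgoing edge, on its right side, can be moved parallel to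
this edge until it has passed the vertex, and then leave to infinity across the supporting line. -/
theorem not_left_turn_of_supporting (hs : IsSimplePolygon v) (hc : IsClockwise v) (j : Fin n)
    {a b : ℝ} (hab : a ≠ 0 ∨ b ≠ 0)
    (hmax : ∀ k, a * (v k).1 + b * (v k).2 ≤ a * (v j).1 + b * (v j).2) :
    ¬ 0 < orient (v (j - 1)) (v j) (v (j + 1)) := by
  intro hturn
  have h3 := hs.three_le
  have one_ne : (1 : Fin n) ≠ 0 := by
    obtain ⟨m, rfl⟩ : ∃ m, n = m + 3 := ⟨n - 3, by omega⟩
    simp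
  have hjj : j ≠ j + 1 := by simpa using one_ne
  set d : Plane := v (j + 1) - v j with hd
  set N : Plane := (d.2, -d.1) with hN
  have hd0 : d ≠ 0 := fun h => hjj (hs.injective (sub_eq_zero.1 h)).symm
  have hdd : 0 < d.1 ^ 2 + d.2 ^ 2 := by
    by_contra hcon
    apply hd0
    have e1 : d.1 = 0 := by nlinarith [sq_nonneg d.1, sq_nonneg d.2]
    have e2 : d.2 = 0 := by nlinarith [sq_nonneg d.1, sq_nonneg d.2]
    exact Prod.ext e1 e2
  -- the other edges keep a distance from the first half of the outgoing edge
  set K : Set Plane := ⋃ k ∈ {k | k ≠ j ∧ k ≠ j - 1}, edge v k with hK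
  have hKc : IsClosed K :=
    (Set.toFinite _).isClosed_biUnion fun k _ => (isCompact_edge v k).isClosed
  set φ : ℝ × ℝ → Plane := fun q => v j + q.1 • d + q.2 • N with hφ
  have hφc : Continuous φ := by fun_prop
  have hmemj : ∀ q ∈ Set.Icc (0 : ℝ) (1 / 2), v j + q • d ∈ edge v j := by
    intro q hq
    refine ⟨1 - q, q, by linarith [hq.2], hq.1, by ring, ?_⟩
    rw [hd]; module
  have hKd : Set.Icc (0 : ℝ) (1 / 2) ×ˢ {(0 : ℝ)} ⊆ φ ⁻¹' Kᶜ := by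
    rintro ⟨q, r⟩ ⟨hq, hr⟩
    obtain rfl : r = 0 := hr
    intro hmem
    obtain ⟨k, ⟨hkj, hkj'⟩, hk⟩ := Set.mem_iUnion₂.1 hmem
    have e : φ (q, 0) = v j + q • d := by simp [hφ]
    rw [e] at hk
    by_cases hk1 : k = j + 1
    · subst hk1
      have h1 : v j + q • d ∈ ({v (j + 1)} : Set Plane) := by
        rw [← hs.consecutive j]; exact ⟨hmemj q hq, hk⟩
      have h2 : (1 - q) • d = 0 := by
        rw [Set.mem_singleton_iff] at h1
        rw [show (1 - q) • d = v (j + 1) - (v j + q • d) by rw [hd]; module, h1, sub_self]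
      rcases smul_eq_zero.1 h2 with h | h
      · linarith [hq.2]
      · exact hd0 h
    · refine Set.disjoint_left.1 (hs.disjoint j k (Ne.symm hkj) hk1 ?_) (hmemj q hq) hk
      rintro rfl
      exact hkj' (by simp)
  obtain ⟨U, W, hU, hW, hUs, hWs, hUW⟩ := generalized_tube_lemma isCompact_Icc
    isCompact_singleton (hKc.isOpen_compl.preimage hφc) hKd
  obtain ⟨ε, hε, hεU⟩ := Metric.isOpen_iff.1 hU 0 (hUs ⟨le_rfl, by norm_num⟩)
  have hIU : Set.Icc (-(ε / 2)) (1 / 2) ⊆ U := by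
    intro q hq
    rcases le_total 0 q with h0 | h0
    · exact hUs ⟨h0, hq.2⟩
    · apply hεU
      rw [Metric.mem_ball, Real.dist_eq, sub_zero, abs_of_nonpos h0]
      linarith [hq.1]
  -- the parallel segments miss the boundary
  have hmiss : ∀ q ∈ Set.Icc (-(ε / 2)) (1 / 2 : ℝ), ∀ s ∈ W, 0 < s → φ (q, s) ∉ boundary v := by
    intro q hq s hsW hs0 hmem
    obtain ⟨k, hk⟩ := Set.mem_iUnion.1 hmem
    have ho : orient (v j) (v (j + 1)) (φ (q, s)) < 0 := by
      have : orient (v j) (v (j + 1)) (φ (q, s)) = -s * (d.1 ^ 2 + d.2 ^ 2) := by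
        simp only [orient, hφ, hN, hd, Prod.fst_add, Prod.smul_fst, Prod.snd_add, Prod.smul_snd,
          smul_eq_mul, Prod.fst_sub, Prod.snd_sub]
        ring
      rw [this]; nlinarith
    have hend : ∀ x y : Plane, 0 ≤ orient (v j) (v (j + 1)) x →
        0 ≤ orient (v j) (v (j + 1)) y → φ (q, s) ∉ segment ℝ x y := by
      rintro x y hx hy ⟨c, e, hc, he, hce, h⟩
      rw [← h, orient_combination _ _ _ _ hce] at ho
      nlinarith [mul_nonneg hc hx, mul_nonneg he hy]
    have o1 : orient (v j) (v (j + 1)) (v j) = 0 := by simp [orient]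
    have o2 : orient (v j) (v (j + 1)) (v (j + 1)) = 0 := by simp only [orient]; ring
    by_cases hkj : k = j
    · subst hkj
      exact hend _ _ o1.ge o2.ge hk
    by_cases hkj' : k = j - 1
    · subst hkj'
      rw [edge, sub_add_cancel] at hk
      refine hend _ _ ?_ o1.ge hk
      have : orient (v j) (v (j + 1)) (v (j - 1)) = orient (v (j - 1)) (v j) (v (j + 1)) := by
        simp only [orient]; ring
      rw [this]; exact hturn.le
    · have h1 : φ (q, s) ∈ Kᶜ := hUW (Set.mk_mem_prod (hIU hq) hsW)
      exact h1 (Set.mem_iUnion₂.2 ⟨k, ⟨hkj, hkj'⟩, hk⟩)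
  -- behind the vertex they leave the half-plane that contains the polygon
  have hld : a * d.1 + b * d.2 ≤ 0 := by
    have := hmax (j + 1)
    simp only [hd, Prod.fst_sub, Prod.snd_sub]; linarith
  have hout : ∀ᶠ s : ℝ in 𝓝[>] 0,
      0 < -(ε / 2) * (a * d.1 + b * d.2) + s * (a * d.2 - b * d.1) := by
    rcases hld.lt_or_eq with hneg | hzero
    · have hcont : ContinuousAt
          (fun s : ℝ => -(ε / 2) * (a * d.1 + b * d.2) + s * (a * d.2 - b * d.1)) 0 := by fun_prop
      refine (hcont.eventually_const_lt ?_).filter_mono nhdsWithin_le_nhds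
      nlinarith
    · have hpos : 0 < a * d.2 - b * d.1 := by
        set w : Plane := v (j - 1) - v j with hw
        have hw1 : a * w.1 + b * w.2 ≤ 0 := by
          have := hmax (j - 1)
          simp only [hw, Prod.fst_sub, Prod.snd_sub]; linarith
        have hw2 : 0 < d.1 * w.2 - d.2 * w.1 := by
          have : d.1 * w.2 - d.2 * w.1 = orient (v (j - 1)) (v j) (v (j + 1)) := by
            simp only [orient, hw, hd, Prod.fst_sub, Prod.snd_sub]; ring
          rw [this]; exact hturn
        have e1 : (d.1 ^ 2 + d.2 ^ 2) * (a * w.1 + b * w.2) =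
            (d.1 * w.1 + d.2 * w.2) * (a * d.1 + b * d.2) -
              (d.1 * w.2 - d.2 * w.1) * (a * d.2 - b * d.1) := by ring
        rw [hzero, mul_zero, zero_sub] at e1
        have h0 : 0 ≤ a * d.2 - b * d.1 := by
          by_contra hcon
          push Not at hcon
          nlinarith [mul_pos hw2 (neg_pos.2 hcon), mul_nonneg hdd.le (neg_nonneg.2 hw1)]
        refine h0.lt_of_ne fun h => ?_
        have e2 : a * (d.1 ^ 2 + d.2 ^ 2) = 0 := by
          linear_combination d.1 * hzero - d.2 * h
        have e3 : b * (d.1 ^ 2 + d.2 ^ 2) = 0 := by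
          linear_combination d.2 * hzero + d.1 * h
        rcases hab with h | h
        · exact h ((mul_eq_zero.1 e2).resolve_right hdd.ne')
        · exact h ((mul_eq_zero.1 e3).resolve_right hdd.ne')
      filter_upwards [self_mem_nhdsWithin] with s hs
      rw [hzero]
      have := mul_pos (Set.mem_Ioi.1 hs) hpos
      linarith
  have hWn : ∀ᶠ s : ℝ in 𝓝[>] 0, s ∈ W :=
    nhdsWithin_le_nhds (hW.mem_nhds (hWs rfl))
  obtain ⟨s, hs1, hs2, hs3, hs4⟩ :=
    (hout.and (hWn.and ((hc j).and self_mem_nhdsWithin))).exists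
  have hs0 : 0 < s := hs4
  have hin : φ (1 / 2, s) ∈ region v := by
    convert hs3 using 1
    rw [midpoint_eq_smul_add]
    simp only [hφ, hN, hd]
    simp only [Prod.fst_sub, Prod.snd_sub, invOf_eq_inv]
    congr 1
    module
  set S : Set Plane := (fun q => φ (q, s)) '' Set.Icc (-(ε / 2)) (1 / 2) with hSdef
  have hS : IsPreconnected S := isPreconnected_Icc.image _ (by fun_prop)
  have hSd : Disjoint S (boundary v) := by
    rw [Set.disjoint_left]
    rintro _ ⟨q, hq, rfl⟩
    exact hmiss q hq s hs2 hs0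
  have hy := mem_region_of_isPreconnected hS hSd
    ⟨1 / 2, ⟨by linarith, le_rfl⟩, rfl⟩ ⟨-(ε / 2), ⟨le_rfl, by linarith⟩, rfl⟩ hin
  refine not_mem_region_of_ray (w := (a, b)) ?_ ?_ hy
  · intro h
    rw [Prod.mk_eq_zero] at h
    tauto
  · intro r hr hmem
    have := le_of_mem_boundary hmax hmem
    simp only [hφ, hN, Prod.fst_add, Prod.smul_fst, Prod.snd_add, Prod.smul_snd, smul_eq_mul]
      at this
    nlinarith [mul_nonneg hr (add_nonneg (sq_nonneg a) (sq_nonneg b))]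

end region

section base
variable {n : ℕ} [NeZero n] {v : Fin n → Plane}

/-- The base of a funnel polygon is an edge of its convex hull: of a lowest and a highest vertex
at most one is the apex, and the other vertices off the base are reflex. -/
theorem IsFunnel.orient_base_pos (hv : IsFunnel v) (k : Fin n) (hk0 : k ≠ 0) (hk1 : k ≠ -1) :
    0 < orient (v 0) (v (-1)) (v k) := by
  obtain ⟨t, -, -, hreflex⟩ := hv.chains
  set a : ℝ := -((v (-1)).2 - (v 0).2) with ha
  set b : ℝ := (v (-1)).1 - (v 0).1 with hb
  have horient : ∀ x : Plane, orient (v 0) (v (-1)) x =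
      (a * x.1 + b * x.2) - (a * (v 0).1 + b * (v 0).2) := by
    intro x; simp only [orient, ha, hb]; ring
  have hconv : 0 < orient (v 0) (v (-1)) (v 1) := by
    have h := hv.convex_first
    rw [IsConvexVertex, zero_sub, zero_add] at h
    have : orient (v 0) (v (-1)) (v 1) = -orient (v (-1)) (v 0) (v 1) := by
      simp only [orient]; ring
    rw [this]; linarith
  have o0 : orient (v 0) (v (-1)) (v 0) = 0 := by simp [orient]
  have o1 : orient (v 0) (v (-1)) (v (-1)) = 0 := by simp only [orient]; ring
  have hab : a ≠ 0 ∨ b ≠ 0 := by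
    by_contra h
    push Not at h
    rw [horient, h.1, h.2] at hconv
    simp at hconv
  have hmaxt : ∀ j, (∀ k, orient (v 0) (v (-1)) (v k) ≤ orient (v 0) (v (-1)) (v j)) →
      j = t := by
    intro j hj
    by_contra hjt
    have hpos : 0 < orient (v 0) (v (-1)) (v j) := hconv.trans_le (hj 1)
    refine not_left_turn_of_supporting hv.simple hv.clockwise j hab (fun k => ?_)
      (hreflex j ?_ ?_ hjt)
    · have := hj k
      rw [horient, horient] at this
      linarith
    · rintro rfl; rw [o0] at hpos; exact lt_irrefl _ hpos
    · rintro rfl; rw [o1] at hpos; exact lt_irrefl _ hpos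
  have hmint : ∀ j, j ≠ 0 → j ≠ -1 →
      (∀ k, orient (v 0) (v (-1)) (v j) ≤ orient (v 0) (v (-1)) (v k)) → j = t := by
    intro j hj0 hj1 hj
    by_contra hjt
    refine not_left_turn_of_supporting hv.simple hv.clockwise j (a := -a) (b := -b)
      (by simpa using hab) (fun k => ?_) (hreflex j hj0 hj1 hjt)
    have := hj k
    rw [horient, horient] at this
    linarith
  obtain ⟨M, hM⟩ := Finite.exists_max fun k => orient (v 0) (v (-1)) (v k)
  obtain ⟨m, hm⟩ := Finite.exists_min fun k => orient (v 0) (v (-1)) (v k)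
  have hMt := hmaxt M hM
  by_contra hneg
  push Not at hneg
  have hmneg : orient (v 0) (v (-1)) (v m) ≤ 0 := (hm k).trans hneg
  have hMpos : 0 < orient (v 0) (v (-1)) (v M) := hconv.trans_le (hM 1)
  have hne : m ≠ t := by rintro rfl; rw [hMt] at hMpos; linarith
  by_cases hm0 : m = 0 ∨ m = -1
  · have hz : orient (v 0) (v (-1)) (v m) = 0 := by
      rcases hm0 with rfl | rfl
      exacts [o0, o1]
    have hk := hmint k hk0 hk1 fun i => by rw [hz] at hm; exact hneg.trans (hm i)
    rw [hk, ← hMt] at hneg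
    linarith
  · push Not at hm0
    exact hne (hmint m hm0.1 hm0.2 hm)

end base

/-! ### Two facing convex chains, in coordinates adapted to the base -/

/-- The line through the vertices `i` and `i + 1` of the chain with abscissae `x` and strictly
increasing ordinates `y`, as a function from ordinates to abscissae. -/
noncomputable def line (x y : ℕ → ℝ) (i : ℕ) (η : ℝ) : ℝ :=
  x i + (x (i + 1) - x i) / (y (i + 1) - y i) * (η - y i)

/-- A rising chain with `p` edges that turns left at its inner vertices, i.e. the graph, over the
`y`-axis, of a strictly concave piecewise affine function. -/
structure ConcaveChain (p : ℕ) (x y : ℕ → ℝ) : Prop where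
  rising : ∀ i < p, y i < y (i + 1)
  turn : ∀ i, i + 1 < p →
    (x (i + 2) - x (i + 1)) / (y (i + 2) - y (i + 1)) < (x (i + 1) - x i) / (y (i + 1) - y i)

theorem line_self (x y : ℕ → ℝ) (i : ℕ) : line x y i (y i) = x i := by simp [line]

theorem line_neg (x y : ℕ → ℝ) (i : ℕ) (η : ℝ) :
    line (fun k => -x k) y i η = -line x y i η := by
  simp only [line]; ring

theorem line_affine (x y : ℕ → ℝ) (i : ℕ) (η θ : ℝ) :
    line x y i η = line x y i θ + (x (i + 1) - x i) / (y (i + 1) - y i) * (η - θ) := by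
  simp only [line]; ring

namespace ConcaveChain

variable {p : ℕ} {x y : ℕ → ℝ}

theorem y_lt (h : ConcaveChain p x y) {i k : ℕ} (hik : i < k) (hk : k ≤ p) : y i < y k := by
  induction k, hik using Nat.le_induction with
  | base => exact h.rising i (by omega)
  | succ k hik ih => exact (ih (by omega)).trans (h.rising k (by omega))

theorem y_le (h : ConcaveChain p x y) {i k : ℕ} (hik : i ≤ k) (hk : k ≤ p) : y i ≤ y k := by
  rcases hik.eq_or_lt with rfl | hlt
  · exact le_rfl
  · exact (h.y_lt hlt hk).le

theorem line_succ (h : ConcaveChain p x y) {i : ℕ} (hi : i < p) :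
    line x y i (y (i + 1)) = x (i + 1) := by
  have := sub_pos.2 (h.rising i hi)
  simp only [line]
  field_simp
  ring

theorem line_lt_of_gt (h : ConcaveChain p x y) {i : ℕ} (hi : i + 1 < p) {η : ℝ}
    (hη : y (i + 1) < η) : line x y (i + 1) η < line x y i η := by
  rw [line_affine x y i η (y (i + 1)), line_affine x y (i + 1) η (y (i + 1)), line_self,
    h.line_succ (by omega)]
  have := mul_lt_mul_of_pos_right (h.turn i hi) (sub_pos.2 hη)
  simp only [add_assoc, Nat.reduceAdd] at this ⊢
  linarith

theorem line_lt_of_lt (h : ConcaveChain p x y) {i : ℕ} (hi : i + 1 < p) {η : ℝ}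
    (hη : η < y (i + 1)) : line x y i η < line x y (i + 1) η := by
  rw [line_affine x y i η (y (i + 1)), line_affine x y (i + 1) η (y (i + 1)), line_self,
    h.line_succ (by omega)]
  have := mul_lt_mul_of_pos_right (h.turn i hi) (sub_pos.2 hη)
  simp only [add_assoc, Nat.reduceAdd] at this ⊢
  linarith

theorem line_strict_anti (h : ConcaveChain p x y) {i k : ℕ} (hik : i < k) (hk : k < p) {η : ℝ}
    (hη : y k < η) : line x y k η < line x y i η := by
  induction k, hik using Nat.le_induction with
  | base => exact h.line_lt_of_gt hk hη
  | succ k hik ih =>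
    exact (h.line_lt_of_gt hk hη).trans (ih (by omega) ((h.rising k (by omega)).trans hη))

theorem line_strict_mono (h : ConcaveChain p x y) {i k : ℕ} (hik : i < k) (hk : k < p) {η : ℝ}
    (hη : η < y (i + 1)) : line x y i η < line x y k η := by
  induction k, hik using Nat.le_induction with
  | base => exact h.line_lt_of_lt hk hη
  | succ k hik ih =>
    exact (ih (by omega)).trans
      (h.line_lt_of_lt hk (hη.trans_le (h.y_le (by omega) (by omega))))

theorem line_anti (h : ConcaveChain p x y) {i k : ℕ} (hik : i ≤ k) (hk : k < p) {η : ℝ}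
    (hη : y k ≤ η) : line x y k η ≤ line x y i η := by
  rcases hik.eq_or_lt with rfl | hlt
  · exact le_rfl
  rcases hη.lt_or_eq with hη | rfl
  · exact (h.line_strict_anti hlt hk hη).le
  · obtain ⟨m, rfl⟩ : ∃ m, k = m + 1 := ⟨k - 1, by omega⟩
    rw [line_self, ← h.line_succ (i := m) (by omega)]
    rcases (Nat.lt_succ_iff.1 hlt).eq_or_lt with rfl | hlt'
    · exact le_rfl
    · exact (h.line_strict_anti hlt' (by omega) (h.rising m (by omega))).le

theorem line_mono (h : ConcaveChain p x y) {i k : ℕ} (hik : i ≤ k) (hk : k < p) {η : ℝ}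
    (hη : η ≤ y (i + 1)) : line x y i η ≤ line x y k η := by
  rcases hik.eq_or_lt with rfl | hlt
  · exact le_rfl
  rcases hη.lt_or_eq with hη | rfl
  · exact (h.line_strict_mono hlt hk hη).le
  · rw [h.line_succ (by omega), ← line_self x y (i + 1)]
    rcases (Nat.succ_le_iff.2 hlt).eq_or_lt with rfl | hlt'
    · exact le_rfl
    · exact (h.line_strict_mono hlt' hk (h.rising (i + 1) (by omega))).le

/-- Within the slab of an edge, the chain is the lowest of the lines through its edges. -/
theorem line_le_of_slab (h : ConcaveChain p x y) {i k : ℕ} (hi : i < p) (hk : k < p) {η : ℝ}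
    (h1 : y k ≤ η) (h2 : η ≤ y (k + 1)) : line x y k η ≤ line x y i η := by
  rcases le_total i k with hik | hik
  · exact h.line_anti hik hk h1
  · exact h.line_mono hik hi h2

theorem le_line (h : ConcaveChain p x y) {i k : ℕ} (hi : i < p) (hk : k ≤ p) :
    x k ≤ line x y i (y k) := by
  rcases hk.lt_or_eq with hk | rfl
  · rw [← line_self x y k]
    exact h.line_le_of_slab hi hk le_rfl (h.rising k hk).le
  · obtain ⟨m, rfl⟩ : ∃ m, k = m + 1 := ⟨k - 1, by omega⟩
    rw [← h.line_succ (i := m) (by omega)]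
    exact h.line_le_of_slab hi (by omega) (h.rising m (by omega)).le le_rfl

theorem lt_line (h : ConcaveChain p x y) {i k : ℕ} (hi : i < p) (hk : k ≤ p) (h1 : k ≠ i)
    (h2 : k ≠ i + 1) : x k < line x y i (y k) := by
  rcases lt_or_gt_of_ne h1 with hlt | hgt
  · rw [← line_self x y k]
    exact h.line_strict_mono hlt hi (h.rising k (by omega))
  · obtain ⟨m, rfl⟩ : ∃ m, k = m + 1 := ⟨k - 1, by omega⟩
    rw [← h.line_succ (i := m) (by omega)]
    exact h.line_strict_anti (by omega) (by omega) (h.rising m (by omega))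

theorem exists_slab (_ : ConcaveChain p x y) (hp : 0 < p) {η : ℝ} (h1 : y 0 ≤ η)
    (h2 : η ≤ y p) : ∃ k < p, y k ≤ η ∧ η ≤ y (k + 1) := by
  have : ∀ m, 0 < m → m ≤ p → η ≤ y m → ∃ k < p, y k ≤ η ∧ η ≤ y (k + 1) := by
    intro m
    induction m with
    | zero => intro h0; omega
    | succ m ih =>
      intro _ hm hη
      by_cases hc : y m ≤ η
      · exact ⟨m, by omega, hc, hη⟩
      · rcases Nat.eq_zero_or_pos m with rfl | hm0
        · exact absurd h1 hc
        · exact ih hm0 (by omega) (not_le.1 hc).le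
  exact this p hp le_rfl h2

end ConcaveChain

/-- The two chains of a funnel in coordinates for which the base is horizontal: a concave chain
on the left and, facing it, a convex chain on the right, both rising to a common apex. Each vertex
below the apex lies strictly on its side of the other chain. -/
structure ChainPair (p q : ℕ) (xa ya xb yb : ℕ → ℝ) : Prop where
  pos_left : 0 < p
  pos_right : 0 < q
  left : ConcaveChain p xa ya
  right : ConcaveChain q (fun j => -xb j) yb
  apex_x : xa p = xb q
  apex_y : ya p = yb q
  right_of : ∀ j < q, ∃ k < p, line xa ya k (yb j) < xb j
  left_of : ∀ i < p, ∃ m < q, xa i < line xb yb m (ya i)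

namespace ChainPair

variable {p q : ℕ} {xa ya xb yb : ℕ → ℝ}

/-- The reflection in a vertical axis exchanges the chains. -/
theorem mirror (h : ChainPair p q xa ya xb yb) :
    ChainPair q p (fun j => -xb j) yb (fun i => -xa i) ya where
  pos_left := h.pos_right
  pos_right := h.pos_left
  left := h.right
  right := by simpa using h.left
  apex_x := by rw [h.apex_x]
  apex_y := h.apex_y.symm
  right_of i hi := by
    obtain ⟨m, hm, hlt⟩ := h.left_of i hi
    exact ⟨m, hm, by rw [line_neg]; linarith⟩
  left_of j hj := by
    obtain ⟨m, hm, hlt⟩ := h.right_of j hj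
    exact ⟨m, hm, by rw [line_neg]; linarith⟩

theorem line_le_right (h : ChainPair p q xa ya xb yb) {m j : ℕ} (hm : m < q) (hj : j ≤ q) :
    line xb yb m (yb j) ≤ xb j := by
  have := h.right.le_line hm hj
  rw [line_neg] at this
  linarith

theorem line_lt_right (h : ChainPair p q xa ya xb yb) {m j : ℕ} (hm : m < q) (hj : j ≤ q)
    (h1 : j ≠ m) (h2 : j ≠ m + 1) : line xb yb m (yb j) < xb j := by
  have := h.right.lt_line hm hj h1 h2
  rw [line_neg] at this
  linarith

theorem apex_le_line (h : ChainPair p q xa ya xb yb) {i : ℕ} (hi : i < p) :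
    xb q ≤ line xa ya i (yb q) := by
  rw [← h.apex_x, ← h.apex_y]
  exact h.left.le_line hi le_rfl

theorem yb_lt_apex (h : ChainPair p q xa ya xb yb) {j : ℕ} (hj : j < q) : yb j < ya p := by
  rw [h.apex_y]
  exact h.right.y_lt hj le_rfl

theorem ya_lt_apex (h : ChainPair p q xa ya xb yb) {i : ℕ} (hi : i < p) : ya i < ya p :=
  h.left.y_lt hi le_rfl

/-- Below a vertex `c` of an edge of the left chain, all vertices of the right chain lie to the
right of this edge: otherwise a line of the right chain, which passes `c` on the right, would
cross the line of the edge twice below the apex. -/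
theorem line_lt_of_vertex (h : ChainPair p q xa ya xb yb) {i j c : ℕ} (hi : i < p) (hj : j < q)
    (hc : c < p) (hci : line xa ya i (ya c) = xa c) (hy : yb j ≤ ya c) :
    line xa ya i (yb j) < xb j := by
  by_contra hcon
  push Not at hcon
  obtain ⟨m, hm, hmlt⟩ := h.left_of c hc
  have e1 := (h.line_le_right hm hj.le).trans hcon
  have e2 := (h.line_le_right hm le_rfl).trans (h.apex_le_line hi)
  have hY := h.ya_lt_apex hc
  rw [h.apex_y] at hY
  rw [← hci] at hmlt
  rw [line_affine xb yb m (yb j) (ya c), line_affine xa ya i (yb j) (ya c)] at e1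
  rw [line_affine xb yb m (yb q) (ya c), line_affine xa ya i (yb q) (ya c)] at e2
  set s := (xb (m + 1) - xb m) / (yb (m + 1) - yb m)
  set r := (xa (i + 1) - xa i) / (ya (i + 1) - ya i)
  have hrs : s < r := by
    by_contra hle
    push Not at hle
    nlinarith [mul_nonneg (sub_nonneg.2 hle) (sub_pos.2 hY).le]
  nlinarith [mul_nonneg (sub_pos.2 hrs).le (sub_nonneg.2 hy)]

theorem line_lt_of_le (h : ChainPair p q xa ya xb yb) {i j : ℕ} (hi : i < p) (hj : j < q)
    (hy : yb j ≤ ya (i + 1)) : line xa ya i (yb j) < xb j := by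
  rcases Nat.lt_or_ge (i + 1) p with hip | hip
  · exact h.line_lt_of_vertex hi hj hip (h.left.line_succ hi) hy
  · rcases le_total (yb j) (ya i) with hle | hle
    · exact h.line_lt_of_vertex hi hj hi (line_self _ _ _) hle
    · obtain ⟨k, hk, hlt⟩ := h.right_of j hj
      exact (h.left.line_le_of_slab hk hi hle hy).trans_lt hlt

theorem lt_line_of_le (h : ChainPair p q xa ya xb yb) {i j : ℕ} (hi : i < p) (hj : j < q)
    (hy : ya i ≤ yb (j + 1)) : xa i < line xb yb j (ya i) := by
  have := h.mirror.line_lt_of_le hj hi hy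
  rw [line_neg] at this
  linarith

theorem line_last_lt (h : ChainPair p q xa ya xb yb) {i j : ℕ} (hi : i + 1 = p) (hj : j < q) :
    line xa ya i (yb j) < xb j :=
  h.line_lt_of_le (by omega) hj (by rw [hi]; exact (h.yb_lt_apex hj).le)

theorem lt_of_le_line (h : ChainPair p q xa ya xb yb) {i j : ℕ} (hi : i < p) (hj : j < q)
    (hl : xb j ≤ line xa ya i (yb j)) : ya (i + 1) < yb j := by
  by_contra hcon
  push Not at hcon
  linarith [h.line_lt_of_le hi hj hcon]

theorem lt_of_line_le (h : ChainPair p q xa ya xb yb) {i j : ℕ} (hi : i < p) (hj : j < q)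
    (hl : line xb yb j (ya i) ≤ xa i) : yb (j + 1) < ya i := by
  by_contra hcon
  push Not at hcon
  linarith [h.lt_line_of_le hi hj hcon]

/-- A vertex to the left of an edge of the left chain is to the left of all edges below. -/
theorem lt_line_of_lt (h : ChainPair p q xa ya xb yb) {i k j : ℕ} (hik : i ≤ k) (hk : k < p)
    (hj : j < q) (hl : xb j < line xa ya k (yb j)) : xb j < line xa ya i (yb j) :=
  hl.trans_le <| h.left.line_anti hik hk <|
    ((h.left.rising k hk).trans (h.lt_of_le_line hk hj hl.le)).le

theorem line_lt_of_lt (h : ChainPair p q xa ya xb yb) {i j l : ℕ} (hjl : j ≤ l) (hl : l < q)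
    (hi : i < p) (hlt : line xb yb l (ya i) < xa i) : line xb yb j (ya i) < xa i := by
  have := h.mirror.lt_line_of_lt hjl hl hi (by rw [line_neg]; linarith)
  rw [line_neg] at this
  linarith

/-- Once the right chain has met the line of an edge of the left chain, it stays to the left of
this line up to the apex, by convexity. -/
theorem lt_line_above (h : ChainPair p q xa ya xb yb) {i j l : ℕ} (hi : i < p) (hjl : j < l)
    (hl : l < q) (hle : xb j ≤ line xa ya i (yb j)) : xb l < line xa ya i (yb l) := by
  have e1 := (h.line_lt_right hl (by omega : j ≤ q) (by omega) (by omega)).trans_le hle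
  have e2 := (h.line_le_right hl le_rfl).trans (h.apex_le_line hi)
  have y1 := h.right.y_lt hjl hl.le
  have y2 := h.right.y_lt hl le_rfl
  rw [line_affine xb yb l (yb j) (yb l), line_affine xa ya i (yb j) (yb l), line_self] at e1
  rw [line_affine xb yb l (yb q) (yb l), line_affine xa ya i (yb q) (yb l), line_self] at e2
  set s := (xb (l + 1) - xb l) / (yb (l + 1) - yb l)
  set r := (xa (i + 1) - xa i) / (ya (i + 1) - ya i)
  by_contra hcon
  push Not at hcon
  have hrs : s ≤ r := by
    by_contra hlt
    push Not at hlt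
    nlinarith [mul_pos (sub_pos.2 hlt) (sub_pos.2 y2)]
  nlinarith [mul_nonneg (sub_nonneg.2 hrs) (sub_pos.2 y1).le]

theorem line_lt_above (h : ChainPair p q xa ya xb yb) {j i k : ℕ} (hj : j < q) (hik : i < k)
    (hk : k < p) (hle : line xb yb j (ya i) ≤ xa i) : line xb yb j (ya k) < xa k := by
  have := h.mirror.lt_line_above hj hik hk (by rw [line_neg]; linarith)
  rw [line_neg] at this
  linarith

end ChainPair

/-! ### Coordinates adapted to the base -/

/-- `X` and `Y` are the coordinate functions of an affine coordinate system of the plane. -/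
structure IsCoords (X Y : Plane → ℝ) : Prop where
  fst_comb : ∀ (x y : Plane) (s t : ℝ), s + t = 1 → X (s • x + t • y) = s * X x + t * X y
  snd_comb : ∀ (x y : Plane) (s t : ℝ), s + t = 1 → Y (s • x + t • y) = s * Y x + t * Y y
  inj : ∀ x y, X x = X y → Y x = Y y → x = y
  fst_cont : Continuous X
  snd_cont : Continuous Y

theorem continuous_line (x y : ℕ → ℝ) (i : ℕ) : Continuous (line x y i) := by
  unfold line; fun_prop

theorem line_comb (x y : ℕ → ℝ) (i : ℕ) {s t : ℝ} (η θ : ℝ) (h : s + t = 1) :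
    line x y i (s * η + t * θ) = s * line x y i η + t * line x y i θ := by
  obtain rfl : t = 1 - s := by linarith
  simp only [line]; ring

namespace IsCoords

variable {X Y : Plane → ℝ}

theorem neg_fst (h : IsCoords X Y) : IsCoords (fun x => -X x) Y where
  fst_comb x y s t hst := by rw [h.fst_comb x y s t hst]; ring
  snd_comb := h.snd_comb
  inj x y h1 h2 := h.inj x y (neg_injective h1) h2
  fst_cont := h.fst_cont.neg
  snd_cont := h.snd_cont

theorem snd_mem_Icc_of_mem_segment (h : IsCoords X Y) {P Q x : Plane} (hx : x ∈ segment ℝ P Q)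
    {a b : ℝ} (h1 : a ≤ Y P ∧ Y P ≤ b) (h2 : a ≤ Y Q ∧ Y Q ≤ b) : a ≤ Y x ∧ Y x ≤ b := by
  obtain ⟨s, t, hs, ht, hst, rfl⟩ := hx
  rw [h.snd_comb _ _ _ _ hst]
  obtain rfl : t = 1 - s := by linarith
  constructor <;> nlinarith

/-- A point that is not to the right of a concave chain, but on the line of one of its edges, lies
on the chain. -/
theorem mem_chain (h : IsCoords X Y) {p : ℕ} {P : ℕ → Plane} (hp : 0 < p)
    (hP : ConcaveChain p (fun i => X (P i)) (fun i => Y (P i))) {x : Plane}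
    (h1 : Y (P 0) ≤ Y x) (h2 : Y x ≤ Y (P p))
    (hle : ∀ i < p, X x ≤ line (fun i => X (P i)) (fun i => Y (P i)) i (Y x))
    (heq : ∃ i < p, line (fun i => X (P i)) (fun i => Y (P i)) i (Y x) ≤ X x) :
    ∃ k < p, x ∈ segment ℝ (P k) (P (k + 1)) := by
  obtain ⟨k, hk, hk1, hk2⟩ := hP.exists_slab hp h1 h2
  obtain ⟨i, hi, hix⟩ := heq
  have hX : X x = line (fun i => X (P i)) (fun i => Y (P i)) k (Y x) :=
    le_antisymm (hle k hk) ((hP.line_le_of_slab hi hk hk1 hk2).trans hix)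
  have hpos : 0 < Y (P (k + 1)) - Y (P k) := sub_pos.2 (hP.rising k hk)
  set s := (Y x - Y (P k)) / (Y (P (k + 1)) - Y (P k)) with hs
  have hs0 : 0 ≤ s := div_nonneg (sub_nonneg.2 hk1) hpos.le
  have hs1 : s ≤ 1 := by rw [hs, div_le_one hpos]; linarith
  refine ⟨k, hk, 1 - s, s, by linarith, hs0, by ring, ?_⟩
  apply h.inj
  · rw [h.fst_comb _ _ _ _ (by ring), hX]
    simp only [line, hs]
    ring
  · rw [h.snd_comb _ _ _ _ (by ring), hs]
    field_simp
    ring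

/-- A rising chain `Q` that starts to the right of a concave chain `P` and whose edges do not meet
`P` stays to the right of `P`. -/
theorem right_of_chain (h : IsCoords X Y) {p q : ℕ} {P Q : ℕ → Plane} (hp : 0 < p)
    (hP : ConcaveChain p (fun i => X (P i)) (fun i => Y (P i)))
    (hY : ∀ j ≤ q, Y (P 0) ≤ Y (Q j) ∧ Y (Q j) ≤ Y (P p))
    (hstart : line (fun i => X (P i)) (fun i => Y (P i)) 0 (Y (Q 0)) < X (Q 0))
    (hdis : ∀ k < p, ∀ j, j + 1 < q →
      Disjoint (segment ℝ (P k) (P (k + 1))) (segment ℝ (Q j) (Q (j + 1)))) :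
    ∀ j < q, ∃ k < p, line (fun i => X (P i)) (fun i => Y (P i)) k (Y (Q j)) < X (Q j) := by
  intro j
  induction j with
  | zero => intro _; exact ⟨0, hp, hstart⟩
  | succ j ih =>
    intro hj
    obtain ⟨k, hk, hlt⟩ := ih (by omega)
    by_contra hcon
    push Not at hcon
    have hne : (Finset.range p).Nonempty := ⟨0, Finset.mem_range.2 hp⟩
    set g : ℕ → Plane → ℝ := fun i x =>
      line (fun i => X (P i)) (fun i => Y (P i)) i (Y x) - X x with hg
    set G : Plane → ℝ := fun x => (Finset.range p).inf' hne fun i => g i x with hG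
    have hGc : Continuous G := by
      refine Continuous.finset_inf'_apply hne fun i _ => ?_
      exact ((continuous_line _ _ i).comp h.snd_cont).sub h.fst_cont
    have h0 : G (Q j) ≤ 0 := by
      refine (Finset.inf'_le _ (Finset.mem_range.2 hk)).trans ?_
      simp only [hg]; linarith
    have h1 : 0 ≤ G (Q (j + 1)) := by
      refine Finset.le_inf' _ _ fun i hi => ?_
      have := hcon i (Finset.mem_range.1 hi)
      simp only [hg]; linarith
    obtain ⟨x, hx, hx0⟩ := (convex_segment (𝕜 := ℝ) (Q j) (Q (j + 1))).isPreconnected.intermediate_value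
      (left_mem_segment ℝ _ _) (right_mem_segment ℝ _ _) hGc.continuousOn ⟨h0, h1⟩
    obtain ⟨hy1, hy2⟩ := h.snd_mem_Icc_of_mem_segment hx (hY j (by omega)) (hY (j + 1) hj.le)
    obtain ⟨i, hi, hie⟩ := Finset.exists_mem_eq_inf' hne fun i => g i x
    have hie' : g i x = 0 := by rw [← hie]; exact hx0
    obtain ⟨m, hm, hmem⟩ := h.mem_chain hp hP hy1 hy2
      (fun l hl => by
        have h2 : G x ≤ g l x := Finset.inf'_le _ (Finset.mem_range.2 hl)
        rw [hx0] at h2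
        simp only [hg] at h2; linarith)
      ⟨i, Finset.mem_range.1 hi, by simp only [hg] at hie'; linarith⟩
    exact Set.disjoint_left.1 (hdis m hm j hj) hmem hx

end IsCoords

/-- The `k`-th vertex of a polygon, with the origin as default value. -/
noncomputable def vert {n : ℕ} (v : Fin n → Plane) (k : ℕ) : Plane :=
  if h : k < n then v ⟨k, h⟩ else 0

/-- The coordinate along the base, up to the factor `dist ^ 2` of its endpoints. -/
noncomputable def along {n : ℕ} (v : Fin n → Plane) (x : Plane) : ℝ :=
  ((vert v (n - 1)).1 - (vert v 0).1) * (x.1 - (vert v 0).1) +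
    ((vert v (n - 1)).2 - (vert v 0).2) * (x.2 - (vert v 0).2)

/-- The coordinate orthogonal to the base, in the same unit as `along`. -/
noncomputable def height {n : ℕ} (v : Fin n → Plane) (x : Plane) : ℝ :=
  orient (vert v 0) (vert v (n - 1)) x

/-- The index `t` of a vertex off the base such that all other vertices off the base are strictly
reflex. -/
structure IsApex {n : ℕ} (v : Fin n → Plane) (t : ℕ) : Prop where
  pos : 0 < t
  lt : t + 1 < n
  reflex : ∀ i, i + 2 < n → i + 1 ≠ t → 0 < orient (vert v i) (vert v (i + 1)) (vert v (i + 2))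

section polygon
variable {n : ℕ} {v : Fin n → Plane}

theorem vert_of_lt {k : ℕ} (h : k < n) : vert v k = v ⟨k, h⟩ := dif_pos h

theorem vert_val (i : Fin n) : vert v i = v i := vert_of_lt i.2

theorem height_first : height v (vert v 0) = 0 := by simp [height, orient]

theorem height_last : height v (vert v (n - 1)) = 0 := by
  simp only [height, orient]; ring

theorem along_first : along v (vert v 0) = 0 := by simp [along]

theorem along_mul_orient (p q r : Plane) : along v (vert v (n - 1)) * orient p q r =
    (along v q - along v p) * (height v r - height v p) -
      (height v q - height v p) * (along v r - along v p) := by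
  simp only [along, height, orient]; ring

theorem div_mem_slitPlane_of_turn {a x b : ℂ} (hax : x - a ≠ 0) (h1 : a ∉ segment ℝ x b)
    (h2 : b ∉ segment ℝ a x) : (b - x) / (x - a) ∈ Complex.slitPlane := by
  have s1 := div_sub_mem_slitPlane h1
  have s2 := div_sub_mem_slitPlane h2
  set r := (b - x) / (x - a) with hr
  have e1 : (b - a) / (x - a) = 1 + r := by rw [hr]; field_simp; ring
  rw [e1] at s1
  have hne : 1 + r ≠ 0 := Complex.slitPlane_ne_zero s1
  have e2 : (x - b) / (a - b) = r / (1 + r) := by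
    rw [← e1, hr, ← neg_div_neg_eq, neg_sub, neg_sub, div_div_div_cancel_right₀ hax]
  rw [e2] at s2
  by_contra hcon
  rw [Complex.mem_slitPlane_iff, not_or, not_lt, not_not] at hcon
  obtain ⟨hre, him⟩ := hcon
  have hrr : r = (r.re : ℂ) := by apply Complex.ext <;> simp [him]
  have hpos : 0 < 1 + r.re := by
    rcases Complex.mem_slitPlane_iff.1 s1 with h | h
    · simpa using h
    · simp [him] at h
  rw [hrr, show ((r.re : ℂ) / (1 + (r.re : ℂ))) = ((r.re / (1 + r.re) : ℝ) : ℂ) by push_cast; rfl,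
    Complex.mem_slitPlane_iff] at s2
  rcases s2 with h | h
  · rw [Complex.ofReal_re] at h
    have := div_nonpos_of_nonpos_of_nonneg hre hpos.le
    linarith
  · exact h (Complex.ofReal_im _)

variable [NeZero n]

theorem fin_succ (h3 : 3 ≤ n) {k : ℕ} (h : k + 1 < n) :
    (⟨k, by omega⟩ : Fin n) + 1 = ⟨k + 1, h⟩ := by
  apply Fin.ext
  rw [Fin.val_add, Fin.val_one', Nat.mod_eq_of_lt (by omega : 1 < n), Nat.mod_eq_of_lt h]

theorem fin_neg_one (h3 : 3 ≤ n) : (-1 : Fin n) = ⟨n - 1, by omega⟩ := by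
  symm
  apply eq_neg_of_add_eq_zero_left
  apply Fin.ext
  rw [Fin.val_add, Fin.val_one', Nat.mod_eq_of_lt (by omega : 1 < n)]
  simp only [show n - 1 + 1 = n by omega, Nat.mod_self, Fin.val_zero]

theorem vert_last (h3 : 3 ≤ n) : vert v (n - 1) = v (-1) := by
  rw [fin_neg_one h3, vert_of_lt]

theorem vert_zero (h3 : 3 ≤ n) : vert v 0 = v 0 := by
  rw [vert_of_lt (by omega)]; rfl

theorem edge_eq (h3 : 3 ≤ n) {k : ℕ} (h : k + 1 < n) :
    edge v ⟨k, by omega⟩ = segment ℝ (vert v k) (vert v (k + 1)) := by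
  rw [edge, fin_succ h3 h, vert_of_lt, vert_of_lt]

theorem mem_boundary_iff (h3 : 3 ≤ n) {x : Plane} :
    x ∈ boundary v ↔ (∃ k, k + 1 < n ∧ x ∈ segment ℝ (vert v k) (vert v (k + 1))) ∨
      x ∈ segment ℝ (vert v (n - 1)) (vert v 0) := by
  have hbase : edge v (-1) = segment ℝ (vert v (n - 1)) (vert v 0) := by
    rw [edge, vert_last h3, vert_zero h3, neg_add_cancel]
  rw [boundary, Set.mem_iUnion]
  constructor
  · rintro ⟨i, hi⟩
    by_cases h : (i : ℕ) + 1 < n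
    · exact Or.inl ⟨i, h, by rwa [← edge_eq h3 h]⟩
    · have : i = -1 := by
        rw [fin_neg_one h3]; apply Fin.ext; simp only; omega
      rw [this, hbase] at hi
      exact Or.inr hi
  · rintro (⟨k, hk, hx⟩ | hx)
    · exact ⟨⟨k, by omega⟩, by rwa [edge_eq h3 hk]⟩
    · exact ⟨-1, by rwa [hbase]⟩

theorem IsSimplePolygon.disjoint_segment (hs : IsSimplePolygon v) {i k : ℕ} (hik : i + 1 < k)
    (hk : k + 1 < n) :
    Disjoint (segment ℝ (vert v i) (vert v (i + 1))) (segment ℝ (vert v k) (vert v (k + 1))) := by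
  have h3 := hs.three_le
  rw [← edge_eq h3 (by omega : i + 1 < n), ← edge_eq h3 hk]
  apply hs.disjoint
  · intro h; rw [Fin.mk.injEq] at h; omega
  · rw [fin_succ h3 (by omega)]; intro h; rw [Fin.mk.injEq] at h; omega
  · rw [fin_succ h3 (by omega)]; intro h; rw [Fin.mk.injEq] at h; omega

theorem IsSimplePolygon.vert_injOn (hs : IsSimplePolygon v) {i k : ℕ} (hi : i < n) (hk : k < n)
    (h : vert v i = vert v k) : i = k := by
  rw [vert_of_lt hi, vert_of_lt hk] at h
  have := hs.injective h
  rwa [Fin.mk.injEq] at this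

theorem IsSimplePolygon.segment_inter (hs : IsSimplePolygon v) {i : ℕ} (hi : i + 2 < n) {x : Plane}
    (h1 : x ∈ segment ℝ (vert v i) (vert v (i + 1)))
    (h2 : x ∈ segment ℝ (vert v (i + 1)) (vert v (i + 2))) : x = vert v (i + 1) := by
  have h3 := hs.three_le
  have hc := hs.consecutive ⟨i, by omega⟩
  rw [edge_eq h3 (by omega : i + 1 < n), fin_succ h3 (by omega : i + 1 < n),
    edge_eq h3 (by omega : i + 1 + 1 < n)] at hc
  have : x ∈ ({v ⟨i + 1, by omega⟩} : Set Plane) := by rw [← hc]; exact ⟨h1, h2⟩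
  rw [Set.mem_singleton_iff] at this
  rw [this, vert_of_lt]

theorem IsFunnel.exists_isApex (hv : IsFunnel v) : ∃ t, IsApex v t := by
  have h3 := hv.simple.three_le
  obtain ⟨t, ht0, ht1, ht⟩ := hv.chains
  rw [fin_neg_one h3] at ht1
  refine ⟨t, ?_, ?_, ?_⟩
  · exact Nat.pos_of_ne_zero fun h => ht0 (Fin.ext (by simpa using h))
  · have : (t : ℕ) ≠ n - 1 := fun h => ht1 (Fin.ext h)
    omega
  · intro i hi hit
    have h := ht ⟨i + 1, by omega⟩ ?_ ?_ ?_
    · rw [IsReflexVertex, fin_succ h3 (by omega : i + 1 + 1 < n),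
        ← fin_succ h3 (by omega : i + 1 < n), add_sub_cancel_right,
        fin_succ h3 (by omega : i + 1 < n)] at h
      rw [vert_of_lt (by omega : i < n), vert_of_lt (by omega : i + 1 < n), vert_of_lt hi]
      exact h
    · intro h; have := congrArg Fin.val h; simp at this
    · rw [fin_neg_one h3]; intro h; rw [Fin.mk.injEq] at h; omega
    · intro h; apply hit; rw [← h]

theorem height_pos (hv : IsFunnel v) {k : ℕ} (h0 : 0 < k) (h1 : k + 1 < n) :
    0 < height v (vert v k) := by
  have h3 := hv.simple.three_le
  rw [height, vert_zero h3, vert_last h3, vert_of_lt (by omega)]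
  apply hv.orient_base_pos
  · intro h; have := congrArg Fin.val h; simp at this; omega
  · rw [fin_neg_one h3]; intro h; rw [Fin.mk.injEq] at h; omega

theorem along_last_pos (hs : IsSimplePolygon v) : 0 < along v (vert v (n - 1)) := by
  have h3 := hs.three_le
  have hne : vert v (n - 1) ≠ vert v 0 := fun h => by
    have := hs.vert_injOn (by omega) (by omega) h
    omega
  by_contra hcon
  push Not at hcon
  simp only [along] at hcon
  apply hne
  have e1 : (vert v (n - 1)).1 - (vert v 0).1 = 0 := by
    nlinarith [sq_nonneg ((vert v (n - 1)).1 - (vert v 0).1),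
      sq_nonneg ((vert v (n - 1)).2 - (vert v 0).2)]
  have e2 : (vert v (n - 1)).2 - (vert v 0).2 = 0 := by
    nlinarith [sq_nonneg ((vert v (n - 1)).1 - (vert v 0).1),
      sq_nonneg ((vert v (n - 1)).2 - (vert v 0).2)]
  exact Prod.ext (sub_eq_zero.1 e1) (sub_eq_zero.1 e2)

theorem isCoords (hs : IsSimplePolygon v) : IsCoords (along v) (height v) where
  fst_comb x y s t hst := by
    obtain rfl : t = 1 - s := by linarith
    simp only [along, Prod.fst_add, Prod.smul_fst, Prod.snd_add, Prod.smul_snd, smul_eq_mul]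
    ring
  snd_comb x y s t hst := orient_combination _ _ _ _ hst
  inj x y hx hy := by
    have hδ := along_last_pos hs
    have e1 : along v (vert v (n - 1)) * (x.1 - y.1) = 0 := by
      simp only [along, height, orient] at hx hy ⊢
      linear_combination ((vert v (n - 1)).1 - (vert v 0).1) * hx -
        ((vert v (n - 1)).2 - (vert v 0).2) * hy
    have e2 : along v (vert v (n - 1)) * (x.2 - y.2) = 0 := by
      simp only [along, height, orient] at hx hy ⊢
      linear_combination ((vert v (n - 1)).2 - (vert v 0).2) * hx +
        ((vert v (n - 1)).1 - (vert v 0).1) * hy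
    exact Prod.ext (sub_eq_zero.1 ((mul_eq_zero.1 e1).resolve_left hδ.ne'))
      (sub_eq_zero.1 ((mul_eq_zero.1 e2).resolve_left hδ.ne'))
  fst_cont := by unfold along; fun_prop
  snd_cont := by unfold height orient; fun_prop

/-- The plane, in coordinates adapted to the base, as the complex plane. -/
noncomputable def toComplex (v : Fin n → Plane) (x : Plane) : ℂ := ⟨along v x, height v x⟩

theorem toComplex_mem_segment (hs : IsSimplePolygon v) {P Q x : Plane}
    (h : toComplex v x ∈ segment ℝ (toComplex v P) (toComplex v Q)) : x ∈ segment ℝ P Q := by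
  have hc := isCoords hs
  obtain ⟨s, t, h1, h2, hst, h⟩ := h
  refine ⟨s, t, h1, h2, hst, ?_⟩
  apply hc.inj
  · rw [hc.fst_comb _ _ _ _ hst]
    simpa [toComplex] using congrArg Complex.re h
  · rw [hc.snd_comb _ _ _ _ hst]
    simpa [toComplex] using congrArg Complex.im h

theorem exists_toComplex_of_mem_segment (hs : IsSimplePolygon v) {P Q : Plane} {w : ℂ}
    (h : w ∈ segment ℝ (toComplex v P) (toComplex v Q)) :
    ∃ x ∈ segment ℝ P Q, toComplex v x = w := by
  have hc := isCoords hs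
  obtain ⟨s, t, h1, h2, hst, rfl⟩ := h
  refine ⟨s • P + t • Q, ⟨s, t, h1, h2, hst, rfl⟩, ?_⟩
  apply Complex.ext
  · simpa [toComplex] using hc.fst_comb P Q s t hst
  · simpa [toComplex] using hc.snd_comb P Q s t hst

theorem IsFunnel.height_monotone (hv : IsFunnel v) {t : ℕ} (ht : IsApex v t) :
    (∀ i < t, height v (vert v i) < height v (vert v (i + 1))) ∧
      ∀ i, t ≤ i → i + 1 < n → height v (vert v (i + 1)) < height v (vert v i) := by
  have hs := hv.simple
  have h3 := hs.three_le
  have hc := isCoords hs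
  have hδ := along_last_pos hs
  have htn := ht.lt
  set z : ℕ → ℂ := fun k => toComplex v (vert v k) with hz
  have hinj : ∀ {x y : Plane}, toComplex v x = toComplex v y → x = y := fun h =>
    hc.inj _ _ (congrArg Complex.re h) (congrArg Complex.im h)
  have hne : ∀ i < n - 1, z (i + 1) - z i ≠ 0 := by
    intro i hi h
    have := hs.vert_injOn (by omega) (by omega) (hinj (sub_eq_zero.1 h))
    omega
  have hdivim : ∀ i, i + 2 < n → i + 1 ≠ t →
      0 < ((z (i + 2) - z (i + 1)) / (z (i + 1) - z i)).im := by
    intro i hi hit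
    have ho := ht.reflex i hi hit
    have e : ((z (i + 2) - z (i + 1)) / (z (i + 1) - z i)).im =
        along v (vert v (n - 1)) * orient (vert v i) (vert v (i + 1)) (vert v (i + 2)) /
          Complex.normSq (z (i + 1) - z i) := by
      rw [along_mul_orient, Complex.div_im]
      simp only [hz, toComplex, Complex.sub_re, Complex.sub_im]
      ring
    rw [e]
    exact div_pos (mul_pos hδ ho) (Complex.normSq_pos.2 (hne i (by omega)))
  have key := monotone_of_left_turns (z := z) (N := n - 1) ht.pos (by omega)
    (by
      intro i k hik hk
      rw [Set.disjoint_left]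
      intro w h1 h2
      obtain ⟨x, hx, rfl⟩ := exists_toComplex_of_mem_segment hs h1
      exact Set.disjoint_left.1 (hs.disjoint_segment hik (by omega)) hx
        (toComplex_mem_segment hs h2))
    hne
    (by
      intro i hi
      apply div_mem_slitPlane_of_turn (hne i (by omega))
      · intro h
        have := hs.segment_inter (by omega : i + 2 < n) (left_mem_segment ℝ _ _)
          (toComplex_mem_segment hs h)
        have := hs.vert_injOn (by omega) (by omega) this
        omega
      · intro h
        have := hs.segment_inter (by omega : i + 2 < n) (toComplex_mem_segment hs h)
          (right_mem_segment ℝ _ _)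
        have := hs.vert_injOn (by omega) (by omega) this
        omega)
    (fun i hi hit => hdivim i (by omega) hit)
    (by simpa [hz, toComplex, along_first] using hδ)
    (by simp [hz, toComplex, height_first, height_last])
    (by
      intro i h0 hi
      simpa [hz, toComplex, height_first] using height_pos hv h0 (by omega))
  constructor
  · intro i hi
    simpa [hz, toComplex] using key.1 i hi
  · intro i hti hi
    simpa [hz, toComplex] using key.2 i hti (by omega)

end polygon

/-! ### The two chains of a funnel polygon and the region between them -/

/-- The abscissa of the `i`-th vertex of the left chain, counted from the base. -/
noncomputable def leftX {n : ℕ} (v : Fin n → Plane) (i : ℕ) : ℝ := along v (vert v i)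

/-- The ordinate of the `i`-th vertex of the left chain, counted from the base. -/
noncomputable def leftY {n : ℕ} (v : Fin n → Plane) (i : ℕ) : ℝ := height v (vert v i)

/-- The abscissa of the `j`-th vertex of the right chain, counted from the base. -/
noncomputable def rightX {n : ℕ} (v : Fin n → Plane) (j : ℕ) : ℝ := along v (vert v (n - 1 - j))

/-- The ordinate of the `j`-th vertex of the right chain, counted from the base. -/
noncomputable def rightY {n : ℕ} (v : Fin n → Plane) (j : ℕ) : ℝ := height v (vert v (n - 1 - j))

section chains
variable {n : ℕ} {v : Fin n → Plane} {t : ℕ}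

theorem along_add_smul (x : Plane) (s : ℝ) :
    along v (x + s • (vert v (n - 1) - vert v 0)) = along v x + s * along v (vert v (n - 1)) ∧
      height v (x + s • (vert v (n - 1) - vert v 0)) = height v x := by
  simp only [along, height, orient, Prod.fst_add, Prod.smul_fst, Prod.snd_add, Prod.smul_snd,
    smul_eq_mul, Prod.fst_sub, Prod.snd_sub]
  constructor <;> ring

variable [NeZero n]

theorem neg_iff_of_mul_eq_mul {a b c e : ℝ} (ha : 0 < a) (hb : 0 < b) (h : a * c = b * e) :
    c < 0 ↔ e < 0 := by
  constructor <;> intro hneg <;> by_contra hcon <;> push Not at hcon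
  · nlinarith [mul_nonneg hb.le hcon, mul_pos ha (neg_pos.2 hneg)]
  · nlinarith [mul_nonneg ha.le hcon, mul_pos hb (neg_pos.2 hneg)]

theorem slope_lt_of_cross {a b c e : ℝ} (hb : 0 < b) (he : 0 < e) (h : 0 < a * e - b * c) :
    c / e < a / b := by
  rw [div_lt_div_iff₀ he hb]; linarith

theorem IsFunnel.leftChain (hv : IsFunnel v) (ht : IsApex v t) :
    ConcaveChain t (leftX v) (leftY v) where
  rising := (hv.height_monotone ht).1
  turn i hi := by
    have htn := ht.lt
    have ho := mul_pos (along_last_pos hv.simple) (ht.reflex i (by omega) (by omega))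
    rw [along_mul_orient] at ho
    have h1 := (hv.height_monotone ht).1 i (by omega)
    have h2 := (hv.height_monotone ht).1 (i + 1) (by omega)
    simp only [leftX, leftY]
    apply slope_lt_of_cross (sub_pos.2 h1) (sub_pos.2 h2)
    linarith

theorem IsFunnel.right_rising (hv : IsFunnel v) (ht : IsApex v t) {j : ℕ} (hj : j < n - 1 - t) :
    rightY v j < rightY v (j + 1) := by
  have h := (hv.height_monotone ht).2 (n - 1 - (j + 1)) (by omega) (by omega)
  rwa [show n - 1 - (j + 1) + 1 = n - 1 - j by omega] at h

theorem IsFunnel.rightChain (hv : IsFunnel v) (ht : IsApex v t) :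
    ConcaveChain (n - 1 - t) (fun j => -rightX v j) (rightY v) where
  rising _ hj := hv.right_rising ht hj
  turn j hj := by
    have htn := ht.lt
    have ho := mul_pos (along_last_pos hv.simple)
      (ht.reflex (n - 1 - (j + 2)) (by omega) (by omega))
    rw [along_mul_orient, show n - 1 - (j + 2) + 1 = n - 1 - (j + 1) by omega,
      show n - 1 - (j + 2) + 2 = n - 1 - j by omega] at ho
    have h1 := hv.right_rising ht (j := j) (by omega)
    have h2 := hv.right_rising ht (j := j + 1) (by omega)
    simp only [rightX, rightY] at h1 h2 ⊢
    apply slope_lt_of_cross (sub_pos.2 h1) (sub_pos.2 h2)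
    linarith

theorem IsFunnel.chainPair (hv : IsFunnel v) (ht : IsApex v t) :
    ChainPair t (n - 1 - t) (leftX v) (leftY v) (rightX v) (rightY v) := by
  have htn := ht.lt
  have ht0 := ht.pos
  have hL := hv.leftChain ht
  have hR := hv.rightChain ht
  have hc := isCoords hv.simple
  have hδ := along_last_pos hv.simple
  have hapex : n - 1 - (n - 1 - t) = t := by omega
  have y0 : leftY v 0 = 0 := height_first
  have y0' : rightY v 0 = 0 := by rw [rightY, Nat.sub_zero]; exact height_last
  have yt : rightY v (n - 1 - t) = leftY v t := by rw [rightY, hapex]; rfl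
  have x0 : leftX v 0 = 0 := along_first
  have x0' : 0 < rightX v 0 := by rw [rightX, Nat.sub_zero]; exact hδ
  refine ⟨ht0, by omega, hL, hR, by rw [rightX, hapex]; rfl, yt.symm, ?_, ?_⟩
  · refine hc.right_of_chain (P := vert v) (Q := fun j => vert v (n - 1 - j)) ht0 hL ?_ ?_ ?_
    · intro j hj
      change leftY v 0 ≤ rightY v j ∧ rightY v j ≤ leftY v t
      rw [← yt, y0, ← y0']
      exact ⟨hR.y_le (Nat.zero_le _) hj, hR.y_le hj le_rfl⟩
    · change line (leftX v) (leftY v) 0 (rightY v 0) < rightX v 0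
      rw [y0', ← y0, line_self, x0]
      exact x0'
    · intro k hk j hj
      have := hv.simple.disjoint_segment (i := k) (k := n - 1 - (j + 1)) (by omega) (by omega)
      rw [show n - 1 - (j + 1) + 1 = n - 1 - j by omega, segment_symm ℝ (vert v (n - 1 - (j + 1)))]
        at this
      exact this
  · have := hc.neg_fst.right_of_chain (P := fun j => vert v (n - 1 - j)) (Q := vert v)
      (p := n - 1 - t) (q := t) (by omega) hR ?_ ?_ ?_
    · intro i hi
      obtain ⟨m, hm, hlt⟩ := this i hi
      refine ⟨m, hm, ?_⟩
      change line (fun j => -rightX v j) (rightY v) m (leftY v i) < -leftX v i at hlt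
      rw [line_neg] at hlt
      linarith
    · intro i hi
      change rightY v 0 ≤ leftY v i ∧ leftY v i ≤ rightY v (n - 1 - t)
      rw [yt, y0', ← y0]
      exact ⟨hL.y_le (Nat.zero_le _) hi, hL.y_le hi le_rfl⟩
    · change line (fun j => -rightX v j) (rightY v) 0 (leftY v 0) < -leftX v 0
      rw [y0, ← y0', line_self, x0]
      linarith
    · intro k hk i hi
      have := hv.simple.disjoint_segment (i := i) (k := n - 1 - (k + 1)) (by omega) (by omega)
      rw [show n - 1 - (k + 1) + 1 = n - 1 - k by omega, segment_symm ℝ (vert v (n - 1 - (k + 1)))]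
        at this
      exact this.symm

/-- The position of a point relative to an edge of the left chain, in adapted coordinates. -/
theorem along_mul_orient_left (hv : IsFunnel v) (ht : IsApex v t) {i : ℕ} (hi : i < t) (x : Plane) :
    along v (vert v (n - 1)) * orient (vert v i) (vert v (i + 1)) x =
      (leftY v (i + 1) - leftY v i) *
        (line (leftX v) (leftY v) i (height v x) - along v x) := by
  have hpos := sub_pos.2 ((hv.leftChain ht).rising i hi)
  rw [along_mul_orient]
  simp only [line]
  rw [show height v (vert v (i + 1)) - height v (vert v i) = leftY v (i + 1) - leftY v i from rfl]
  field_simp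
  simp only [leftX, leftY]
  ring

/-- The position of a point relative to an edge of the right chain, in adapted coordinates. -/
theorem along_mul_orient_right (hv : IsFunnel v) (ht : IsApex v t) {j : ℕ} (hj : j < n - 1 - t)
    (x : Plane) :
    along v (vert v (n - 1)) * orient (vert v (n - 1 - j)) (vert v (n - 1 - (j + 1))) x =
      (rightY v (j + 1) - rightY v j) *
        (line (rightX v) (rightY v) j (height v x) - along v x) := by
  have hpos := sub_pos.2 (hv.right_rising ht hj)
  rw [along_mul_orient]
  simp only [line]
  rw [show height v (vert v (n - 1 - (j + 1))) - height v (vert v (n - 1 - j)) =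
    rightY v (j + 1) - rightY v j from rfl]
  field_simp
  simp only [rightX, rightY]
  ring

theorem orient_left_pos_iff (hv : IsFunnel v) (ht : IsApex v t) {i : ℕ} (hi : i < t) (x : Plane) :
    0 < orient (vert v i) (vert v (i + 1)) x ↔
      along v x < line (leftX v) (leftY v) i (height v x) := by
  rw [← mul_pos_iff_of_pos_left (along_last_pos hv.simple), along_mul_orient_left hv ht hi,
    mul_pos_iff_of_pos_left (sub_pos.2 ((hv.leftChain ht).rising i hi)), sub_pos]

theorem orient_left_neg_iff (hv : IsFunnel v) (ht : IsApex v t) {i : ℕ} (hi : i < t) (x : Plane) :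
    orient (vert v i) (vert v (i + 1)) x < 0 ↔
      line (leftX v) (leftY v) i (height v x) < along v x := by
  rw [neg_iff_of_mul_eq_mul (along_last_pos hv.simple)
    (sub_pos.2 ((hv.leftChain ht).rising i hi)) (along_mul_orient_left hv ht hi x), sub_neg]

theorem orient_right_pos_iff (hv : IsFunnel v) (ht : IsApex v t) {j : ℕ} (hj : j < n - 1 - t)
    (x : Plane) : 0 < orient (vert v (n - 1 - j)) (vert v (n - 1 - (j + 1))) x ↔
      along v x < line (rightX v) (rightY v) j (height v x) := by
  rw [← mul_pos_iff_of_pos_left (along_last_pos hv.simple), along_mul_orient_right hv ht hj,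
    mul_pos_iff_of_pos_left (sub_pos.2 (hv.right_rising ht hj)), sub_pos]

theorem orient_right_neg_iff (hv : IsFunnel v) (ht : IsApex v t) {j : ℕ} (hj : j < n - 1 - t)
    (x : Plane) : orient (vert v (n - 1 - j)) (vert v (n - 1 - (j + 1))) x < 0 ↔
      line (rightX v) (rightY v) j (height v x) < along v x := by
  rw [neg_iff_of_mul_eq_mul (along_last_pos hv.simple)
    (sub_pos.2 (hv.right_rising ht hj)) (along_mul_orient_right hv ht hj x), sub_neg]

theorem line_le_of_mem_segment {X Y : Plane → ℝ} (hc : IsCoords X Y) {x y : ℕ → ℝ} {i : ℕ}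
    {P Q z : Plane} (hP : line x y i (Y P) ≤ X P) (hQ : line x y i (Y Q) ≤ X Q)
    (hz : z ∈ segment ℝ P Q) : line x y i (Y z) ≤ X z := by
  obtain ⟨s, t, hs, ht, hst, rfl⟩ := hz
  rw [hc.fst_comb _ _ _ _ hst, hc.snd_comb _ _ _ _ hst, line_comb _ _ _ _ _ hst]
  have := mul_le_mul_of_nonneg_left hP hs
  have := mul_le_mul_of_nonneg_left hQ ht
  linarith

theorem le_line_of_mem_segment {X Y : Plane → ℝ} (hc : IsCoords X Y) {x y : ℕ → ℝ} {i : ℕ}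
    {P Q z : Plane} (hP : X P ≤ line x y i (Y P)) (hQ : X Q ≤ line x y i (Y Q))
    (hz : z ∈ segment ℝ P Q) : X z ≤ line x y i (Y z) := by
  obtain ⟨s, t, hs, ht, hst, rfl⟩ := hz
  rw [hc.fst_comb _ _ _ _ hst, hc.snd_comb _ _ _ _ hst, line_comb _ _ _ _ _ hst]
  have := mul_le_mul_of_nonneg_left hP hs
  have := mul_le_mul_of_nonneg_left hQ ht
  linarith

/-- No boundary point is strictly to the left of all edges of the left chain. -/
theorem exists_line_le_of_mem_boundary (hv : IsFunnel v) (ht : IsApex v t) {x : Plane}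
    (hx : x ∈ boundary v) :
    ∃ i < t, line (leftX v) (leftY v) i (height v x) ≤ along v x := by
  have hc := isCoords hv.simple
  have h3 := hv.simple.three_le
  have hp := hv.chainPair ht
  have ht0 := ht.pos
  have htn := ht.lt
  have hleft : ∀ i < t, ∀ k ≤ t, (k = i ∨ k = i + 1) →
      line (leftX v) (leftY v) i (height v (vert v k)) ≤ along v (vert v k) := by
    rintro i hi k hk (rfl | rfl)
    · exact (line_self (leftX v) (leftY v) k).le
    · exact (hp.left.line_succ hi).le
  have hright : ∀ k, t ≤ k → k < n →
      line (leftX v) (leftY v) (t - 1) (height v (vert v k)) ≤ along v (vert v k) := by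
    intro k htk hk
    rcases htk.eq_or_lt with rfl | hlt
    · exact hleft _ (by omega) _ le_rfl (by omega)
    · have := hp.line_last_lt (i := t - 1) (j := n - 1 - k) (by omega) (by omega)
      simp only [rightX, rightY, show n - 1 - (n - 1 - k) = k by omega] at this
      exact this.le
  rcases (mem_boundary_iff h3).1 hx with ⟨k, hk, hx⟩ | hx
  · rcases Nat.lt_or_ge k t with hkt | hkt
    · exact ⟨k, hkt, line_le_of_mem_segment hc (hleft k hkt k (by omega) (by omega))
        (hleft k hkt (k + 1) (by omega) (by omega)) hx⟩
    · exact ⟨t - 1, by omega, line_le_of_mem_segment hc (hright k hkt (by omega))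
        (hright (k + 1) (by omega) hk) hx⟩
  · refine ⟨0, ht0, line_le_of_mem_segment hc ?_ (hleft 0 ht0 0 (by omega) (by omega)) hx⟩
    have := hp.line_lt_of_le (i := 0) (j := 0) ht0 (by omega) (by
      have h1 := hp.left.rising 0 ht0
      have e1 : leftY v 0 = 0 := height_first
      have e2 : rightY v 0 = 0 := by rw [rightY, Nat.sub_zero]; exact height_last
      rw [e2]; rw [e1] at h1; exact h1.le)
    simp only [rightX, rightY, Nat.sub_zero] at this
    exact this.le

/-- No boundary point is strictly to the right of all edges of the right chain. -/
theorem exists_le_line_of_mem_boundary (hv : IsFunnel v) (ht : IsApex v t) {x : Plane}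
    (hx : x ∈ boundary v) :
    ∃ j < n - 1 - t, along v x ≤ line (rightX v) (rightY v) j (height v x) := by
  have hc := isCoords hv.simple
  have h3 := hv.simple.three_le
  have hp := hv.chainPair ht
  have ht0 := ht.pos
  have htn := ht.lt
  have hright : ∀ j < n - 1 - t, ∀ k ≤ n - 1 - t, (k = j ∨ k = j + 1) →
      rightX v k ≤ line (rightX v) (rightY v) j (rightY v k) := by
    rintro j hj k hk (rfl | rfl)
    · exact (line_self (rightX v) (rightY v) k).ge
    · have := (hp.right.line_succ hj)
      rw [line_neg] at this
      linarith
  have hleft : ∀ k, k ≤ t →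
      along v (vert v k) ≤ line (rightX v) (rightY v) (n - 1 - t - 1) (height v (vert v k)) := by
    intro k hkt
    rcases hkt.eq_or_lt with rfl | hlt
    · have := hright (n - 1 - k - 1) (by omega) (n - 1 - k) le_rfl (by omega)
      simpa only [rightX, rightY, show n - 1 - (n - 1 - k) = k by omega] using this
    · have := hp.mirror.line_last_lt (i := n - 1 - t - 1) (j := k) (by omega) hlt
      rw [line_neg] at this
      simp only [leftX, leftY] at this
      linarith
  rcases (mem_boundary_iff h3).1 hx with ⟨k, hk, hx⟩ | hx
  · rcases Nat.lt_or_ge k t with hkt | hkt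
    · exact ⟨n - 1 - t - 1, by omega, le_line_of_mem_segment hc (hleft k (by omega))
        (hleft (k + 1) (by omega)) hx⟩
    · refine ⟨n - 1 - (k + 1), by omega, le_line_of_mem_segment hc ?_ ?_ hx⟩
      · have := hright (n - 1 - (k + 1)) (by omega) (n - 1 - k) (by omega) (by omega)
        simpa only [rightX, rightY, show n - 1 - (n - 1 - k) = k by omega] using this
      · have := hright (n - 1 - (k + 1)) (by omega) (n - 1 - (k + 1)) (by omega) (by omega)
        simpa only [rightX, rightY, show n - 1 - (n - 1 - (k + 1)) = k + 1 by omega] using this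
  · refine ⟨0, by omega, le_line_of_mem_segment hc ?_ ?_ hx⟩
    · have := hright 0 (by omega) 0 (by omega) (by omega)
      simpa only [rightX, rightY, Nat.sub_zero] using this
    · have := hp.lt_line_of_le (i := 0) (j := 0) ht0 (by omega) (by
        have h1 := hp.right.rising 0 (by omega)
        have e1 : leftY v 0 = 0 := height_first
        have e2 : rightY v 0 = 0 := by rw [rightY, Nat.sub_zero]; exact height_last
        rw [e1]; rw [e2] at h1; exact h1.le)
      exact this.le

theorem base_ne_zero (hs : IsSimplePolygon v) : vert v (n - 1) - vert v 0 ≠ 0 := by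
  have h3 := hs.three_le
  intro h
  have := hs.vert_injOn (by omega) (by omega) (sub_eq_zero.1 h)
  omega

/-- Points beyond the left chain are outside the polygon: the ray parallel to the base that leads
away from the right chain does not meet the boundary. -/
theorem not_mem_region_of_left (hv : IsFunnel v) (ht : IsApex v t) {x : Plane}
    (hx : ∀ i < t, along v x < line (leftX v) (leftY v) i (height v x)) : x ∉ region v := by
  refine not_mem_region_of_ray (neg_ne_zero.2 (base_ne_zero hv.simple)) fun s hs hmem => ?_
  obtain ⟨i, hi, hle⟩ := exists_line_le_of_mem_boundary hv ht hmem
  rw [smul_neg, ← neg_smul, (along_add_smul x _).1, (along_add_smul x _).2] at hle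
  have := mul_nonneg hs (along_last_pos hv.simple).le
  linarith [hx i hi]

theorem not_mem_region_of_right (hv : IsFunnel v) (ht : IsApex v t) {x : Plane}
    (hx : ∀ j < n - 1 - t, line (rightX v) (rightY v) j (height v x) < along v x) :
    x ∉ region v := by
  refine not_mem_region_of_ray (base_ne_zero hv.simple) fun s hs hmem => ?_
  obtain ⟨j, hj, hle⟩ := exists_le_line_of_mem_boundary hv ht hmem
  rw [(along_add_smul x _).1, (along_add_smul x _).2] at hle
  have := mul_nonneg hs (along_last_pos hv.simple).le
  linarith [hx j hj]

/-- The closed set of points between the two chains. -/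
def between (v : Fin n → Plane) (t : ℕ) : Set Plane :=
  {x | (0 ≤ height v x ∧ height v x ≤ leftY v t) ∧
    (∃ i < t, line (leftX v) (leftY v) i (height v x) ≤ along v x) ∧
    ∃ j < n - 1 - t, along v x ≤ line (rightX v) (rightY v) j (height v x)}

/-- The open set of points strictly between the two chains. -/
def strictlyBetween (v : Fin n → Plane) (t : ℕ) : Set Plane :=
  {x | (0 < height v x ∧ height v x < leftY v t) ∧
    (∃ i < t, line (leftX v) (leftY v) i (height v x) < along v x) ∧
    ∃ j < n - 1 - t, along v x < line (rightX v) (rightY v) j (height v x)}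

theorem isClosed_between (hs : IsSimplePolygon v) : IsClosed (between v t) := by
  have hc := isCoords hs
  have cl : ∀ x y : ℕ → ℝ, ∀ i, Continuous fun z => line x y i (height v z) := fun x y i =>
    (continuous_line x y i).comp hc.snd_cont
  have e : between v t = ({x | 0 ≤ height v x} ∩ {x | height v x ≤ leftY v t}) ∩
      ((⋃ i ∈ Set.Iio t, {x | line (leftX v) (leftY v) i (height v x) ≤ along v x}) ∩
        ⋃ j ∈ Set.Iio (n - 1 - t),
          {x | along v x ≤ line (rightX v) (rightY v) j (height v x)}) := by
    ext x; simp [between]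
  rw [e]
  refine ((isClosed_le continuous_const hc.snd_cont).inter
    (isClosed_le hc.snd_cont continuous_const)).inter (IsClosed.inter ?_ ?_)
  · exact (Set.finite_Iio t).isClosed_biUnion fun i _ => isClosed_le (cl _ _ i) hc.fst_cont
  · exact (Set.finite_Iio _).isClosed_biUnion fun i _ => isClosed_le hc.fst_cont (cl _ _ i)

theorem isOpen_strictlyBetween (hs : IsSimplePolygon v) : IsOpen (strictlyBetween v t) := by
  have hc := isCoords hs
  have cl : ∀ x y : ℕ → ℝ, ∀ i, Continuous fun z => line x y i (height v z) := fun x y i =>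
    (continuous_line x y i).comp hc.snd_cont
  have e : strictlyBetween v t = ({x | 0 < height v x} ∩ {x | height v x < leftY v t}) ∩
      ((⋃ i ∈ Set.Iio t, {x | line (leftX v) (leftY v) i (height v x) < along v x}) ∩
        ⋃ j ∈ Set.Iio (n - 1 - t),
          {x | along v x < line (rightX v) (rightY v) j (height v x)}) := by
    ext x; simp [strictlyBetween]
  rw [e]
  refine ((isOpen_lt continuous_const hc.snd_cont).inter
    (isOpen_lt hc.snd_cont continuous_const)).inter (IsOpen.inter ?_ ?_)
  · exact isOpen_biUnion fun i _ => isOpen_lt (cl _ _ i) hc.fst_cont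
  · exact isOpen_biUnion fun i _ => isOpen_lt hc.fst_cont (cl _ _ i)

theorem isBounded_between (hs : IsSimplePolygon v) : Bornology.IsBounded (between v t) := by
  have hδ := along_last_pos hs
  -- on the strip below the apex each of the finitely many lines is bounded
  have hb : ∀ (m : ℕ) (x y : ℕ → ℝ), ∃ c : ℝ, ∀ i < m, ∀ η, 0 ≤ η → η ≤ leftY v t →
      |line x y i η| ≤ c := by
    intro m x y
    induction m with
    | zero => exact ⟨0, fun i hi => by omega⟩
    | succ m ih =>
      obtain ⟨c, hc⟩ := ih
      obtain ⟨c', hc'⟩ := (isCompact_Icc (a := (0 : ℝ)) (b := leftY v t)).exists_bound_of_continuousOn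
        (continuous_line x y m).continuousOn
      refine ⟨max c c', fun i hi η h0 h1 => ?_⟩
      rcases (Nat.lt_succ_iff.1 hi).lt_or_eq with h | rfl
      · exact (hc i h η h0 h1).trans (le_max_left _ _)
      · exact (hc' η ⟨h0, h1⟩).trans (le_max_right _ _)
  obtain ⟨c, hc⟩ := hb t (leftX v) (leftY v)
  obtain ⟨c', hc'⟩ := hb (n - 1 - t) (rightX v) (rightY v)
  set K : Set (ℝ × ℝ) := Set.Icc (-c) c' ×ˢ Set.Icc 0 (leftY v t) with hK
  set δ := along v (vert v (n - 1)) with hδd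
  set D := vert v (n - 1) - vert v 0 with hD
  set ψ : ℝ × ℝ → Plane := fun w =>
    ((vert v 0).1 + (D.1 * w.1 - D.2 * w.2) / δ, (vert v 0).2 + (D.2 * w.1 + D.1 * w.2) / δ)
    with hψ
  have hψc : Continuous ψ := by
    rw [hψ]
    fun_prop
  have hψK : Bornology.IsBounded (ψ '' K) :=
    ((isCompact_Icc.prod isCompact_Icc).image hψc).isBounded
  refine hψK.subset ?_
  rintro x ⟨⟨h0, h1⟩, ⟨i, hi, hix⟩, j, hj, hjx⟩
  refine ⟨(along v x, height v x), ⟨⟨?_, ?_⟩, h0, h1⟩, ?_⟩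
  · have := (abs_le.1 (hc i hi _ h0 h1)).1
    simp only; linarith
  · have := (abs_le.1 (hc' j hj _ h0 h1)).2
    simp only; linarith
  · have hδe : δ = D.1 ^ 2 + D.2 ^ 2 := by
      rw [hδd, hD]; simp only [along, Prod.fst_sub, Prod.snd_sub]; ring
    apply Prod.ext
    · simp only [hψ]
      have : D.1 * along v x - D.2 * height v x = δ * (x.1 - (vert v 0).1) := by
        rw [hδe, hD]; simp only [along, height, orient, Prod.fst_sub, Prod.snd_sub]; ring
      rw [this, mul_div_cancel_left₀ _ hδ.ne']; ring
    · simp only [hψ]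
      have : D.2 * along v x + D.1 * height v x = δ * (x.2 - (vert v 0).2) := by
        rw [hδe, hD]; simp only [along, height, orient, Prod.fst_sub, Prod.snd_sub]; ring
      rw [this, mul_div_cancel_left₀ _ hδ.ne']; ring

theorem mem_strictlyBetween_or_mem_boundary (hv : IsFunnel v) (ht : IsApex v t) {x : Plane}
    (hx : x ∈ between v t) : x ∈ strictlyBetween v t ∨ x ∈ boundary v := by
  have hc := isCoords hv.simple
  have h3 := hv.simple.three_le
  have hp := hv.chainPair ht
  have ht0 := ht.pos
  have htn := ht.lt
  have hδ := along_last_pos hv.simple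
  have x0 : leftX v 0 = 0 := along_first
  have y0 : leftY v 0 = 0 := height_first
  have y0' : rightY v 0 = 0 := by rw [rightY, Nat.sub_zero]; exact height_last
  have x0' : rightX v 0 = along v (vert v (n - 1)) := by rw [rightX, Nat.sub_zero]
  obtain ⟨⟨h0, h1⟩, ⟨i, hi, hix⟩, j, hj, hjx⟩ := hx
  have hP0 : leftY v 0 ≤ height v x := by rw [y0]; exact h0
  have hQ0 : rightY v 0 ≤ height v x := by rw [y0']; exact h0
  have hQ1 : height v x ≤ rightY v (n - 1 - t) := by rw [← hp.apex_y]; exact h1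
  by_contra hcon
  rw [not_or] at hcon
  obtain ⟨hcon, hnb⟩ := hcon
  apply hcon
  -- a point of a chain is on the boundary
  have hright : (∃ i < t, line (leftX v) (leftY v) i (height v x) < along v x) := by
    by_contra hno
    push Not at hno
    obtain ⟨k, hk, hmem⟩ := hc.mem_chain (P := vert v) ht0 hp.left hP0 h1 hno ⟨i, hi, hix⟩
    exact hnb ((mem_boundary_iff h3).2 (Or.inl ⟨k, by omega, hmem⟩))
  have hleft : (∃ j < n - 1 - t, along v x < line (rightX v) (rightY v) j (height v x)) := by
    by_contra hno
    push Not at hno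
    obtain ⟨k, hk, hmem⟩ := hc.neg_fst.mem_chain (P := fun j => vert v (n - 1 - j)) hp.pos_right
      hp.right hQ0 hQ1
      (fun k hk => by
        have := hno k hk
        have e := line_neg (rightX v) (rightY v) k (height v x)
        change -along v x ≤ line (fun j => -rightX v j) (rightY v) k (height v x)
        rw [e]; linarith)
      ⟨j, hj, by
        have e := line_neg (rightX v) (rightY v) j (height v x)
        change line (fun j => -rightX v j) (rightY v) j (height v x) ≤ -along v x
        rw [e]; linarith⟩
    refine hnb ((mem_boundary_iff h3).2 (Or.inl ⟨n - 1 - (k + 1), by omega, ?_⟩))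
    rw [show n - 1 - (k + 1) + 1 = n - 1 - k by omega, segment_symm]
    exact hmem
  refine ⟨⟨h0.lt_of_ne fun hz => ?_, h1.lt_of_ne fun hz => ?_⟩, hright, hleft⟩
  · -- at height zero the point is on the base
    have a1 : 0 ≤ along v x := by
      refine le_trans ?_ hix
      have := hp.left.le_line hi (Nat.zero_le t)
      rw [x0, y0] at this
      rw [← hz]
      exact this
    have a2 : along v x ≤ along v (vert v (n - 1)) := by
      refine hjx.trans ?_
      have := hp.line_le_right hj (Nat.zero_le _)
      rw [x0', y0'] at this
      rw [← hz]
      exact this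
    refine hnb ((mem_boundary_iff h3).2 (Or.inr ?_))
    refine ⟨along v x / along v (vert v (n - 1)), 1 - along v x / along v (vert v (n - 1)),
      div_nonneg a1 hδ.le, ?_, by ring, ?_⟩
    · rw [sub_nonneg, div_le_one hδ]; exact a2
    · apply hc.inj
      · rw [hc.fst_comb _ _ _ _ (by ring), along_first]
        field_simp
        ring
      · rw [hc.snd_comb _ _ _ _ (by ring), height_first, height_last, ← hz]
        ring
  · -- at the height of the apex the point is the apex
    have hxa : x = vert v t := by
      apply hc.inj _ _ (le_antisymm ?_ ?_) hz
      · refine hjx.trans ?_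
        have := hp.line_le_right hj le_rfl
        rwa [← hp.apex_x, ← hp.apex_y, ← hz] at this
      · refine le_trans ?_ hix
        have := hp.left.le_line hi le_rfl
        rwa [← hz] at this
    refine hnb ((mem_boundary_iff h3).2 (Or.inl ⟨t, htn, ?_⟩))
    rw [hxa]
    exact left_mem_segment ℝ _ _

/-- Off the boundary the closed set between the chains is open, so that it contains with a point
also the connected component of this point. -/
theorem between_subset_region (hv : IsFunnel v) (ht : IsApex v t) : between v t ⊆ region v := by
  intro x hx
  by_cases hb : x ∈ boundary v
  · exact Or.inl hb
  refine Or.inr ⟨hb, (isBounded_between (t := t) hv.simple).subset ?_⟩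
  have hsb : strictlyBetween v t ⊆ between v t := by
    rintro y ⟨⟨h0, h1⟩, ⟨i, hi, hiy⟩, j, hj, hjy⟩
    exact ⟨⟨h0.le, h1.le⟩, ⟨i, hi, hiy.le⟩, j, hj, hjy.le⟩
  refine Set.Subset.trans ?_ hsb
  refine IsPreconnected.subset_left_of_subset_union (isOpen_strictlyBetween hv.simple)
    (isClosed_between hv.simple).isOpen_compl (v := (between v t)ᶜ) ?_ ?_ ?_
    isPreconnected_connectedComponentIn
  · exact Set.disjoint_left.2 fun y hy hy' => hy' (hsb hy)
  · intro y hy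
    by_cases hyb : y ∈ between v t
    · refine Or.inl ((mem_strictlyBetween_or_mem_boundary hv ht hyb).resolve_right ?_)
      exact connectedComponentIn_subset _ _ hy
    · exact Or.inr hyb
  · exact ⟨x, mem_connectedComponentIn hb,
      (mem_strictlyBetween_or_mem_boundary hv ht hx).resolve_right hb⟩

/-- A convex polygon whose vertices lie on the inner side of one edge of each chain is contained in
the funnel polygon. -/
theorem convexHull_subset_region (hv : IsFunnel v) (ht : IsApex v t) {s : Set Plane} {i j : ℕ}
    (hi : i < t) (hj : j < n - 1 - t)
    (h0 : ∀ x ∈ s, 0 ≤ height v x ∧ height v x ≤ leftY v t)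
    (hl : ∀ x ∈ s, line (leftX v) (leftY v) i (height v x) ≤ along v x)
    (hr : ∀ x ∈ s, along v x ≤ line (rightX v) (rightY v) j (height v x)) :
    convexHull ℝ s ⊆ region v := by
  have hc := isCoords hv.simple
  refine Set.Subset.trans ?_ (between_subset_region hv ht)
  refine Set.Subset.trans (convexHull_min (t := {x | (0 ≤ height v x ∧ height v x ≤ leftY v t) ∧
    line (leftX v) (leftY v) i (height v x) ≤ along v x ∧
    along v x ≤ line (rightX v) (rightY v) j (height v x)}) ?_ ?_) ?_
  · exact fun x hx => ⟨h0 x hx, hl x hx, hr x hx⟩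
  · rw [convex_iff_segment_subset]
    rintro x ⟨hx0, hx1, hx2⟩ y ⟨hy0, hy1, hy2⟩ z hz
    exact ⟨hc.snd_mem_Icc_of_mem_segment hz hx0 hy0, line_le_of_mem_segment hc hx1 hy1 hz,
      le_line_of_mem_segment hc hx2 hy2 hz⟩
  · rintro x ⟨hx0, hx1, hx2⟩
    exact ⟨hx0, ⟨i, hi, hx1⟩, j, hj, hx2⟩

end chains

/-! ### The order on the vertices and hidden pairs -/

/-- The strict order on the vertices whose incomparable pairs are the pairs that see each other
(`k` below `l`): on a chain, two vertices are comparable if they are not adjacent; vertices of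
different chains are comparable if the line of the edge above the lower one separates it from the
upper one. Indices up to `t` belong to the left chain and the apex, the others to the right
chain. -/
def Below (V : ℕ → Plane) (t k l : ℕ) : Prop :=
  if k ≤ t then
    if l ≤ t then k + 2 ≤ l else 0 < orient (V k) (V (k + 1)) (V l)
  else
    if l ≤ t then orient (V k) (V (k - 1)) (V l) < 0 else l + 2 ≤ k

section order
variable {n t : ℕ}

theorem exists_right_index {u : ℕ} (htn : t + 1 < n) (h1 : t < u) (h2 : u < n) :
    ∃ j < n - 1 - t, u = n - 1 - j := ⟨n - 1 - u, by omega, by omega⟩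

variable [NeZero n] {v : Fin n → Plane}

theorem below_left_right (hv : IsFunnel v) (ht : IsApex v t) {i j : ℕ} (hi : i < t) :
    0 < orient (vert v i) (vert v (i + 1)) (vert v (n - 1 - j)) ↔
      rightX v j < line (leftX v) (leftY v) i (rightY v j) := orient_left_pos_iff hv ht hi _

theorem below_right_left (hv : IsFunnel v) (ht : IsApex v t) {i j : ℕ} (hj : j < n - 1 - t) :
    orient (vert v (n - 1 - j)) (vert v (n - 1 - j - 1)) (vert v i) < 0 ↔
      line (rightX v) (rightY v) j (leftY v i) < leftX v i := by
  rw [show n - 1 - j - 1 = n - 1 - (j + 1) by omega]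
  exact orient_right_neg_iff hv ht hj _

theorem ChainPair.line_lt_apex {p q : ℕ} {xa ya xb yb : ℕ → ℝ}
    (h : ChainPair p q xa ya xb yb) {j : ℕ} (hj : j + 1 < q) :
    line xb yb j (ya p) < xa p := by
  rw [h.apex_x, h.apex_y]
  exact h.line_lt_right (by omega) le_rfl (by omega) (by omega)

theorem Below.trans (hv : IsFunnel v) (ht : IsApex v t) {a b c : ℕ} (ha : a < n) (hb : b < n)
    (hc : c < n) (hbt : b ≠ t) (hct : c ≠ t) (hcb : Below (vert v) t c b)
    (hba : Below (vert v) t b a) : Below (vert v) t c a := by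
  have hp := hv.chainPair ht
  have htn := ht.lt
  unfold Below at hcb hba ⊢
  rcases Nat.lt_or_ge t c with h1 | h1
  · obtain ⟨jc, hjc, rfl⟩ := exists_right_index htn h1 hc
    rw [if_neg (by omega)] at hcb ⊢
    rcases Nat.lt_or_ge t b with h2 | h2
    · obtain ⟨jb, hjb, rfl⟩ := exists_right_index htn h2 hb
      rw [if_neg (by omega)] at hcb hba
      rcases Nat.lt_or_ge t a with h3 | h3
      · rw [if_neg (by omega)] at hba ⊢
        omega
      · rw [if_pos h3] at hba ⊢
        rw [below_right_left hv ht (by omega)] at hba ⊢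
        rcases h3.lt_or_eq with h3 | rfl
        · exact hp.line_lt_of_lt (by omega) hjb h3 hba
        · exact hp.line_lt_apex (by omega)
    · rw [if_pos h2, below_right_left hv ht hjc] at hcb
      rw [if_pos h2] at hba
      have hb' : b < t := lt_of_le_of_ne h2 hbt
      have y1 := hp.lt_of_line_le hb' hjc hcb.le
      rcases Nat.lt_or_ge t a with h3 | h3
      · obtain ⟨ja, hja, rfl⟩ := exists_right_index htn h3 ha
        rw [if_neg (by omega), below_left_right hv ht hb'] at hba
        rw [if_neg (by omega)]
        have y2 := hp.lt_of_le_line hb' hja hba.le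
        have y3 := hp.left.rising b hb'
        by_contra hcon
        have := hp.right.y_le (show ja ≤ jc + 1 by omega) (by omega)
        linarith
      · rw [if_pos h3] at hba ⊢
        rw [below_right_left hv ht hjc]
        rcases h3.lt_or_eq with h3 | rfl
        · exact hp.line_lt_above hjc (by omega) h3 hcb.le
        · apply hp.line_lt_apex
          by_contra hcon
          have e : jc + 1 = n - 1 - a := by omega
          rw [e, ← hp.apex_y] at y1
          exact lt_asymm y1 (hp.ya_lt_apex hb')
  · have hc' : c < t := lt_of_le_of_ne h1 hct
    rw [if_pos h1] at hcb ⊢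
    rcases Nat.lt_or_ge t b with h2 | h2
    · obtain ⟨jb, hjb, rfl⟩ := exists_right_index htn h2 hb
      rw [if_neg (by omega)] at hba
      rw [if_neg (by omega), below_left_right hv ht hc'] at hcb
      have y1 := hp.lt_of_le_line hc' hjb hcb.le
      rcases Nat.lt_or_ge t a with h3 | h3
      · obtain ⟨ja, hja, rfl⟩ := exists_right_index htn h3 ha
        rw [if_neg (by omega)] at hba ⊢
        rw [below_left_right hv ht hc']
        exact hp.lt_line_above hc' (by omega) hja hcb.le
      · rw [if_pos h3] at hba ⊢
        rw [below_right_left hv ht hjb] at hba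
        rcases h3.lt_or_eq with h3 | rfl
        · have y2 := hp.lt_of_line_le h3 hjb hba.le
          have y3 := hp.right.rising jb hjb
          by_contra hcon
          have := hp.left.y_le (show a ≤ c + 1 by omega) (by omega)
          linarith
        · by_contra hcon
          rw [show c + 1 = a by omega] at y1
          exact lt_asymm y1 (hp.yb_lt_apex hjb)
    · have hb' : b < t := lt_of_le_of_ne h2 hbt
      rw [if_pos h2] at hcb hba
      rcases Nat.lt_or_ge t a with h3 | h3
      · obtain ⟨ja, hja, rfl⟩ := exists_right_index htn h3 ha
        rw [if_neg (by omega), below_left_right hv ht hb'] at hba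
        rw [if_neg (by omega), below_left_right hv ht hc']
        exact hp.lt_line_of_lt (by omega) hb' hja hba
      · rw [if_pos h3] at hba ⊢
        omega

/-- A point of a segment at which finitely many affine functions are positive. -/
theorem exists_mem_segment_forall_pos {m : ℕ} {G : ℕ → Plane → ℝ} {P Q : Plane}
    (hG : ∀ i, ∀ s t : ℝ, s + t = 1 → G i (s • P + t • Q) = s * G i P + t * G i Q)
    (h : ∀ i < m, 0 < G i P ∨ 0 ≤ G i P ∧ 0 < G i Q) :
    ∃ x ∈ segment ℝ P Q, ∀ i < m, 0 < G i x := by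
  have ev : ∀ i ∈ Finset.range m, ∀ᶠ s : ℝ in 𝓝[>] 0, 0 < (1 - s) * G i P + s * G i Q := by
    intro i hi
    rcases h i (Finset.mem_range.1 hi) with hpos | ⟨h0, hpos⟩
    · have hcont : ContinuousAt (fun s : ℝ => (1 - s) * G i P + s * G i Q) 0 := by fun_prop
      refine (hcont.eventually_const_lt ?_).filter_mono nhdsWithin_le_nhds
      simpa using hpos
    · filter_upwards [Ioo_mem_nhdsGT (zero_lt_one (α := ℝ))] with s hs
      have := mul_nonneg (sub_pos.2 hs.2).le h0
      have := mul_pos hs.1 hpos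
      linarith
  have ev' := (Finset.eventually_all _).2 ev
  obtain ⟨s, hs, hs0, hs1⟩ := (ev'.and (Ioo_mem_nhdsGT (zero_lt_one (α := ℝ)))).exists
  refine ⟨(1 - s) • P + s • Q, ⟨1 - s, s, by linarith, hs0.le, by ring, rfl⟩, fun i hi => ?_⟩
  rw [hG i _ _ (by ring)]
  exact hs i (Finset.mem_range.2 hi)

theorem not_sees_of_left (hv : IsFunnel v) (ht : IsApex v t) {P Q : Plane}
    (h : ∀ i < t, along v P < line (leftX v) (leftY v) i (height v P) ∨
      along v P ≤ line (leftX v) (leftY v) i (height v P) ∧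
        along v Q < line (leftX v) (leftY v) i (height v Q)) : ¬ Sees v P Q := by
  intro hsee
  have hc := isCoords hv.simple
  obtain ⟨x, hx, hpos⟩ := exists_mem_segment_forall_pos (m := t) (P := P) (Q := Q)
    (G := fun i x => line (leftX v) (leftY v) i (height v x) - along v x)
    (fun i s t hst => by
      rw [hc.fst_comb _ _ _ _ hst, hc.snd_comb _ _ _ _ hst, line_comb _ _ _ _ _ hst]
      ring)
    (fun i hi => by simpa using h i hi)
  exact not_mem_region_of_left hv ht (fun i hi => sub_pos.1 (hpos i hi)) (hsee hx)

theorem not_sees_of_right (hv : IsFunnel v) (ht : IsApex v t) {P Q : Plane}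
    (h : ∀ j < n - 1 - t, line (rightX v) (rightY v) j (height v P) < along v P ∨
      line (rightX v) (rightY v) j (height v P) ≤ along v P ∧
        line (rightX v) (rightY v) j (height v Q) < along v Q) : ¬ Sees v P Q := by
  intro hsee
  have hc := isCoords hv.simple
  obtain ⟨x, hx, hpos⟩ := exists_mem_segment_forall_pos (m := n - 1 - t) (P := P) (Q := Q)
    (G := fun j x => along v x - line (rightX v) (rightY v) j (height v x))
    (fun i s t hst => by
      rw [hc.fst_comb _ _ _ _ hst, hc.snd_comb _ _ _ _ hst, line_comb _ _ _ _ _ hst]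
      ring)
    (fun i hi => by simpa using h i hi)
  exact not_mem_region_of_right hv ht (fun i hi => sub_pos.1 (hpos i hi)) (hsee hx)

/-- Comparable vertices do not see each other: the segment between them passes behind the chain
of the lower one, immediately after it or in between. -/
theorem not_sees_of_below (hv : IsFunnel v) (ht : IsApex v t) {k l : ℕ} (hk : k < n) (hl : l < n)
    (hkt : k ≠ t) (h : Below (vert v) t k l) : ¬ Sees v (vert v k) (vert v l) := by
  have hp := hv.chainPair ht
  have htn := ht.lt
  unfold Below at h
  rcases Nat.lt_or_ge t k with h1 | h1
  · obtain ⟨j, hj, rfl⟩ := exists_right_index htn h1 hk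
    rw [if_neg (by omega)] at h
    apply not_sees_of_right hv ht
    rcases Nat.lt_or_ge t l with h2 | h2
    · obtain ⟨m, hm, rfl⟩ := exists_right_index htn h2 hl
      rw [if_neg (by omega)] at h
      intro e he
      by_cases hej : j = e ∨ j = e + 1
      · exact Or.inr ⟨hp.line_le_right he hj.le,
          hp.line_lt_right he hm.le (by omega) (by omega)⟩
      · exact Or.inl (hp.line_lt_right he hj.le (by omega) (by omega))
    · rw [if_pos h2, below_right_left hv ht hj] at h
      intro e he
      by_cases hej : e ≤ j
      · refine Or.inr ⟨hp.line_le_right he hj.le, ?_⟩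
        rcases h2.lt_or_eq with h2 | rfl
        · exact hp.line_lt_of_lt hej hj h2 h
        · apply hp.line_lt_apex
          by_contra hcon
          have e1 : j = n - 1 - l - 1 := by omega
          have := hp.right.line_succ hj
          rw [line_neg, show j + 1 = n - 1 - l by omega, ← hp.apex_y, ← hp.apex_x] at this
          linarith
      · exact Or.inl (hp.line_lt_right he hj.le (by omega) (by omega))
  · have hk' : k < t := lt_of_le_of_ne h1 hkt
    rw [if_pos h1] at h
    apply not_sees_of_left hv ht
    rcases Nat.lt_or_ge t l with h2 | h2
    · obtain ⟨m, hm, rfl⟩ := exists_right_index htn h2 hl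
      rw [if_neg (by omega), below_left_right hv ht hk'] at h
      intro e he
      by_cases hej : e ≤ k
      · exact Or.inr ⟨hp.left.le_line he h1, hp.lt_line_of_lt hej hk' hm h⟩
      · exact Or.inl (hp.left.lt_line he h1 (by omega) (by omega))
    · rw [if_pos h2] at h
      intro e he
      by_cases hej : k = e ∨ k = e + 1
      · exact Or.inr ⟨hp.left.le_line he h1, hp.left.lt_line he h2 (by omega) (by omega)⟩
      · exact Or.inl (hp.left.lt_line he h1 (by omega) (by omega))

end order

/-! ### The greedy partition into levels -/

section algorithm
variable (V : ℕ → Plane)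

/-- The left vertex `i + 1` is not strictly above the right edge `(u, u - 1)`. -/
def LeftNextFree (i u : ℕ) : Prop := ¬ orient (V u) (V (u - 1)) (V (i + 1)) < 0

/-- The right vertex `u - 1` is not strictly above the left edge `(i, i + 1)`. -/
def RightNextFree (i u : ℕ) : Prop := ¬ 0 < orient (V i) (V (i + 1)) (V (u - 1))

/-- The left vertex `i` is not strictly above the right edge `(u, u - 1)`. -/
def LeftFree (i u : ℕ) : Prop := ¬ orient (V u) (V (u - 1)) (V i) < 0

/-- The right vertex `u` is not strictly above the left edge `(i, i + 1)`. -/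
def RightFree (i u : ℕ) : Prop := ¬ 0 < orient (V i) (V (i + 1)) (V u)

open Classical in
/-- The lowest vertices that remain on the two chains, after the minimal elements among the
remaining vertices have been removed. The state `(i, u)` means that `i, …, t` and `t, …, u` remain;
the last vertex before the apex is never removed from its chain. -/
noncomputable def next (t : ℕ) (s : ℕ × ℕ) : ℕ × ℕ :=
  if LeftNextFree V s.1 s.2 then
    if RightNextFree V s.1 s.2 then (min (s.1 + 2) (t - 1), max (s.2 - 2) (t + 1))
    else (min (s.1 + 2) (t - 1), if RightFree V s.1 s.2 then max (s.2 - 1) (t + 1) else s.2)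
  else (if LeftFree V s.1 s.2 then min (s.1 + 1) (t - 1) else s.1, max (s.2 - 2) (t + 1))

open Classical in
/-- A convex polygon with the left edge `(i, i + 1)` and the right vertex `w`, which is thickened
by the vertex below `w` if the three are collinear. -/
noncomputable def leftEdgePiece (i w : ℕ) : List ℕ :=
  if orient (V i) (V (i + 1)) (V w) < 0 then [i, i + 1, w] else [i, i + 1, w, w + 1]

open Classical in
/-- A convex polygon with the right edge `(u, u - 1)` and the left vertex `w`, which is thickened
by the vertex below `w` if the three are collinear. -/
noncomputable def rightEdgePiece (u w : ℕ) : List ℕ :=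
  if 0 < orient (V u) (V (u - 1)) (V w) then [u, u - 1, w] else [u, u - 1, w, w - 1]

open Classical in
/-- A convex polygon that contains the minimal elements among the remaining vertices. -/
noncomputable def levelPiece (s : ℕ × ℕ) : List ℕ :=
  if LeftNextFree V s.1 s.2 then
    if RightNextFree V s.1 s.2 then [s.1, s.1 + 1, s.2, s.2 - 1]
    else leftEdgePiece V s.1 (if RightFree V s.1 s.2 then s.2 else s.2 + 1)
  else rightEdgePiece V s.2 (if LeftFree V s.1 s.2 then s.1 else s.1 - 1)

open Classical in
/-- A remaining vertex below a vertex of the next level, given the chain of the latter (`true` for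
the left chain and the apex), together with its own chain. -/
noncomputable def pick (b : Bool) (s : ℕ × ℕ) : ℕ × Bool :=
  if b then if LeftNextFree V s.1 s.2 then (s.1, true) else (s.2, false)
  else if RightNextFree V s.1 s.2 then (s.2, false) else (s.1, true)

end algorithm

namespace ChainPair

variable {p q : ℕ} {xa ya xb yb : ℕ → ℝ}

theorem last_line_apex (h : ChainPair p q xa ya xb yb) {j : ℕ} (hj : j + 1 = q) :
    line xb yb j (ya p) = xa p := by
  have := h.right.line_succ (i := j) (by omega)
  rw [line_neg, hj, ← h.apex_y, ← h.apex_x] at this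
  linarith

theorem below_next_of_line_lt (h : ChainPair p q xa ya xb yb) {i j : ℕ} (hi : i < p) (hj : j < q)
    (hl : line xb yb j (ya (i + 1)) < xa (i + 1)) : j + 1 < q ∧ yb (j + 1) < ya (i + 1) := by
  have hjq : j + 1 < q := by
    by_contra hcon
    rcases Nat.lt_or_ge (i + 1) p with hip | hip
    · have := h.lt_of_line_le hip hj hl.le
      rw [show j + 1 = q by omega, ← h.apex_y] at this
      exact lt_asymm this (h.ya_lt_apex hip)
    · have := h.last_line_apex (j := j) (by omega)
      rw [show p = i + 1 by omega] at this
      linarith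
  refine ⟨hjq, ?_⟩
  rcases Nat.lt_or_ge (i + 1) p with hip | hip
  · exact h.lt_of_line_le hip hj hl.le
  · rw [show i + 1 = p by omega]
    exact h.yb_lt_apex hjq

theorem below_next_of_lt_line (h : ChainPair p q xa ya xb yb) {i j : ℕ} (hi : i < p) (hj : j < q)
    (hl : xb (j + 1) < line xa ya i (yb (j + 1))) : i + 1 < p ∧ ya (i + 1) < yb (j + 1) :=
  h.mirror.below_next_of_line_lt hj hi (by simpa [line_neg] using hl)

theorem free_of_next_free (h : ChainPair p q xa ya xb yb) {i j : ℕ} (hi : i < p) (hj : j < q)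
    (hl : line xa ya i (yb (j + 1)) ≤ xb (j + 1)) : line xa ya i (yb j) < xb j := by
  by_contra hcon
  push Not at hcon
  rcases Nat.lt_or_ge (j + 1) q with hjq | hjq
  · linarith [h.lt_line_above hi (Nat.lt_succ_self j) hjq hcon]
  · rw [show j + 1 = q by omega, ← h.apex_x, ← h.apex_y] at hl
    have hip : i + 1 = p := by
      by_contra hne
      linarith [h.left.lt_line hi le_rfl (by omega) (by omega)]
    linarith [h.line_last_lt hip hj]

theorem left_free_of_next_free (h : ChainPair p q xa ya xb yb) {i j : ℕ} (hi : i < p) (hj : j < q)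
    (hl : xa (i + 1) ≤ line xb yb j (ya (i + 1))) : xa i < line xb yb j (ya i) := by
  have := h.mirror.free_of_next_free hj hi (by rw [line_neg]; linarith)
  rw [line_neg] at this
  linarith

/-- If a vertex of the right chain lies on the line of an edge of the left chain and sees the
edge, then the vertex below it lies strictly inside and sees the edge as well. -/
theorem thicken (h : ChainPair p q xa ya xb yb) {i l : ℕ} (hi : i + 1 < p) (hl : l < q)
    (h1 : line xa ya i (yb l) ≤ xb l) (h2 : xb l ≤ line xa ya i (yb l)) (h0 : yb 0 ≤ ya 0) :
    0 < l ∧ line xa ya i (yb (l - 1)) < xb (l - 1) ∧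
      xa (i + 1) ≤ line xb yb (l - 1) (ya (i + 1)) ∧ xa i ≤ line xb yb (l - 1) (ya i) := by
  have hy := h.lt_of_le_line (by omega) hl h2
  have hl0 : 0 < l := by
    rcases Nat.eq_zero_or_pos l with rfl | h'
    · have := h.left.y_le (Nat.zero_le (i + 1)) hi.le
      linarith
    · exact h'
  obtain ⟨m, rfl⟩ : ∃ m, l = m + 1 := ⟨l - 1, by omega⟩
  rw [Nat.add_sub_cancel]
  refine ⟨hl0, h.free_of_next_free (by omega) (by omega) h1, ?_, ?_⟩
  · exact (h.lt_line_of_le hi (by omega) hy.le).le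
  · exact (h.lt_line_of_le (by omega) (by omega)
      ((h.left.rising i (by omega)).trans hy).le).le

end ChainPair

/-! ### The pieces of the cover -/

/-- The convex hull of the listed vertices is a convex polygon with interior points inside the
given polygon. -/
structure IsGoodPiece {n : ℕ} [NeZero n] (v : Fin n → Plane) (L : List ℕ) : Prop where
  lt : ∀ k ∈ L, k < n
  subset : convexHull ℝ {p | ∃ k ∈ L, p = vert v k} ⊆ region v
  orient_ne : ∃ a ∈ L, ∃ b ∈ L, ∃ c ∈ L, orient (vert v a) (vert v b) (vert v c) ≠ 0

section pieces
variable {n : ℕ} {v : Fin n → Plane} {t : ℕ}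

theorem rightY_zero_le : rightY v 0 ≤ leftY v 0 := by
  rw [rightY, Nat.sub_zero, leftY, height_first, height_last]

variable [NeZero n]

theorem leftNextFree_iff (hv : IsFunnel v) (ht : IsApex v t) {i j : ℕ} (hj : j < n - 1 - t) :
    LeftNextFree (vert v) i (n - 1 - j) ↔
      leftX v (i + 1) ≤ line (rightX v) (rightY v) j (leftY v (i + 1)) := by
  rw [LeftNextFree, below_right_left hv ht hj, not_lt]

theorem leftFree_iff (hv : IsFunnel v) (ht : IsApex v t) {i j : ℕ} (hj : j < n - 1 - t) :
    LeftFree (vert v) i (n - 1 - j) ↔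
      leftX v i ≤ line (rightX v) (rightY v) j (leftY v i) := by
  rw [LeftFree, below_right_left hv ht hj, not_lt]

theorem rightNextFree_iff (hv : IsFunnel v) (ht : IsApex v t) {i j : ℕ} (hi : i < t) :
    RightNextFree (vert v) i (n - 1 - j) ↔
      line (leftX v) (leftY v) i (rightY v (j + 1)) ≤ rightX v (j + 1) := by
  rw [RightNextFree, show n - 1 - j - 1 = n - 1 - (j + 1) by omega, below_left_right hv ht hi,
    not_lt]

theorem rightFree_iff (hv : IsFunnel v) (ht : IsApex v t) {i j : ℕ} (hi : i < t) :
    RightFree (vert v) i (n - 1 - j) ↔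
      line (leftX v) (leftY v) i (rightY v j) ≤ rightX v j := by
  rw [RightFree, below_left_right hv ht hi, not_lt]

theorem height_mem (hv : IsFunnel v) (ht : IsApex v t) {k : ℕ} (hk : k < n) :
    0 ≤ height v (vert v k) ∧ height v (vert v k) ≤ leftY v t := by
  have hp := hv.chainPair ht
  have htn := ht.lt
  have y0 : leftY v 0 = 0 := height_first
  have y0' : rightY v 0 = 0 := by rw [rightY, Nat.sub_zero]; exact height_last
  rcases Nat.lt_or_ge t k with h | h
  · obtain ⟨j, hj, rfl⟩ := exists_right_index htn h hk
    rw [← y0']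
    exact ⟨hp.right.y_le (Nat.zero_le _) hj.le, (hp.yb_lt_apex hj).le⟩
  · rw [← y0]
    exact ⟨hp.left.y_le (Nat.zero_le _) h, hp.left.y_le h le_rfl⟩

theorem isGoodPiece_of (hv : IsFunnel v) (ht : IsApex v t) {L : List ℕ} {i j : ℕ} (hi : i < t)
    (hj : j < n - 1 - t) (hL : ∀ k ∈ L, k < n)
    (hl : ∀ k ∈ L, line (leftX v) (leftY v) i (height v (vert v k)) ≤ along v (vert v k))
    (hr : ∀ k ∈ L, along v (vert v k) ≤ line (rightX v) (rightY v) j (height v (vert v k)))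
    {a b c : ℕ} (ha : a ∈ L) (hb : b ∈ L) (hc : c ∈ L)
    (ho : orient (vert v a) (vert v b) (vert v c) ≠ 0) : IsGoodPiece v L := by
  refine ⟨hL, convexHull_subset_region hv ht hi hj ?_ ?_ ?_, a, ha, b, hb, c, hc, ho⟩
  · rintro _ ⟨k, hk, rfl⟩; exact height_mem hv ht (hL k hk)
  · rintro _ ⟨k, hk, rfl⟩; exact hl k hk
  · rintro _ ⟨k, hk, rfl⟩; exact hr k hk

theorem isGoodPiece_leftEdge (hv : IsFunnel v) (ht : IsApex v t) {i l : ℕ} (hi : i + 1 < t)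
    (hl : l < n - 1 - t) (h1 : line (leftX v) (leftY v) i (rightY v l) ≤ rightX v l)
    (h2 : leftX v (i + 1) ≤ line (rightX v) (rightY v) l (leftY v (i + 1))) :
    IsGoodPiece v (leftEdgePiece (vert v) i (n - 1 - l)) := by
  have hp := hv.chainPair ht
  have htn := ht.lt
  have a1 : line (leftX v) (leftY v) i (leftY v i) ≤ leftX v i := (line_self _ _ _).le
  have a2 : line (leftX v) (leftY v) i (leftY v (i + 1)) ≤ leftX v (i + 1) :=
    (hp.left.line_succ (by omega)).le
  have b0 : leftX v i ≤ line (rightX v) (rightY v) l (leftY v i) :=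
    (hp.left_free_of_next_free (by omega) hl h2).le
  have b1 : rightX v l ≤ line (rightX v) (rightY v) l (rightY v l) := (line_self _ _ _).ge
  unfold leftEdgePiece
  split_ifs with ho
  · refine isGoodPiece_of hv ht (i := i) (j := l) (by omega) hl ?_ ?_ ?_
      (a := i) (b := i + 1) (c := n - 1 - l) (by simp) (by simp) (by simp) ho.ne <;>
    · intro k hk
      simp only [List.mem_cons, List.not_mem_nil, or_false] at hk
      rcases hk with rfl | rfl | rfl
      all_goals first | omega | assumption
  · rw [orient_left_neg_iff hv ht (by omega), not_lt] at ho
    obtain ⟨hl0, c1, c2, c3⟩ := hp.thicken hi hl h1 ho rightY_zero_le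
    obtain ⟨m, rfl⟩ : ∃ m, l = m + 1 := ⟨l - 1, by omega⟩
    rw [Nat.add_sub_cancel] at c1 c2 c3
    rw [show n - 1 - (m + 1) + 1 = n - 1 - m by omega]
    have d1 : rightX v (m + 1) ≤ line (rightX v) (rightY v) m (rightY v (m + 1)) := by
      have := hp.right.line_succ (i := m) (by omega)
      rw [line_neg] at this
      linarith
    have d2 : rightX v m ≤ line (rightX v) (rightY v) m (rightY v m) := (line_self _ _ _).ge
    refine isGoodPiece_of hv ht (i := i) (j := m) (by omega) (by omega) ?_ ?_ ?_
      (a := i) (b := i + 1) (c := n - 1 - m) (by simp) (by simp) (by simp)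
      ((orient_left_neg_iff hv ht (by omega) _).2 c1).ne <;>
    · intro k hk
      simp only [List.mem_cons, List.not_mem_nil, or_false] at hk
      rcases hk with rfl | rfl | rfl | rfl
      all_goals first | omega | assumption | exact c1.le

theorem isGoodPiece_rightEdge (hv : IsFunnel v) (ht : IsApex v t) {i j : ℕ} (hi : i < t)
    (hj : j + 1 < n - 1 - t) (h1 : leftX v i ≤ line (rightX v) (rightY v) j (leftY v i))
    (h2 : line (leftX v) (leftY v) i (rightY v (j + 1)) ≤ rightX v (j + 1)) :
    IsGoodPiece v (rightEdgePiece (vert v) (n - 1 - j) i) := by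
  have hp := hv.chainPair ht
  have htn := ht.lt
  have a1 : rightX v j ≤ line (rightX v) (rightY v) j (rightY v j) := (line_self _ _ _).ge
  have a2 : rightX v (j + 1) ≤ line (rightX v) (rightY v) j (rightY v (j + 1)) := by
    have := hp.right.line_succ (i := j) (by omega)
    rw [line_neg] at this
    linarith
  have b0 : line (leftX v) (leftY v) i (rightY v j) ≤ rightX v j :=
    (hp.free_of_next_free hi (by omega) h2).le
  unfold rightEdgePiece
  rw [show n - 1 - j - 1 = n - 1 - (j + 1) by omega]
  split_ifs with ho
  · refine isGoodPiece_of hv ht (i := i) (j := j) hi (by omega) ?_ ?_ ?_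
      (a := n - 1 - j) (b := n - 1 - (j + 1)) (c := i) (by simp) (by simp) (by simp) ho.ne' <;>
    · intro k hk
      simp only [List.mem_cons, List.not_mem_nil, or_false] at hk
      rcases hk with rfl | rfl | rfl
      all_goals first | omega | assumption | exact (line_self _ _ _).le
  · rw [orient_right_pos_iff hv ht (by omega), not_lt] at ho
    obtain ⟨hi0, c1, c2, c3⟩ := hp.mirror.thicken hj hi (by rw [line_neg]; linarith)
      (by rw [line_neg]; exact neg_le_neg ho)
      (by rw [rightY, Nat.sub_zero, leftY, height_first, height_last])
    obtain ⟨m, rfl⟩ : ∃ m, i = m + 1 := ⟨i - 1, by omega⟩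
    rw [line_neg, Nat.add_sub_cancel] at c1 c2 c3
    rw [Nat.add_sub_cancel]
    have c1' : leftX v m < line (rightX v) (rightY v) j (leftY v m) := by linarith
    have c2' : line (leftX v) (leftY v) m (rightY v (j + 1)) ≤ rightX v (j + 1) := by linarith
    have c3' : line (leftX v) (leftY v) m (rightY v j) ≤ rightX v j := by linarith
    have d1 : line (leftX v) (leftY v) m (leftY v (m + 1)) ≤ leftX v (m + 1) :=
      (hp.left.line_succ (by omega)).le
    refine isGoodPiece_of hv ht (i := m) (j := j) (by omega) (by omega) ?_ ?_ ?_
      (a := n - 1 - j) (b := n - 1 - (j + 1)) (c := m) (by simp) (by simp) (by simp)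
      ((orient_right_pos_iff hv ht (by omega) _).2 c1').ne' <;>
    · intro k hk
      simp only [List.mem_cons, List.not_mem_nil, or_false] at hk
      rcases hk with rfl | rfl | rfl | rfl
      all_goals first | omega | assumption | exact (line_self _ _ _).le | exact c1'.le

/-- The invariants of the greedy partition: the highest removed vertex of either chain is free with
respect to the edge that starts at the lowest remaining vertex of the other one. -/
structure Inv (v : Fin n → Plane) (t i j : ℕ) : Prop where
  left_lt : i < t
  right_lt : j < n - 1 - t
  left_free : 0 < i → leftX v (i - 1) ≤ line (rightX v) (rightY v) j (leftY v (i - 1))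
  right_free : 0 < j → line (leftX v) (leftY v) i (rightY v (j - 1)) ≤ rightX v (j - 1)

theorem Inv.leftFree_mono (hv : IsFunnel v) (ht : IsApex v t) {i j j' : ℕ} (hi : i < t)
    (hjj : j ≤ j') (hj : j' < n - 1 - t)
    (h : leftX v i ≤ line (rightX v) (rightY v) j (leftY v i)) :
    leftX v i ≤ line (rightX v) (rightY v) j' (leftY v i) := by
  by_contra hcon
  push Not at hcon
  linarith [(hv.chainPair ht).line_lt_of_lt hjj hj hi hcon]

theorem Inv.rightFree_mono (hv : IsFunnel v) (ht : IsApex v t) {i i' j : ℕ} (hj : j < n - 1 - t)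
    (hii : i ≤ i') (hi : i' < t)
    (h : line (leftX v) (leftY v) i (rightY v j) ≤ rightX v j) :
    line (leftX v) (leftY v) i' (rightY v j) ≤ rightX v j := by
  by_contra hcon
  push Not at hcon
  linarith [(hv.chainPair ht).lt_line_of_lt hii hi hj hcon]

theorem isGoodPiece_level (hv : IsFunnel v) (ht : IsApex v t) {i j : ℕ} (h : Inv v t i j) :
    IsGoodPiece v (levelPiece (vert v) (i, n - 1 - j)) := by
  have hp := hv.chainPair ht
  have htn := ht.lt
  obtain ⟨hi, hj, hL, hR⟩ := h
  unfold levelPiece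
  simp only [leftNextFree_iff hv ht hj, rightNextFree_iff hv ht hi, leftFree_iff hv ht hj,
    rightFree_iff hv ht hi]
  by_cases hX : leftX v (i + 1) ≤ line (rightX v) (rightY v) j (leftY v (i + 1))
  · rw [if_pos hX]
    by_cases hY : line (leftX v) (leftY v) i (rightY v (j + 1)) ≤ rightX v (j + 1)
    · rw [if_pos hY, show n - 1 - j - 1 = n - 1 - (j + 1) by omega]
      have a1 : line (leftX v) (leftY v) i (leftY v i) ≤ leftX v i := (line_self _ _ _).le
      have a2 : line (leftX v) (leftY v) i (leftY v (i + 1)) ≤ leftX v (i + 1) :=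
        (hp.left.line_succ (by omega)).le
      have a3 := hp.free_of_next_free hi hj hY
      have a3' := a3.le
      have b1 : rightX v j ≤ line (rightX v) (rightY v) j (rightY v j) := (line_self _ _ _).ge
      have b2 : rightX v (j + 1) ≤ line (rightX v) (rightY v) j (rightY v (j + 1)) := by
        have := hp.right.line_succ hj
        rw [line_neg] at this
        linarith
      have b3 := (hp.left_free_of_next_free hi hj hX).le
      refine isGoodPiece_of hv ht hi hj ?_ ?_ ?_
        (a := i) (b := i + 1) (c := n - 1 - j) (by simp) (by simp) (by simp)
        ((orient_left_neg_iff hv ht hi _).2 a3).ne <;>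
      · intro k hk
        simp only [List.mem_cons, List.not_mem_nil, or_false] at hk
        rcases hk with rfl | rfl | rfl | rfl
        all_goals first | omega | assumption
    · rw [if_neg hY]
      obtain ⟨hi1, hy⟩ := hp.below_next_of_lt_line hi hj (not_le.1 hY)
      split_ifs with hPA
      · exact isGoodPiece_leftEdge hv ht hi1 hj hPA hX
      · push Not at hPA
        have hya := hp.lt_of_le_line hi hj hPA.le
        have hj0 : 0 < j := by
          rcases Nat.eq_zero_or_pos j with rfl | h'
          · have := hp.left.y_le (Nat.zero_le (i + 1)) hi1.le
            linarith [rightY_zero_le (v := v)]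
          · exact h'
        obtain ⟨m, rfl⟩ : ∃ m, j = m + 1 := ⟨j - 1, by omega⟩
        rw [show n - 1 - (m + 1) + 1 = n - 1 - m by omega]
        exact isGoodPiece_leftEdge hv ht hi1 (by omega) (hR hj0)
          (hp.lt_line_of_le hi1 (by omega) hya.le).le
  · rw [if_neg hX]
    obtain ⟨hj1, hy⟩ := hp.below_next_of_line_lt hi hj (not_le.1 hX)
    have hY : line (leftX v) (leftY v) i (rightY v (j + 1)) ≤ rightX v (j + 1) :=
      (hp.line_lt_of_le hi hj1 hy.le).le
    split_ifs with hPB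
    · exact isGoodPiece_rightEdge hv ht hi hj1 hPB hY
    · push Not at hPB
      have hyb := hp.lt_of_line_le hi hj hPB.le
      have hi0 : 0 < i := by
        rcases Nat.eq_zero_or_pos i with rfl | h'
        · have e1 := hp.right.y_le (Nat.zero_le (j + 1)) hj1.le
          have y0 : leftY v 0 = 0 := height_first
          have y0' : rightY v 0 = 0 := by rw [rightY, Nat.sub_zero]; exact height_last
          linarith
        · exact h'
      obtain ⟨m, rfl⟩ : ∃ m, i = m + 1 := ⟨i - 1, by omega⟩
      rw [Nat.add_sub_cancel]
      exact isGoodPiece_rightEdge hv ht (by omega) hj1 (hL hi0)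
        (hp.line_lt_of_le (by omega) hj1 hyb.le).le

/-- The effect of removing a level. -/
structure Step (v : Fin n → Plane) (t i j i' j' : ℕ) : Prop where
  inv : Inv v t i' j'
  progress : i + j < i' + j'
  left_mem : ∀ k, i ≤ k → k < i' → k ∈ levelPiece (vert v) (i, n - 1 - j)
  right_mem : ∀ l, j ≤ l → l < j' → n - 1 - l ∈ levelPiece (vert v) (i, n - 1 - j)

theorem mem_leftEdgePiece (V : ℕ → Plane) (i w : ℕ) :
    i ∈ leftEdgePiece V i w ∧ i + 1 ∈ leftEdgePiece V i w ∧ w ∈ leftEdgePiece V i w := by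
  unfold leftEdgePiece
  split_ifs <;> simp

theorem mem_rightEdgePiece (V : ℕ → Plane) (u w : ℕ) :
    u ∈ rightEdgePiece V u w ∧ u - 1 ∈ rightEdgePiece V u w ∧ w ∈ rightEdgePiece V u w := by
  unfold rightEdgePiece
  split_ifs <;> simp

theorem exists_step (hv : IsFunnel v) (ht : IsApex v t) {i j : ℕ} (h : Inv v t i j)
    (hcont : i + 1 < t ∨ j + 1 < n - 1 - t) :
    ∃ i' j', next (vert v) t (i, n - 1 - j) = (i', n - 1 - j') ∧ Step v t i j i' j' := by
  have hp := hv.chainPair ht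
  have htn := ht.lt
  have hi := h.left_lt
  have hj := h.right_lt
  -- the freeness of the highest removed vertices is preserved
  have hL : ∀ i' j', j ≤ j' → j' < n - 1 - t → i' < t → i ≤ i' → i' ≤ i + 2 →
      (i < i' → leftX v i ≤ line (rightX v) (rightY v) j (leftY v i)) →
      (i + 1 < i' → leftX v (i + 1) ≤ line (rightX v) (rightY v) j (leftY v (i + 1))) →
      0 < i' → leftX v (i' - 1) ≤ line (rightX v) (rightY v) j' (leftY v (i' - 1)) := by
    intro i' j' h1 h2 h3 h4 h5 h6 h7 h8
    refine Inv.leftFree_mono hv ht (by omega) h1 h2 ?_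
    rcases h4.eq_or_lt with rfl | h9
    · exact h.left_free h8
    · rcases (Nat.succ_le_iff.2 h9).eq_or_lt with rfl | h10
      · exact h6 h9
      · obtain rfl : i' = i + 2 := by omega
        exact h7 h10
  have hR : ∀ i' j', i ≤ i' → i' < t → j' < n - 1 - t → j ≤ j' → j' ≤ j + 2 →
      (j < j' → line (leftX v) (leftY v) i (rightY v j) ≤ rightX v j) →
      (j + 1 < j' → line (leftX v) (leftY v) i (rightY v (j + 1)) ≤ rightX v (j + 1)) →
      0 < j' → line (leftX v) (leftY v) i' (rightY v (j' - 1)) ≤ rightX v (j' - 1) := by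
    intro i' j' h1 h2 h3 h4 h5 h6 h7 h8
    refine Inv.rightFree_mono hv ht (by omega) h1 h2 ?_
    rcases h4.eq_or_lt with rfl | h9
    · exact h.right_free h8
    · rcases (Nat.succ_le_iff.2 h9).eq_or_lt with rfl | h10
      · exact h6 h9
      · obtain rfl : j' = j + 2 := by omega
        exact h7 h10
  by_cases hX : leftX v (i + 1) ≤ line (rightX v) (rightY v) j (leftY v (i + 1))
  · have hPB := (hp.left_free_of_next_free hi hj hX).le
    by_cases hY : line (leftX v) (leftY v) i (rightY v (j + 1)) ≤ rightX v (j + 1)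
    · have hPA := (hp.free_of_next_free hi hj hY).le
      have hpiece : levelPiece (vert v) (i, n - 1 - j) =
          [i, i + 1, n - 1 - j, n - 1 - (j + 1)] := by
        unfold levelPiece
        rw [if_pos ((leftNextFree_iff hv ht hj).2 hX), if_pos ((rightNextFree_iff hv ht hi).2 hY)]
        simp only [show n - 1 - j - 1 = n - 1 - (j + 1) by omega]
      refine ⟨min (i + 2) (t - 1), min (j + 2) (n - 1 - t - 1), ?_, ?_⟩
      · unfold next
        rw [if_pos ((leftNextFree_iff hv ht hj).2 hX), if_pos ((rightNextFree_iff hv ht hi).2 hY)]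
        rw [Prod.mk.injEq]
        exact ⟨rfl, by omega⟩
      · refine ⟨⟨by omega, by omega, ?_, ?_⟩, by omega, ?_, ?_⟩
        · exact hL _ _ (by omega) (by omega) (by omega) (by omega) (by omega)
            (fun _ => hPB) (fun _ => hX)
        · exact hR _ _ (by omega) (by omega) (by omega) (by omega) (by omega)
            (fun _ => hPA) (fun _ => hY)
        · intro k h1 h2
          rw [hpiece]
          simp only [List.mem_cons]
          omega
        · intro l h1 h2
          rw [hpiece]
          simp only [List.mem_cons]
          omega
    · obtain ⟨hi1, hy⟩ := hp.below_next_of_lt_line hi hj (not_le.1 hY)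
      have hpiece : ∀ P : Prop, ∀ _ : Decidable P,
          (P ↔ line (leftX v) (leftY v) i (rightY v j) ≤ rightX v j) →
          levelPiece (vert v) (i, n - 1 - j) =
            leftEdgePiece (vert v) i (if P then n - 1 - j else n - 1 - j + 1) := by
        intro P _ hP
        unfold levelPiece
        rw [if_pos ((leftNextFree_iff hv ht hj).2 hX),
          if_neg (fun hc => hY ((rightNextFree_iff hv ht hi).1 hc))]
        simp only [rightFree_iff hv ht hi, hP]
      by_cases hPA : line (leftX v) (leftY v) i (rightY v j) ≤ rightX v j
      · have hpc := hpiece True inferInstance (by simpa using hPA)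
        rw [if_pos trivial] at hpc
        obtain ⟨m1, m2, m3⟩ := mem_leftEdgePiece (vert v) i (n - 1 - j)
        refine ⟨min (i + 2) (t - 1), min (j + 1) (n - 1 - t - 1), ?_, ?_⟩
        · unfold next
          rw [if_pos ((leftNextFree_iff hv ht hj).2 hX),
            if_neg (fun hc => hY ((rightNextFree_iff hv ht hi).1 hc)),
            if_pos ((rightFree_iff hv ht hi).2 hPA), Prod.mk.injEq]
          exact ⟨rfl, by omega⟩
        · refine ⟨⟨by omega, by omega, ?_, ?_⟩, by omega, ?_, ?_⟩
          · exact hL _ _ (by omega) (by omega) (by omega) (by omega) (by omega)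
              (fun _ => hPB) (fun _ => hX)
          · exact hR _ _ (by omega) (by omega) (by omega) (by omega) (by omega)
              (fun _ => hPA) (fun _ => by omega)
          · intro k h1 h2
            rw [hpc]
            obtain rfl | rfl : k = i ∨ k = i + 1 := by omega
            · exact m1
            · exact m2
          · intro l h1 h2
            rw [hpc]
            obtain rfl : l = j := by omega
            exact m3
      · have hpc := hpiece False inferInstance (by simpa using hPA)
        rw [if_neg not_false] at hpc
        obtain ⟨m1, m2, -⟩ := mem_leftEdgePiece (vert v) i (n - 1 - j + 1)
        refine ⟨min (i + 2) (t - 1), j, ?_, ?_⟩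
        · unfold next
          rw [if_pos ((leftNextFree_iff hv ht hj).2 hX),
            if_neg (fun hc => hY ((rightNextFree_iff hv ht hi).1 hc)),
            if_neg (fun hc => hPA ((rightFree_iff hv ht hi).1 hc))]
        · refine ⟨⟨by omega, by omega, ?_, ?_⟩, by omega, ?_, ?_⟩
          · exact hL _ _ (by omega) (by omega) (by omega) (by omega) (by omega)
              (fun _ => hPB) (fun _ => hX)
          · exact hR _ _ (by omega) (by omega) (by omega) (by omega) (by omega)
              (fun _ => by omega) (fun _ => by omega)
          · intro k h1 h2
            rw [hpc]
            obtain rfl | rfl : k = i ∨ k = i + 1 := by omega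
            · exact m1
            · exact m2
          · intro l h1 h2
            omega
  · obtain ⟨hj1, hy⟩ := hp.below_next_of_line_lt hi hj (not_le.1 hX)
    have hY : line (leftX v) (leftY v) i (rightY v (j + 1)) ≤ rightX v (j + 1) :=
      (hp.line_lt_of_le hi hj1 hy.le).le
    have hPA := (hp.free_of_next_free hi hj hY).le
    have hpiece : ∀ P : Prop, ∀ _ : Decidable P,
        (P ↔ leftX v i ≤ line (rightX v) (rightY v) j (leftY v i)) →
        levelPiece (vert v) (i, n - 1 - j) =
          rightEdgePiece (vert v) (n - 1 - j) (if P then i else i - 1) := by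
      intro P _ hP
      unfold levelPiece
      rw [if_neg (fun hc => hX ((leftNextFree_iff hv ht hj).1 hc))]
      simp only [leftFree_iff hv ht hj, hP]
    by_cases hPB : leftX v i ≤ line (rightX v) (rightY v) j (leftY v i)
    · have hpc := hpiece True inferInstance (by simpa using hPB)
      rw [if_pos trivial] at hpc
      obtain ⟨m1, m2, m3⟩ := mem_rightEdgePiece (vert v) (n - 1 - j) i
      refine ⟨min (i + 1) (t - 1), min (j + 2) (n - 1 - t - 1), ?_, ?_⟩
      · unfold next
        rw [if_neg (fun hc => hX ((leftNextFree_iff hv ht hj).1 hc)),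
          if_pos ((leftFree_iff hv ht hj).2 hPB), Prod.mk.injEq]
        exact ⟨rfl, by omega⟩
      · refine ⟨⟨by omega, by omega, ?_, ?_⟩, by omega, ?_, ?_⟩
        · exact hL _ _ (by omega) (by omega) (by omega) (by omega) (by omega)
            (fun _ => hPB) (fun _ => by omega)
        · exact hR _ _ (by omega) (by omega) (by omega) (by omega) (by omega)
            (fun _ => hPA) (fun _ => hY)
        · intro k h1 h2
          rw [hpc]
          obtain rfl : k = i := by omega
          exact m3
        · intro l h1 h2
          rw [hpc]
          obtain rfl | rfl : l = j ∨ l = j + 1 := by omega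
          · exact m1
          · rw [show n - 1 - (j + 1) = n - 1 - j - 1 by omega]
            exact m2
    · have hpc := hpiece False inferInstance (by simpa using hPB)
      rw [if_neg not_false] at hpc
      obtain ⟨m1, m2, -⟩ := mem_rightEdgePiece (vert v) (n - 1 - j) (i - 1)
      refine ⟨i, min (j + 2) (n - 1 - t - 1), ?_, ?_⟩
      · unfold next
        rw [if_neg (fun hc => hX ((leftNextFree_iff hv ht hj).1 hc)),
          if_neg (fun hc => hPB ((leftFree_iff hv ht hj).1 hc)), Prod.mk.injEq]
        exact ⟨rfl, by omega⟩
      · refine ⟨⟨by omega, by omega, ?_, ?_⟩, by omega, ?_, ?_⟩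
        · exact hL _ _ (by omega) (by omega) (by omega) (by omega) (by omega)
            (fun _ => by omega) (fun _ => by omega)
        · exact hR _ _ (by omega) (by omega) (by omega) (by omega) (by omega)
            (fun _ => hPA) (fun _ => hY)
        · intro k h1 h2
          omega
        · intro l h1 h2
          rw [hpc]
          obtain rfl | rfl : l = j ∨ l = j + 1 := by omega
          · exact m1
          · rw [show n - 1 - (j + 1) = n - 1 - j - 1 by omega]
            exact m2

end pieces

/-! ### The hidden set and the cover -/

/-- Some vertex other than the two neighbours of the apex and the apex remains. -/
def Continues (t : ℕ) (s : ℕ × ℕ) : Prop := s.1 + 1 < t ∨ t + 1 < s.2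

/-- The sequence of states of the greedy partition. -/
noncomputable def run (V : ℕ → Plane) (n t r : ℕ) : ℕ × ℕ := (next V t)^[r] (0, n - 1)

/-- One vertex of each of the levels `r - 1, …, 0`, each below its predecessor. -/
noncomputable def picks (V : ℕ → Plane) (S : ℕ → ℕ × ℕ) : ℕ → Bool → List ℕ
  | 0, _ => []
  | r + 1, b => (pick V b (S r)).1 :: picks V S r (pick V b (S r)).2

theorem length_picks (V : ℕ → Plane) (S : ℕ → ℕ × ℕ) (r : ℕ) (b : Bool) :
    (picks V S r b).length = r := by
  induction r generalizing b with
  | zero => rfl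
  | succ r ih => rw [picks, List.length_cons, ih]

section hidden
variable {n : ℕ} [NeZero n] {v : Fin n → Plane} {t : ℕ}

theorem run_succ (V : ℕ → Plane) (n t r : ℕ) : run V n t (r + 1) = next V t (run V n t r) := by
  rw [run, run, Function.iterate_succ_apply']

theorem inv_zero (hv : IsFunnel v) (ht : IsApex v t) : Inv v t 0 0 :=
  ⟨ht.pos, (hv.chainPair ht).pos_right, fun h => absurd h (lt_irrefl _),
    fun h => absurd h (lt_irrefl _)⟩

theorem run_inv (hv : IsFunnel v) (ht : IsApex v t) (r : ℕ)
    (h : ∀ s < r, Continues t (run (vert v) n t s)) :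
    ∃ i j, run (vert v) n t r = (i, n - 1 - j) ∧ Inv v t i j ∧ r ≤ i + j := by
  induction r with
  | zero => exact ⟨0, 0, rfl, inv_zero hv ht, le_rfl⟩
  | succ r ih =>
    obtain ⟨i, j, e, hinv, hr⟩ := ih fun s hs => h s (by omega)
    have hc := h r (by omega)
    rw [e] at hc
    have hj := hinv.right_lt
    obtain ⟨i', j', e', hs⟩ := exists_step hv ht hinv (by
      unfold Continues at hc
      simp only at hc
      omega)
    refine ⟨i', j', by rw [run_succ, e, e'], hs.inv, ?_⟩
    have := hs.progress
    omega

theorem exists_run_end (hv : IsFunnel v) (ht : IsApex v t) :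
    ∃ m ≤ n, (∀ r < m, Continues t (run (vert v) n t r)) ∧
      ¬ Continues t (run (vert v) n t m) := by
  classical
  have hex : ∃ r, r ≤ n ∧ ¬ Continues t (run (vert v) n t r) := by
    by_contra hcon
    push Not at hcon
    obtain ⟨i, j, -, hinv, hr⟩ := run_inv hv ht n fun s hs => hcon s hs.le
    have h1 := hinv.left_lt
    have h2 := hinv.right_lt
    omega
  refine ⟨Nat.find hex, (Nat.find_spec hex).1, fun r hr => ?_, (Nat.find_spec hex).2⟩
  by_contra hc
  exact Nat.find_min hex hr ⟨hr.le.trans (Nat.find_spec hex).1, hc⟩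

/-- The vertex `x` is the apex or remains in the state `(i, j)` and is not a neighbour of the apex;
the flag tells its chain. -/
def Remains (n t : ℕ) (b : Bool) (x i j : ℕ) : Prop :=
  match b with
  | true => x = t ∨ i ≤ x ∧ x + 2 ≤ t
  | false => ∃ l, x = n - 1 - l ∧ j ≤ l ∧ l + 1 < n - 1 - t

theorem pick_spec (hv : IsFunnel v) (ht : IsApex v t) {i j i' j' : ℕ} (h : Inv v t i j)
    (hcont : i + 1 < t ∨ j + 1 < n - 1 - t) (h' : Inv v t i' j')
    (hnext : next (vert v) t (i, n - 1 - j) = (i', n - 1 - j')) {b : Bool} {x : ℕ}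
    (hx : Remains n t b x i' j') :
    Remains n t (pick (vert v) b (i, n - 1 - j)).2 (pick (vert v) b (i, n - 1 - j)).1 i j ∧
      Below (vert v) t (pick (vert v) b (i, n - 1 - j)).1 x ∧
      (pick (vert v) b (i, n - 1 - j)).1 ≠ t ∧ (pick (vert v) b (i, n - 1 - j)).1 < n := by
  have hp := hv.chainPair ht
  have htn := ht.lt
  have hi := h.left_lt
  have hj := h.right_lt
  have hj' := h'.right_lt
  unfold next at hnext
  simp only [leftNextFree_iff hv ht hj, rightNextFree_iff hv ht hi, leftFree_iff hv ht hj,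
    rightFree_iff hv ht hi] at hnext
  cases b with
  | true =>
    simp only [Remains] at hx
    have hxt : x ≤ t := by omega
    by_cases hX : leftX v (i + 1) ≤ line (rightX v) (rightY v) j (leftY v (i + 1))
    · have hpick : pick (vert v) true (i, n - 1 - j) = (i, true) := by
        simp only [pick, if_true, leftNextFree_iff hv ht hj, if_pos hX]
      rw [hpick]
      have hi2 : i + 2 ≤ t := by
        by_contra hcon
        have hit : i + 1 = t := by omega
        rw [hit] at hX
        linarith [hp.line_lt_apex (j := j) (by omega)]
      have hbel : i + 2 ≤ x := by
        rw [if_pos hX] at hnext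
        have : i' = min (i + 2) (t - 1) := by
          split_ifs at hnext <;> exact (congrArg Prod.fst hnext).symm
        omega
      refine ⟨Or.inr ⟨le_rfl, hi2⟩, ?_, by simp only; omega, by simp only; omega⟩
      rw [Below, if_pos (by simp only; omega), if_pos hxt]
      exact hbel
    · have hpick : pick (vert v) true (i, n - 1 - j) = (n - 1 - j, false) := by
        simp only [pick, if_true, leftNextFree_iff hv ht hj, if_neg hX]
      rw [hpick]
      obtain ⟨hj1, -⟩ := hp.below_next_of_line_lt hi hj (not_le.1 hX)
      refine ⟨⟨j, rfl, le_rfl, hj1⟩, ?_, by simp only; omega, by simp only; omega⟩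
      rw [Below, if_neg (by simp only; omega), if_pos hxt]
      simp only
      rw [below_right_left hv ht hj]
      rcases hx with rfl | ⟨hx1, hx2⟩
      · exact hp.line_lt_apex hj1
      · rw [if_neg hX] at hnext
        rcases Nat.lt_or_ge i x with hix | hix
        · rcases (Nat.succ_le_iff.2 hix).eq_or_lt with rfl | hlt
          · exact not_le.1 hX
          · exact hp.line_lt_above hj hlt (by omega) (not_le.1 hX).le
        · by_contra hcon
          have hPB : leftX v i ≤ line (rightX v) (rightY v) j (leftY v i) := by
            by_contra hno
            rw [if_neg hno] at hnext
            have : i' = i := (congrArg Prod.fst hnext).symm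
            obtain rfl : x = i := by omega
            exact hcon (not_le.1 hno)
          rw [if_pos hPB] at hnext
          have : i' = min (i + 1) (t - 1) := (congrArg Prod.fst hnext).symm
          omega
  | false =>
    obtain ⟨l, rfl, hl1, hl2⟩ := hx
    by_cases hY : line (leftX v) (leftY v) i (rightY v (j + 1)) ≤ rightX v (j + 1)
    · have hpick : pick (vert v) false (i, n - 1 - j) = (n - 1 - j, false) := by
        simp only [pick, Bool.false_eq_true, if_false, rightNextFree_iff hv ht hi, if_pos hY]
      rw [hpick]
      have hbel : j + 2 ≤ l := by
        rw [if_pos hY] at hnext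
        have : n - 1 - j' = max (n - 1 - j - 2) (t + 1) := by
          split_ifs at hnext <;> exact (congrArg Prod.snd hnext).symm
        omega
      refine ⟨⟨j, rfl, le_rfl, by omega⟩, ?_, by simp only; omega, by simp only; omega⟩
      rw [Below, if_neg (by simp only; omega), if_neg (by omega)]
      simp only
      omega
    · have hpick : pick (vert v) false (i, n - 1 - j) = (i, true) := by
        simp only [pick, Bool.false_eq_true, if_false, rightNextFree_iff hv ht hi, if_neg hY]
      rw [hpick]
      obtain ⟨hi1, -⟩ := hp.below_next_of_lt_line hi hj (not_le.1 hY)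
      refine ⟨Or.inr ⟨le_rfl, hi1⟩, ?_, by simp only; omega, by simp only; omega⟩
      rw [Below, if_pos (by simp only; omega), if_neg (by omega)]
      simp only
      rw [below_left_right hv ht hi]
      have hX : leftX v (i + 1) ≤ line (rightX v) (rightY v) j (leftY v (i + 1)) := by
        by_contra hno
        have h1 := (hp.below_next_of_line_lt hi hj (not_le.1 hno)).2
        have h2 := (hp.below_next_of_lt_line hi hj (not_le.1 hY)).2
        exact lt_asymm h1 h2
      rw [if_pos hX, if_neg hY] at hnext
      rcases Nat.lt_or_ge j l with hjl | hjl
      · rcases (Nat.succ_le_iff.2 hjl).eq_or_lt with rfl | hlt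
        · exact not_le.1 hY
        · exact hp.lt_line_above hi hlt (by omega) (not_le.1 hY).le
      · by_contra hcon
        have hPA : line (leftX v) (leftY v) i (rightY v j) ≤ rightX v j := by
          by_contra hno
          rw [if_neg hno] at hnext
          have : n - 1 - j' = n - 1 - j := (congrArg Prod.snd hnext).symm
          obtain rfl : l = j := by omega
          exact hcon (not_le.1 hno)
        rw [if_pos hPA] at hnext
        have : n - 1 - j' = max (n - 1 - j - 1) (t + 1) := (congrArg Prod.snd hnext).symm
        omega

/-- `b` is below `a` and is not the apex. -/
def Above (v : Fin n → Plane) (t a b : ℕ) : Prop :=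
  Below (vert v) t b a ∧ b ≠ t ∧ b < n ∧ a < n

theorem isChain_picks (hv : IsFunnel v) (ht : IsApex v t) (r : ℕ)
    (h : ∀ s < r, Continues t (run (vert v) n t s)) {b : Bool} {x i j : ℕ} (hxn : x < n)
    (hrun : run (vert v) n t r = (i, n - 1 - j)) (hinv : Inv v t i j) (hx : Remains n t b x i j) :
    List.IsChain (Above v t) (x :: picks (vert v) (run (vert v) n t) r b) := by
  induction r generalizing b x i j with
  | zero => simp [picks]
  | succ r ih =>
    have hr : ∀ s < r, Continues t (run (vert v) n t s) := fun s hs => h s (by omega)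
    obtain ⟨i₀, j₀, e, hinv₀, -⟩ := run_inv hv ht r hr
    have hc := h r (by omega)
    rw [e] at hc
    have hj := hinv₀.right_lt
    rw [run_succ, e] at hrun
    obtain ⟨h1, h2, h3, h4⟩ := pick_spec hv ht hinv₀ (by
      unfold Continues at hc
      simp only at hc
      omega) hinv hrun hx
    rw [picks, e]
    exact List.isChain_cons_cons.2 ⟨⟨h2, h3, h4, hxn⟩, ih hr h4 e hinv₀ h1⟩

theorem pairwise_picks (hv : IsFunnel v) (ht : IsApex v t) {m : ℕ}
    (h : ∀ s < m, Continues t (run (vert v) n t s)) :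
    List.Pairwise (Above v t) (t :: picks (vert v) (run (vert v) n t) m true) := by
  have htn := ht.lt
  obtain ⟨i, j, e, hinv, -⟩ := run_inv hv ht m h
  have hchain := isChain_picks hv ht m h (b := true) (x := t) (by omega) e hinv (Or.inl rfl)
  have : Trans (Above v t) (Above v t) (Above v t) := ⟨fun {a b c} hab hbc =>
    ⟨Below.trans hv ht hab.2.2.2 hab.2.2.1 hbc.2.2.1 hab.2.1 hbc.2.1 hbc.1 hab.1, hbc.2.1,
      hbc.2.2.1, hab.2.2.2⟩⟩
  exact List.isChain_iff_pairwise.1 hchain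

/-- A sequence of natural numbers that starts at zero and takes steps of any size passes every
value below its last one. -/
theorem exists_step_over {f : ℕ → ℕ} {m k : ℕ} (h0 : f 0 ≤ k) (hm : k < f m) :
    ∃ r < m, f r ≤ k ∧ k < f (r + 1) := by
  induction m with
  | zero => omega
  | succ m ih =>
    by_cases hk : k < f m
    · obtain ⟨r, hr, h⟩ := ih hk
      exact ⟨r, by omega, h⟩
    · exact ⟨m, by omega, by omega, hm⟩

/-- The pieces of the levels, and the triangle at the apex. -/
noncomputable def pieces (V : ℕ → Plane) (n t m : ℕ) : List (List ℕ) :=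
  (List.range m).map (fun r => levelPiece V (run V n t r)) ++ [[t - 1, t, t + 1]]

theorem isGoodPiece_of_mem_pieces (hv : IsFunnel v) (ht : IsApex v t) {m : ℕ}
    (h : ∀ s < m, Continues t (run (vert v) n t s)) {L : List ℕ}
    (hL : L ∈ pieces (vert v) n t m) : IsGoodPiece v L := by
  have hp := hv.chainPair ht
  have htn := ht.lt
  have ht0 := ht.pos
  rw [pieces, List.mem_append, List.mem_map, List.mem_singleton] at hL
  rcases hL with ⟨r, hr, rfl⟩ | rfl
  · rw [List.mem_range] at hr
    obtain ⟨i, j, e, hinv, -⟩ := run_inv hv ht r fun s hs => h s (by omega)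
    rw [e]
    exact isGoodPiece_level hv ht hinv
  · obtain ⟨s, rfl⟩ : ∃ s, t = s + 1 := ⟨t - 1, by omega⟩
    obtain ⟨j, hj⟩ : ∃ j, j + 1 = n - 1 - (s + 1) := ⟨n - 1 - (s + 1) - 1, by omega⟩
    have hjt : n - 1 - j = s + 1 + 1 := by omega
    have a1 : line (leftX v) (leftY v) s (leftY v s) ≤ leftX v s := (line_self _ _ _).le
    have a2 : line (leftX v) (leftY v) s (leftY v (s + 1)) ≤ leftX v (s + 1) :=
      (hp.left.line_succ (by omega)).le
    have a3 := hp.line_last_lt (i := s) (j := j) rfl (by omega)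
    have a3' := a3.le
    have b1 : rightX v j ≤ line (rightX v) (rightY v) j (rightY v j) := (line_self _ _ _).ge
    have b2 : leftX v (s + 1) ≤ line (rightX v) (rightY v) j (leftY v (s + 1)) :=
      (hp.last_line_apex hj).ge
    have b3 : leftX v s ≤ line (rightX v) (rightY v) j (leftY v s) := by
      refine (hp.lt_line_of_le (by omega) (by omega) ?_).le
      rw [hj, ← hp.apex_y]
      exact (hp.ya_lt_apex (by omega)).le
    rw [Nat.add_sub_cancel, ← hjt]
    refine isGoodPiece_of hv ht (i := s) (j := j) (by omega) (by omega) ?_ ?_ ?_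
      (a := s) (b := s + 1) (c := n - 1 - j) (by simp) (by simp) (by simp)
      ((orient_left_neg_iff hv ht (by omega) _).2 a3).ne <;>
    · intro k hk
      simp only [List.mem_cons, List.not_mem_nil, or_false] at hk
      rcases hk with rfl | rfl | rfl
      all_goals first | omega | assumption

theorem exists_mem_pieces (hv : IsFunnel v) (ht : IsApex v t) {m : ℕ}
    (h : ∀ s < m, Continues t (run (vert v) n t s)) (hm : ¬ Continues t (run (vert v) n t m))
    {k : ℕ} (hk : k < n) : ∃ L ∈ pieces (vert v) n t m, k ∈ L := by
  have htn := ht.lt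
  have ht0 := ht.pos
  by_cases hkt : k = t - 1 ∨ k = t ∨ k = t + 1
  · exact ⟨[t - 1, t, t + 1], by simp [pieces], by simpa using hkt⟩
  have hstep : ∀ r < m, ∃ i j i' j', run (vert v) n t r = (i, n - 1 - j) ∧
      run (vert v) n t (r + 1) = (i', n - 1 - j') ∧ j < n - 1 - t ∧ Step v t i j i' j' := by
    intro r hr
    obtain ⟨i, j, e, hinv, -⟩ := run_inv hv ht r fun s hs => h s (by omega)
    have hc := h r hr
    rw [e] at hc
    have hj := hinv.right_lt
    obtain ⟨i', j', e', hs⟩ := exists_step hv ht hinv (by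
      unfold Continues at hc
      simp only at hc
      omega)
    exact ⟨i, j, i', j', e, by rw [run_succ, e, e'], hj, hs⟩
  have hmem : ∀ r < m, levelPiece (vert v) (run (vert v) n t r) ∈ pieces (vert v) n t m := by
    intro r hr
    rw [pieces, List.mem_append, List.mem_map]
    exact Or.inl ⟨r, List.mem_range.2 hr, rfl⟩
  obtain ⟨im, jm, em, hinvm, -⟩ := run_inv hv ht m h
  have hm1 := hinvm.left_lt
  have hm2 := hinvm.right_lt
  rw [em] at hm
  unfold Continues at hm
  simp only at hm
  rcases Nat.lt_or_ge t k with h1 | h1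
  · obtain ⟨r, hr, h2, h3⟩ := exists_step_over (f := fun r => n - 1 - (run (vert v) n t r).2)
      (m := m) (k := n - 1 - k) (by simp only [run, Function.iterate_zero, id]; omega)
      (by simp only [em]; omega)
    obtain ⟨i, j, i', j', e, e', hj, hs⟩ := hstep r hr
    refine ⟨_, hmem r hr, ?_⟩
    have hj' := hs.inv.right_lt
    simp only [e, e'] at h2 h3
    have := hs.right_mem (n - 1 - k) (by omega) (by omega)
    rwa [show n - 1 - (n - 1 - k) = k by omega, ← e] at this
  · obtain ⟨r, hr, h2, h3⟩ := exists_step_over (f := fun r => (run (vert v) n t r).1)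
      (m := m) (k := k) (by simp [run]) (by simp only [em]; omega)
    obtain ⟨i, j, i', j', e, e', hj, hs⟩ := hstep r hr
    refine ⟨_, hmem r hr, ?_⟩
    simp only [e, e'] at h2 h3
    rw [e]
    exact hs.left_mem k h2 h3

theorem affineSpan_eq_top_of_orient_ne {S : Set Plane} {a b c : Plane} (ha : a ∈ S) (hb : b ∈ S)
    (hc : c ∈ S) (h : orient a b c ≠ 0) : affineSpan ℝ S = ⊤ := by
  rw [eq_top_iff]
  intro x _
  have ha' := subset_affineSpan ℝ S ha
  have hb' := subset_affineSpan ℝ S hb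
  have hc' := subset_affineSpan ℝ S hc
  have hx : x = (orient a x c / orient a b c) • (b -ᵥ a) +ᵥ
      ((orient a b x / orient a b c) • (c -ᵥ a) +ᵥ a) := by
    simp only [vsub_eq_sub, vadd_eq_add]
    apply Prod.ext
    · simp only [Prod.fst_add, Prod.smul_fst, smul_eq_mul, Prod.fst_sub]
      field_simp
      simp only [orient]
      ring
    · simp only [Prod.snd_add, Prod.smul_snd, smul_eq_mul, Prod.snd_sub]
      field_simp
      simp only [orient]
      ring
  rw [hx]
  exact AffineSubspace.smul_vsub_vadd_mem _ _ hb' ha'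
    (AffineSubspace.smul_vsub_vadd_mem _ _ hc' ha' ha')

theorem piece_eq {n : ℕ} (v : Fin n → Plane) (l : List (Fin n)) :
    piece v l = convexHull ℝ {p | ∃ k ∈ l.map Fin.val, p = vert v k} := by
  rw [piece]
  congr 1
  ext p
  constructor
  · rintro ⟨i, hi, rfl⟩
    exact ⟨i, List.mem_map_of_mem hi, (vert_val i).symm⟩
  · rintro ⟨k, hk, rfl⟩
    obtain ⟨i, hi, rfl⟩ := List.mem_map.1 hk
    exact ⟨i, hi, vert_val i⟩

theorem IsGoodPiece.isConvexPolygon {l : List (Fin n)} (h : IsGoodPiece v (l.map Fin.val)) :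
    IsConvexPolygon (piece v l) := by
  obtain ⟨a, ha, b, hb, c, hc, ho⟩ := h.orient_ne
  rw [piece_eq]
  refine ⟨?_, _, ?_, rfl⟩
  · rw [interior_convexHull_nonempty_iff_affineSpan_eq_top]
    exact affineSpan_eq_top_of_orient_ne ⟨a, ha, rfl⟩ ⟨b, hb, rfl⟩ ⟨c, hc, rfl⟩ ho
  · refine ((List.finite_toSet (l.map Fin.val)).image (vert v)).subset ?_
    rintro _ ⟨k, hk, rfl⟩
    exact ⟨k, hk, rfl⟩

/-- A convex polygon inside the polygon contains at most one vertex of a hidden set. -/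
theorem card_le_ncard {H : Finset (Fin n)} (hH : IsHiddenVertexSet v H) {C : Set (Set Plane)}
    (hC : IsVertexConvexCover v C) : H.card ≤ C.ncard := by
  choose f hf hmem using hC.covers
  rw [← Set.ncard_coe_finset]
  refine Set.ncard_le_ncard_of_injOn f (fun i _ => hf i) ?_ hC.finite
  intro i hi j hj hij
  by_contra hne
  refine hH i hi j hj hne (Set.Subset.trans ?_ (hC.inside _ (hf i)))
  obtain ⟨-, F, -, hF⟩ := hC.convex _ (hf i)
  have hconv : Convex ℝ (f i) := by rw [hF]; exact convex_convexHull ℝ F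
  exact hconv.segment_subset (hmem i) (hij ▸ hmem j)

theorem exists_fin_list {n : ℕ} {L : List ℕ} (h : ∀ k ∈ L, k < n) :
    ∃ l : List (Fin n), l.map Fin.val = L :=
  ⟨L.pmap Fin.mk h, by simp [List.map_pmap]⟩

theorem exists_fin_lists {n : ℕ} {C : List (List ℕ)} (h : ∀ L ∈ C, ∀ k ∈ L, k < n) :
    ∃ c : List (List (Fin n)), c.map (List.map Fin.val) = C := by
  induction C with
  | nil => exact ⟨[], rfl⟩
  | cons L C ih =>
    obtain ⟨c, hc⟩ := ih fun L' hL' => h L' (List.mem_cons_of_mem _ hL')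
    obtain ⟨l, hl⟩ := exists_fin_list (h L List.mem_cons_self)
    exact ⟨l :: c, by rw [List.map_cons, hl, hc]⟩

/-- The picked vertices form a hidden set and the pieces a convex cover of the same size. -/
theorem exists_hidden_cover (hv : IsFunnel v) (ht : IsApex v t) {m : ℕ}
    (h : ∀ s < m, Continues t (run (vert v) n t s)) (hm : ¬ Continues t (run (vert v) n t m)) :
    ∃ (H : List (Fin n)) (C : List (List (Fin n))),
      H.map Fin.val = t :: picks (vert v) (run (vert v) n t) m true ∧
      C.map (List.map Fin.val) = pieces (vert v) n t m ∧
      H.Nodup ∧ IsHiddenVertexSet v H.toFinset ∧ (C.map (piece v)).Nodup ∧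
      IsVertexConvexCover v {S | S ∈ C.map (piece v)} ∧ H.length = C.length := by
  classical
  have htn := ht.lt
  have hpw := pairwise_picks hv ht h
  obtain ⟨H, hH⟩ := exists_fin_list (n := n) (L := t :: picks (vert v) (run (vert v) n t) m true) (by
    intro k hk
    rcases List.mem_cons.1 hk with rfl | hk
    · omega
    · exact ((List.pairwise_cons.1 hpw).1 k hk).2.2.1)
  obtain ⟨C, hC⟩ := exists_fin_lists (n := n) (C := pieces (vert v) n t m)
    fun L hL => (isGoodPiece_of_mem_pieces hv ht h hL).lt
  have hgood : ∀ l ∈ C, IsGoodPiece v (l.map Fin.val) := fun l hl =>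
    isGoodPiece_of_mem_pieces hv ht h (hC ▸ List.mem_map_of_mem hl)
  have hlen : H.length = C.length := by
    have e1 := congrArg List.length hH
    have e2 := congrArg List.length hC
    rw [List.length_map, List.length_cons, length_picks] at e1
    rw [List.length_map, pieces, List.length_append, List.length_map, List.length_range,
      List.length_singleton] at e2
    omega
  rw [← hH, List.pairwise_map] at hpw
  have hsee : ∀ {i j : Fin n}, Above v t i j → ¬ Sees v (v i) (v j) := by
    intro i j hij
    have := not_sees_of_below hv ht hij.2.2.1 hij.2.2.2 hij.2.1 hij.1
    rw [vert_val, vert_val] at this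
    unfold Sees at this ⊢
    rwa [segment_symm]
  have hnd : H.Nodup := by
    refine hpw.imp fun {i j} hij heq => ?_
    subst heq
    have := hij.1
    unfold Below at this
    rcases Nat.lt_or_ge t i with h1 | h1
    · rw [if_neg (by omega), if_neg (by omega)] at this; omega
    · rw [if_pos h1, if_pos h1] at this; omega
  have hhid : IsHiddenVertexSet v H.toFinset := by
    intro i hi j hj hij
    rw [List.mem_toFinset] at hi hj
    have hsymm : Std.Symm fun i j : Fin n => ¬ Sees v (v i) (v j) := by
      refine ⟨fun i j hn hs => hn ?_⟩
      unfold Sees at hs ⊢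
      rwa [segment_symm]
    have hp2 : H.Pairwise fun i j => ¬ Sees v (v i) (v j) := hpw.imp hsee
    exact hp2.forall hi hj hij
  have hcov : IsVertexConvexCover v {S | S ∈ C.map (piece v)} := by
    refine ⟨List.finite_toSet _, ?_, ?_, ?_⟩
    · intro S hS
      obtain ⟨l, hl, rfl⟩ := List.mem_map.1 hS
      exact (hgood l hl).isConvexPolygon
    · intro S hS
      obtain ⟨l, hl, rfl⟩ := List.mem_map.1 hS
      rw [piece_eq]
      exact (hgood l hl).subset
    · intro i
      obtain ⟨L, hL, hiL⟩ := exists_mem_pieces hv ht h hm i.2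
      rw [← hC] at hL
      obtain ⟨l, hl, rfl⟩ := List.mem_map.1 hL
      refine ⟨piece v l, List.mem_map_of_mem hl, ?_⟩
      rw [piece_eq]
      exact subset_convexHull ℝ _ ⟨i, hiL, (vert_val i).symm⟩
  refine ⟨H, C, hH, hC, hnd, hhid, ?_, hcov, hlen⟩
  -- by the duality bound the pieces are pairwise distinct
  have hle := card_le_ncard hhid hcov
  have e : {S | S ∈ C.map (piece v)} = ((C.map (piece v)).toFinset : Set (Set Plane)) := by
    ext S; simp
  rw [List.toFinset_card_of_nodup hnd, e, Set.ncard_coe_finset, hlen] at hle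
  rw [← List.dedup_eq_self]
  refine (List.dedup_sublist _).eq_of_length_le ?_
  rw [List.length_map]
  rwa [List.card_toFinset] at hle

end hidden

end Funnel

namespace RealRAM

open Funnel (Plane orient vert LeftNextFree RightNextFree LeftFree RightFree next levelPiece
  leftEdgePiece rightEdgePiece pick picks pieces run Continues)

/-! ### Running programs of the real RAM -/

/-- Started in `s`, the program halts within `c` steps in a state with the property `Q`. -/
def Runs (P : Prog) (c : ℕ) (s : State) (Q : State → Prop) : Prop :=
  ∃ k s', Exec P s k s' ∧ k ≤ c ∧ Q s'

/-- The weakest precondition of a program without loops. Loops get the precondition `False`. -/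
def wp : Prog → (State → Prop) → State → Prop
  | .setI a e, Q, s => Q { s with I := Function.update s.I (a.eval s) (e.eval s) }
  | .setR a e, Q, s => Q { s with R := Function.update s.R (a.eval s) (e.eval s) }
  | .write e, Q, s => Q { s with out := s.out ++ [e.eval s] }
  | .seq P P', Q, s => wp P (wp P' Q) s
  | .ite b P P', Q, s => (b.eval s → wp P Q s) ∧ (¬ b.eval s → wp P' Q s)
  | .while _ _, _, _ => False

/-- The number of steps is at most `bound P * n` if every loop of `P` has a body without loops and
runs for at most `n` rounds, where `0 < n`. For programs without loops it is at most `bound P`. -/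
def bound : Prog → ℕ
  | .setI a e => a.cost + e.cost + 1
  | .setR a e => a.cost + e.cost + 1
  | .write e => e.cost + 1
  | .seq P P' => bound P + bound P'
  | .ite b P P' => b.cost + 1 + (bound P + bound P')
  | .while b P => b.cost + 1 + bound P + (b.cost + 1)

theorem runs_bound_of_wp {P : Prog} {Q : State → Prop} {s : State} (h : wp P Q s) :
    Runs P (bound P) s Q := by
  induction P generalizing Q s with
  | setI a e => exact ⟨_, _, .setI a e s, le_rfl, h⟩
  | setR a e => exact ⟨_, _, .setR a e s, le_rfl, h⟩
  | write e => exact ⟨_, _, .write e s, le_rfl, h⟩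
  | seq P P' ih ih' =>
    obtain ⟨k, s', hk, hkc, h'⟩ := ih h
    obtain ⟨k', s'', hk', hkc', h''⟩ := ih' h'
    exact ⟨_, _, .seq hk hk', Nat.add_le_add hkc hkc', h''⟩
  | ite b P P' ih ih' =>
    by_cases hb : b.eval s
    · obtain ⟨k, s', hk, hkc, h'⟩ := ih (h.1 hb)
      exact ⟨_, _, .ite_true hb hk, by rw [bound]; omega, h'⟩
    · obtain ⟨k, s', hk, hkc, h'⟩ := ih' (h.2 hb)
      exact ⟨_, _, .ite_false hb hk, by rw [bound]; omega, h'⟩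
  | _ => exact h.elim

theorem runs_of_wp {P : Prog} {n : ℕ} (hn : 0 < n) {Q : State → Prop} {s : State}
    (h : wp P Q s) : Runs P (bound P * n) s Q := by
  obtain ⟨k, s', hk, hkc, h'⟩ := runs_bound_of_wp h
  exact ⟨k, s', hk, hkc.trans (Nat.le_mul_of_pos_right _ hn), h'⟩

theorem Runs.seq {P P' : Prog} {n : ℕ} {s : State} {Q Q' : State → Prop}
    (h : Runs P (bound P * n) s Q) (h' : ∀ s', Q s' → Runs P' (bound P' * n) s' Q') :
    Runs (.seq P P') (bound (.seq P P') * n) s Q' := by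
  obtain ⟨k, s', hk, hkc, hQ⟩ := h
  obtain ⟨k', s'', hk', hkc', hQ'⟩ := h' s' hQ
  exact ⟨_, _, .seq hk hk', (Nat.add_le_add hkc hkc').trans_eq (add_mul _ _ _).symm, hQ'⟩

/-- A loop whose `r`-th round leads from the `r`-th to the next member of a sequence of assertions,
and whose test fails after `m` rounds. -/
theorem runs_while {b : Test} {P : Prog} {m n : ℕ} (hn : 0 < n) (hm : m ≤ n)
    {A : ℕ → State → Prop} (hstep : ∀ r < m, ∀ s, A r s → b.eval s ∧ wp P (A (r + 1)) s)
    (hend : ∀ s, A m s → ¬ b.eval s) {s : State} (h : A 0 s) :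
    Runs (.while b P) (bound (.while b P) * n) s (A m) := by
  suffices H : Runs (.while b P) (m * (b.cost + 1 + bound P) + (b.cost + 1)) s (A m) by
    obtain ⟨k, s', hk, hkc, h'⟩ := H
    refine ⟨k, s', hk, hkc.trans ?_, h'⟩
    rw [bound, add_mul, mul_comm m]
    exact Nat.add_le_add (Nat.mul_le_mul_left _ hm) (Nat.le_mul_of_pos_right _ hn)
  clear hm hn
  induction m generalizing s A with
  | zero => exact ⟨_, _, .while_false (hend s h), by omega, h⟩
  | succ m ih =>
    obtain ⟨hb, hw⟩ := hstep 0 (by omega) s h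
    obtain ⟨k, s', hk, hkc, h'⟩ := runs_bound_of_wp hw
    obtain ⟨k', s'', hk', hkc', h''⟩ := ih (A := fun r => A (r + 1))
      (fun r hr => hstep (r + 1) (by omega)) hend h'
    refine ⟨_, _, .while_true hb hk hk', ?_, h''⟩
    rw [Nat.succ_mul]
    omega

theorem wp_mono {P : Prog} {Q Q' : State → Prop} {s : State} (h : wp P Q s)
    (hQ : ∀ s, Q s → Q' s) : wp P Q' s := by
  induction P generalizing Q Q' s with
  | seq P P' ih ih' => exact ih h fun s hs => ih' hs hQ
  | ite b P P' ih ih' => exact ⟨fun hb => ih (h.1 hb) hQ, fun hb => ih' (h.2 hb) hQ⟩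
  | setI a e => exact hQ _ h
  | setR a e => exact hQ _ h
  | write e => exact hQ _ h
  | _ => exact h.elim

theorem wp_seq {P P' : Prog} {Q Q' : State → Prop} {s : State} (h : wp P Q s)
    (h' : ∀ s', Q s' → wp P' Q' s') : wp (.seq P P') Q' s :=
  wp_mono (P := P) h h'

/-! ### The program -/

/-- The content of the cell with a fixed address. -/
abbrev IExpr.reg (k : ℕ) : IExpr := .mem (.const k)

abbrev IExpr.succ (a : IExpr) : IExpr := .add a (.const 1)

abbrev IExpr.pred (a : IExpr) : IExpr := .sub a (.const 1)

/-- The orientation of the input points with three given indices. -/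
def orientExpr (p q r : IExpr) : RExpr :=
  .sub (.mul (.sub (x q) (x p)) (.sub (y r) (y p))) (.mul (.sub (y q) (y p)) (.sub (x r) (x p)))
where
  /-- The first coordinate of the point with index `a`. -/
  x (a : IExpr) : RExpr := .mem (.add a a)
  /-- The second coordinate of the point with index `a`. -/
  y (a : IExpr) : RExpr := .mem (.add (.add a a) (.const 1))

def isLeftTurn (p q r : IExpr) : Test := .rlt (.const 0) (orientExpr p q r)

def isRightTurn (p q r : IExpr) : Test := .rlt (orientExpr p q r) (.const 0)

/-- The minimum, by truncated subtraction. -/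
def minExpr (a b : IExpr) : IExpr := .sub a (.sub a b)

/-- The maximum, by truncated subtraction. -/
def maxExpr (a b : IExpr) : IExpr := .add b (.sub a b)

/-- Writes a list of indices in the output format. -/
def writeList : List IExpr → Prog
  | [] => .write (.const 0)
  | a :: l => .seq (.write a.succ) (writeList l)

/-! The cells used by the program are: `1` for the apex, `2` and `3` for a state of the greedy
partition, `4` for the number of levels, `5` for the chain of the last picked vertex, `6` for a
scratch value, `7` for a counter, and `8 + 2 * r` and `9 + 2 * r` for the `r`-th state. -/

abbrev apexCell : IExpr := .reg 1
abbrev leftCell : IExpr := .reg 2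
abbrev rightCell : IExpr := .reg 3
abbrev levelsCell : IExpr := .reg 4
abbrev chainCell : IExpr := .reg 5
abbrev scratchCell : IExpr := .reg 6
abbrev counterCell : IExpr := .reg 7

def leftNextFreeTest : Test := .not (isRightTurn rightCell rightCell.pred leftCell.succ)

def rightNextFreeTest : Test := .not (isLeftTurn leftCell leftCell.succ rightCell.pred)

def leftFreeTest : Test := .not (isRightTurn rightCell rightCell.pred leftCell)

def rightFreeTest : Test := .not (isLeftTurn leftCell leftCell.succ rightCell)

/-- The first vertex after `v 0` that is not strictly reflex. -/
def findApex : Prog :=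
  .seq (.setI (.const 1) (.const 1))
    (.while (isLeftTurn apexCell.pred apexCell apexCell.succ) (.setI (.const 1) apexCell.succ))

/-- Replaces the current state `(i, u)` by `next V t (i, u)`. All tests are made before the tested
cells are changed. -/
def advance : Prog :=
  .ite leftNextFreeTest
    (.seq
      (.ite rightNextFreeTest
        (.setI (.const 3) (maxExpr (.sub rightCell (.const 2)) apexCell.succ))
        (.ite rightFreeTest (.setI (.const 3) (maxExpr rightCell.pred apexCell.succ))
          (.setI (.const 3) rightCell)))
      (.setI (.const 2) (minExpr (.add leftCell (.const 2)) apexCell.pred)))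
    (.seq
      (.ite leftFreeTest (.setI (.const 2) (minExpr leftCell.succ apexCell.pred))
        (.setI (.const 2) leftCell))
      (.setI (.const 3) (maxExpr (.sub rightCell (.const 2)) apexCell.succ)))

/-- Appends the current state to the stored ones. -/
def storeState : Prog :=
  .seq (.setI (.add (.const 8) (.add levelsCell levelsCell)) leftCell)
    (.seq (.setI (.add (.const 9) (.add levelsCell levelsCell)) rightCell)
      (.setI (.const 4) levelsCell.succ))

def continuesTest : Test :=
  .not (.and (.not (.ilt leftCell.succ apexCell)) (.not (.ilt apexCell.succ rightCell)))

/-- The greedy partition, with all its states stored. -/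
def partition : Prog :=
  .seq (.setI (.const 3) (.pred (.reg 0)))
    (.while continuesTest (.seq storeState advance))

/-- Makes the stored state with the index in the counter the current one. -/
def loadState : Prog :=
  .seq (.setI (.const 2) (.mem (.add (.const 8) (.add counterCell counterCell))))
    (.setI (.const 3) (.mem (.add (.const 9) (.add counterCell counterCell))))

/-- Writes the vertex that `pick` selects at the current state. -/
def writePick : Prog :=
  .ite (.ilt (.const 0) chainCell)
    (.ite leftNextFreeTest (.write leftCell.succ)
      (.seq (.write rightCell.succ) (.setI (.const 5) (.const 0))))
    (.ite rightNextFreeTest (.write rightCell.succ)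
      (.seq (.write leftCell.succ) (.setI (.const 5) (.const 1))))

/-- Writes the apex and the picked vertices, from the last level to the first. -/
def writeHidden : Prog :=
  .seq (.seq (.write apexCell.succ)
      (.seq (.setI (.const 5) (.const 1)) (.setI (.const 7) levelsCell)))
    (.seq (.while (.ilt (.const 0) counterCell)
        (.seq (.setI (.const 7) counterCell.pred) (.seq loadState writePick)))
      (.write (.const 0)))

/-- Writes the piece `levelPiece` of the current state. -/
def writeLevel : Prog :=
  .ite leftNextFreeTest
    (.ite rightNextFreeTest (writeList [leftCell, leftCell.succ, rightCell, rightCell.pred])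
      (.seq
        (.ite rightFreeTest (.setI (.const 6) rightCell) (.setI (.const 6) rightCell.succ))
        (.ite (isRightTurn leftCell leftCell.succ scratchCell)
          (writeList [leftCell, leftCell.succ, scratchCell])
          (writeList [leftCell, leftCell.succ, scratchCell, scratchCell.succ]))))
    (.seq
      (.ite leftFreeTest (.setI (.const 6) leftCell) (.setI (.const 6) leftCell.pred))
      (.ite (isLeftTurn rightCell rightCell.pred scratchCell)
        (writeList [rightCell, rightCell.pred, scratchCell])
        (writeList [rightCell, rightCell.pred, scratchCell, scratchCell.pred])))

/-- Writes the pieces of the levels and the triangle at the apex. -/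
def writeCover : Prog :=
  .seq (.setI (.const 7) (.const 0))
    (.seq (.while (.ilt counterCell levelsCell)
        (.seq loadState (.seq writeLevel (.setI (.const 7) counterCell.succ))))
      (writeList [apexCell.pred, apexCell, apexCell.succ]))

/-- Finds the apex, computes and stores the states of the greedy partition, and writes one vertex of
each level, from the last to the first, and then the pieces of the levels. -/
def funnelProgram : Prog :=
  .seq findApex (.seq partition (.seq writeHidden writeCover))

/-! ### Correctness of the program -/

/-- The real memory contains the points `V 0, V 1, …`. -/
def HoldsPoints (V : ℕ → Plane) (s : State) : Prop :=
  ∀ k, s.R (k + k) = (V k).1 ∧ s.R (k + k + 1) = (V k).2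

theorem holdsPoints_initState {n : ℕ} (v : Fin n → Plane) :
    HoldsPoints (vert v) (initState v) := by
  intro k
  have h1 : (k + k) / 2 = k := by omega
  have h2 : (k + k) % 2 = 0 := by omega
  have h3 : (k + k + 1) / 2 = k := by omega
  have h4 : (k + k + 1) % 2 = 1 := by omega
  simp only [initState, h1, h2, h3, h4, vert]
  split_ifs <;> simp_all

section eval
variable {V : ℕ → Plane} {s : State} {p q r : IExpr}

theorem eval_orientExpr (h : HoldsPoints V s) :
    (orientExpr p q r).eval s = orient (V (p.eval s)) (V (q.eval s)) (V (r.eval s)) := by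
  simp only [orientExpr, orientExpr.x, orientExpr.y, RExpr.eval, IExpr.eval, (h _).1, (h _).2,
    orient]

theorem eval_isLeftTurn (h : HoldsPoints V s) : (isLeftTurn p q r).eval s ↔
    0 < orient (V (p.eval s)) (V (q.eval s)) (V (r.eval s)) := by
  rw [isLeftTurn, Test.eval, eval_orientExpr h, RExpr.eval, Int.cast_zero]

theorem eval_isRightTurn (h : HoldsPoints V s) : (isRightTurn p q r).eval s ↔
    orient (V (p.eval s)) (V (q.eval s)) (V (r.eval s)) < 0 := by
  rw [isRightTurn, Test.eval, eval_orientExpr h, RExpr.eval, Int.cast_zero]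

theorem eval_leftNextFreeTest (h : HoldsPoints V s) :
    leftNextFreeTest.eval s ↔ LeftNextFree V (s.I 2) (s.I 3) :=
  not_congr (eval_isRightTurn h)

theorem eval_rightNextFreeTest (h : HoldsPoints V s) :
    rightNextFreeTest.eval s ↔ RightNextFree V (s.I 2) (s.I 3) :=
  not_congr (eval_isLeftTurn h)

theorem eval_leftFreeTest (h : HoldsPoints V s) :
    leftFreeTest.eval s ↔ LeftFree V (s.I 2) (s.I 3) :=
  not_congr (eval_isRightTurn h)

theorem eval_rightFreeTest (h : HoldsPoints V s) :
    rightFreeTest.eval s ↔ RightFree V (s.I 2) (s.I 3) :=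
  not_congr (eval_isLeftTurn h)

theorem eval_minExpr : (minExpr p q).eval s = min (p.eval s) (q.eval s) := by
  simp only [minExpr, IExpr.eval]; omega

theorem eval_maxExpr : (maxExpr p q).eval s = max (p.eval s) (q.eval s) := by
  simp only [maxExpr, IExpr.eval]; omega

theorem eval_continuesTest : continuesTest.eval s ↔ Continues (s.I 1) (s.I 2, s.I 3) := by
  simp only [continuesTest, Test.eval, IExpr.eval, Continues]; tauto

end eval

/-- The output format for a list of natural numbers. -/
def encodeNats (L : List ℕ) : List ℕ := L.map (· + 1) ++ [0]

theorem wp_writeList (l : List IExpr) (Q : State → Prop) (s : State) :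
    wp (writeList l) Q s ↔
      Q { s with out := s.out ++ encodeNats (l.map fun a => a.eval s) } := by
  have heval : ∀ (a : IExpr) (o : List ℕ), a.eval { s with out := o } = a.eval s := by
    intro a o
    induction a <;> simp_all [IExpr.eval]
  suffices H : ∀ o, wp (writeList l) Q { s with out := o } ↔
      Q { s with out := o ++ encodeNats (l.map fun a => a.eval s) } from H s.out
  induction l with
  | nil => intro o; rfl
  | cons a l ih =>
    intro o
    rw [writeList, wp]
    simp only [wp]
    rw [ih]
    simp [encodeNats, IExpr.eval, heval]

/-- The points, the apex, and the current state of the greedy partition. -/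
structure Loaded (V : ℕ → Plane) (t : ℕ) (S : ℕ × ℕ) (s : State) : Prop where
  points : HoldsPoints V s
  apex : s.I 1 = t
  left : s.I 2 = S.1
  right : s.I 3 = S.2

/-- The stored states are `S 0, …, S (m - 1)`. -/
def Stores (S : ℕ → ℕ × ℕ) (m : ℕ) (s : State) : Prop :=
  s.I 4 = m ∧ ∀ r < m, s.I (8 + (r + r)) = (S r).1 ∧ s.I (9 + (r + r)) = (S r).2

section
variable {V : ℕ → Plane} {t : ℕ}

theorem wp_storeState {S : ℕ → ℕ × ℕ} {m : ℕ} {s : State} (h : Loaded V t (S m) s)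
    (hS : Stores S m s) :
    wp storeState (fun s' => Loaded V t (S m) s' ∧ Stores S (m + 1) s' ∧ s'.out = s.out) s := by
  obtain ⟨h4, hS⟩ := hS
  have e8 : ∀ k < 8, ∀ x, k ≠ 8 + x ∧ k ≠ 9 + x ∧ 8 + x ≠ k ∧ 9 + x ≠ k := by omega
  have e9 : ∀ x y, 8 + (x + x) ≠ 9 + (y + y) ∧ 9 + (x + x) ≠ 8 + (y + y) := by omega
  have e1 := e8 1 (by omega)
  have e2 := e8 2 (by omega)
  have e3 := e8 3 (by omega)
  have e4 := e8 4 (by omega)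
  refine ⟨⟨h.points, ?_, ?_, ?_⟩, ⟨?_, fun r hr => ?_⟩, rfl⟩
  all_goals simp [IExpr.eval, Function.update_apply, h4, h.apex, h.left, h.right, e1, e2, e3, e4,
    e9]
  rcases (Nat.lt_succ_iff.1 hr).eq_or_lt with rfl | hr
  · simp
  · rw [if_neg (by omega), if_neg (by omega)]
    exact hS r hr

theorem wp_advance {S : ℕ × ℕ} {s : State} (h : Loaded V t S s) :
    wp advance (fun s' => Loaded V t (next V t S) s' ∧ (∀ a, 4 ≤ a → s'.I a = s.I a) ∧
      s'.out = s.out) s := by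
  obtain ⟨h0, h1, h2, h3⟩ := h
  have ha : ∀ a, 4 ≤ a → a ≠ 2 ∧ a ≠ 3 := by omega
  simp only [advance, wp, eval_leftNextFreeTest h0, eval_rightNextFreeTest h0,
    eval_leftFreeTest h0, eval_rightFreeTest h0, h2, h3, next]
  refine ⟨fun hX => ⟨fun hY => ?_, fun hY => ⟨fun hR => ?_, fun hR => ?_⟩⟩,
    fun hX => ⟨fun hL => ?_, fun hL => ?_⟩⟩
  all_goals
    refine ⟨⟨h0, ?_, ?_, ?_⟩, fun a h4 => ?_, trivial⟩
    all_goals simp_all [IExpr.eval, eval_minExpr, eval_maxExpr]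

theorem wp_loadState {S : ℕ → ℕ × ℕ} {m r : ℕ} {s : State} (h0 : HoldsPoints V s)
    (h1 : s.I 1 = t) (hS : Stores S m s) (h7 : s.I 7 = r) (hr : r < m) :
    wp loadState (fun s' => Loaded V t (S r) s' ∧ (∀ a, 4 ≤ a → s'.I a = s.I a) ∧
      s'.out = s.out) s := by
  simp only [loadState, wp, IExpr.eval, h7]
  refine ⟨⟨h0, ?_, ?_, ?_⟩, fun a ha => ?_, trivial⟩
  · simpa using h1
  · simp [(hS.2 r hr).1]
  · have : 9 + (r + r) ≠ 2 := by omega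
    simp [h7, this, (hS.2 r hr).2]
  · have : a ≠ 2 ∧ a ≠ 3 := by omega
    simp [this]

/-- The code of the chain of the last picked vertex. -/
def chainCode (b : Bool) : ℕ := if b then 1 else 0

theorem wp_writePick {S : ℕ × ℕ} {b : Bool} {s : State} (h : Loaded V t S s)
    (h5 : s.I 5 = chainCode b) :
    wp writePick (fun s' => s'.R = s.R ∧ (∀ a, a ≠ 5 → s'.I a = s.I a) ∧
      s'.I 5 = chainCode (pick V b S).2 ∧ s'.out = s.out ++ [(pick V b S).1 + 1]) s := by
  obtain ⟨h0, h1, h2, h3⟩ := h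
  simp only [writePick, wp, eval_leftNextFreeTest h0, eval_rightNextFreeTest h0, h2, h3, Test.eval,
    IExpr.eval, h5, chainCode, pick]
  cases b
  · by_cases hY : RightNextFree V S.1 S.2 <;> simp_all [chainCode]
  · by_cases hX : LeftNextFree V S.1 S.2 <;> simp_all [chainCode]

theorem wp_writeLevel {S : ℕ × ℕ} {s : State} (h : Loaded V t S s) :
    wp writeLevel (fun s' => s'.R = s.R ∧ (∀ a, a ≠ 6 → s'.I a = s.I a) ∧
      s'.out = s.out ++ encodeNats (levelPiece V S)) s := by
  obtain ⟨h0, h1, h2, h3⟩ := h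
  have hs : ∀ w, HoldsPoints V { s with I := Function.update s.I 6 w } := fun w => h0
  simp only [writeLevel, wp, eval_leftNextFreeTest h0, eval_rightNextFreeTest h0,
    eval_leftFreeTest h0, eval_rightFreeTest h0, h2, h3, levelPiece, wp_writeList,
    eval_isLeftTurn (hs _), eval_isRightTurn (hs _), leftEdgePiece, rightEdgePiece, IExpr.eval]
  by_cases hX : LeftNextFree V S.1 S.2
  · by_cases hY : RightNextFree V S.1 S.2
    · simp_all [IExpr.eval, -not_lt]
    · by_cases hR : RightFree V S.1 S.2
      · by_cases ho : orient (V S.1) (V (S.1 + 1)) (V S.2) < 0 <;> simp_all [IExpr.eval, -not_lt]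
      · by_cases ho : orient (V S.1) (V (S.1 + 1)) (V (S.2 + 1)) < 0 <;> simp_all [IExpr.eval, -not_lt]
  · by_cases hL : LeftFree V S.1 S.2
    · by_cases ho : 0 < orient (V S.2) (V (S.2 - 1)) (V S.1) <;> simp_all [IExpr.eval, -not_lt]
    · by_cases ho : 0 < orient (V S.2) (V (S.2 - 1)) (V (S.1 - 1)) <;> simp_all [IExpr.eval, -not_lt]
variable {n : ℕ}

theorem Stores.congr {S : ℕ → ℕ × ℕ} {m : ℕ} {s s' : State} (h : Stores S m s)
    (he : ∀ a, 4 ≤ a → a ≠ 5 → a ≠ 6 → a ≠ 7 → s'.I a = s.I a) : Stores S m s' := by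
  refine ⟨?_, fun r hr => ?_⟩
  · rw [he 4 (by omega) (by omega) (by omega) (by omega), h.1]
  · rw [he _ (by omega) (by omega) (by omega) (by omega),
      he _ (by omega) (by omega) (by omega) (by omega)]
    exact h.2 r hr

theorem runs_findApex (htn : t ≤ n) (ht : 0 < t)
    (hlt : ∀ k, k + 1 < t → 0 < orient (V k) (V (k + 1)) (V (k + 2)))
    (hlast : ¬ 0 < orient (V (t - 1)) (V t) (V (t + 1))) {s : State} (h : HoldsPoints V s) :
    Runs findApex (bound findApex * n) s fun s' =>
      HoldsPoints V s' ∧ s'.I 1 = t ∧ (∀ a, a ≠ 1 → s'.I a = s.I a) ∧ s'.out = s.out := by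
  have hn : 0 < n := by omega
  let A : ℕ → State → Prop := fun r s' =>
    HoldsPoints V s' ∧ s'.I 1 = r + 1 ∧ (∀ a, a ≠ 1 → s'.I a = s.I a) ∧ s'.out = s.out
  have hA : ∀ s', A (t - 1) s' →
      HoldsPoints V s' ∧ s'.I 1 = t ∧ (∀ a, a ≠ 1 → s'.I a = s.I a) ∧ s'.out = s.out := by
    intro s' ⟨h1, h2, h3⟩
    exact ⟨h1, by omega, h3⟩
  refine Runs.seq (Q := A 0) (runs_of_wp hn ?_) fun s₁ hs₁ => ?_
  · refine ⟨h, ?_, ?_, rfl⟩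
    · simp [IExpr.eval]
    · intro a ha
      simp [IExpr.eval, ha]
  · obtain ⟨k, s', hk, hkc, h'⟩ := runs_while (A := A) (m := t - 1)
      (P := .setI (.const 1) apexCell.succ)
      (b := isLeftTurn apexCell.pred apexCell apexCell.succ) hn (by omega) (by
      intro r hr s₂ ⟨h0, h1, h2, h3⟩
      rw [eval_isLeftTurn h0]
      refine ⟨?_, h0, ?_, fun a ha => ?_, h3⟩
      · simpa [IExpr.eval, h1] using hlt r (by omega)
      · simp [IExpr.eval, h1]
      · simp [IExpr.eval, ha, h2]) (by
      intro s₂ ⟨h0, h1, _⟩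
      rw [eval_isLeftTurn h0]
      simpa [IExpr.eval, h1, Nat.sub_add_cancel ht] using hlast) hs₁
    exact ⟨k, s', hk, hkc, hA s' h'⟩

/-- The points and the apex. -/
def Ready (V : ℕ → Plane) (t : ℕ) (s : State) : Prop := HoldsPoints V s ∧ s.I 1 = t

theorem runs_partition {m : ℕ} (hn : 0 < n) (hm : m ≤ n)
    (h : ∀ r < m, Continues t (run V n t r)) (hend : ¬ Continues t (run V n t m)) {s : State}
    (hs : Ready V t s) (h0 : s.I 0 = n) (h2 : s.I 2 = 0) (h4 : s.I 4 = 0) :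
    Runs partition (bound partition * n) s fun s' =>
      Ready V t s' ∧ Stores (run V n t) m s' ∧ s'.out = s.out := by
  let A : ℕ → State → Prop := fun r s' =>
    Loaded V t (run V n t r) s' ∧ Stores (run V n t) r s' ∧ s'.out = s.out
  refine Runs.seq (Q := A 0) (runs_of_wp hn ?_) fun s₁ hs₁ => ?_
  · refine ⟨⟨hs.1, ?_, ?_, ?_⟩, ⟨?_, ?_⟩, rfl⟩
    · simpa [IExpr.eval] using hs.2
    · simpa [IExpr.eval, run] using h2
    · simp [IExpr.eval, run, h0]
    · simpa [IExpr.eval] using h4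
    · exact fun r hr => absurd hr (Nat.not_lt_zero r)
  · obtain ⟨k, s', hk, hkc, h1, h2, h3⟩ := runs_while (A := A) (m := m) (b := continuesTest)
      (P := .seq storeState advance) hn hm (by
      intro r hr s₂ ⟨hl, hS, ho⟩
      refine ⟨?_, ?_⟩
      · rw [eval_continuesTest, hl.apex, hl.left, hl.right]
        exact h r hr
      · refine wp_seq (wp_storeState hl hS) fun s₃ ⟨hl₃, hS₃, ho₃⟩ => ?_
        refine wp_mono (wp_advance hl₃) fun s₄ ⟨hl₄, ha, ho₄⟩ => ?_
        refine ⟨?_, hS₃.congr fun a h4 _ _ _ => ha a h4, by rw [ho₄, ho₃, ho]⟩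
        rwa [Funnel.run_succ]) (by
      intro s₂ ⟨hl, _⟩
      rw [eval_continuesTest, hl.apex, hl.left, hl.right]
      exact hend) hs₁
    exact ⟨k, s', hk, hkc, ⟨h1.points, h1.apex⟩, h2, h3⟩

theorem runs_writeHidden {S : ℕ → ℕ × ℕ} {m : ℕ} (hn : 0 < n) (hm : m ≤ n) {s : State}
    (hs : Ready V t s) (hS : Stores S m s) :
    Runs writeHidden (bound writeHidden * n) s fun s' =>
      Ready V t s' ∧ Stores S m s' ∧ s'.out = s.out ++ encodeNats (t :: picks V S m true) := by
  -- the output so far, together with the picks that are still to be written, is the whole list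
  let A : ℕ → State → Prop := fun r s' =>
    Ready V t s' ∧ Stores S m s' ∧ s'.I 7 = m - r ∧ ∃ b, s'.I 5 = chainCode b ∧
      s'.out ++ (picks V S (m - r) b).map (· + 1) =
        s.out ++ (t :: picks V S m true).map (· + 1)
  refine Runs.seq (Q := A 0) (runs_of_wp hn ?_) fun s₁ hs₁ => Runs.seq (Q := A m) ?_ ?_
  · refine ⟨⟨hs.1, ?_⟩, hS.congr ?_, ?_, true, ?_, ?_⟩
    · simpa [IExpr.eval] using hs.2
    · intro a h4 h5 h6 h7
      simp [IExpr.eval, h5, h7]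
    · simpa [IExpr.eval] using hS.1
    · simp [IExpr.eval, chainCode]
    · simp [IExpr.eval, hs.2]
  · refine runs_while hn hm ?_ ?_ hs₁
    · intro r hr s₂ ⟨hr₂, hS₂, h7, b, h5, ho⟩
      have hmr : m - r = m - (r + 1) + 1 := by omega
      refine ⟨by simp [Test.eval, IExpr.eval, h7, hr], ?_⟩
      have e : IExpr.eval s₂ counterCell.pred = m - (r + 1) := by
        simp only [IExpr.eval, h7]; omega
      change wp (.seq loadState writePick) (A (r + 1))
        { s₂ with I := Function.update s₂.I 7 (counterCell.pred.eval s₂) }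
      refine wp_seq (wp_loadState (V := V) (t := t) (S := S) (m := m) (r := m - (r + 1))
        hr₂.1 ?_ (hS₂.congr ?_) ?_ (by omega)) fun s₃ ⟨hl₃, ha₃, ho₃⟩ => ?_
      · simpa [IExpr.eval] using hr₂.2
      · intro a h4 h5 h6 h7
        simp [IExpr.eval, h7]
      · simpa [IExpr.eval] using e
      · have h5₃ : s₃.I 5 = chainCode b := by
          rw [ha₃ 5 (by omega)]
          simpa [IExpr.eval] using h5
        refine wp_mono (wp_writePick hl₃ h5₃) fun s₄ ⟨hR, ha₄, h5₄, ho₄⟩ => ?_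
        refine ⟨⟨?_, ?_⟩, hS₂.congr ?_, ?_, _, h5₄, ?_⟩
        · intro k
          rw [hR]
          exact hl₃.points k
        · rw [ha₄ 1 (by omega), hl₃.apex]
        · intro a h4 h5 h6 h7
          rw [ha₄ a h5, ha₃ a h4]
          simp [IExpr.eval, h7]
        · rw [ha₄ 7 (by omega), ha₃ 7 (by omega)]
          simpa [IExpr.eval] using e
        · rw [← ho, ho₄, ho₃, hmr, picks]
          simp
    · intro s₂ ⟨_, _, h7, _⟩
      simp [Test.eval, IExpr.eval, h7]
  · intro s₂ ⟨hr₂, hS₂, h7, b, h5, ho⟩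
    refine runs_of_wp hn ⟨hr₂, hS₂, ?_⟩
    rw [Nat.sub_self] at ho
    simp only [picks, List.map_nil, List.append_nil] at ho
    simp [IExpr.eval, ho, encodeNats]

theorem runs_writeCover {m : ℕ} (hn : 0 < n) (hm : m ≤ n) {s : State}
    (hs : Ready V t s) (hS : Stores (run V n t) m s) :
    Runs writeCover (bound writeCover * n) s fun s' =>
      s'.out = s.out ++ (pieces V n t m).flatMap encodeNats := by
  let A : ℕ → State → Prop := fun r s' =>
    Ready V t s' ∧ Stores (run V n t) m s' ∧ s'.I 7 = r ∧
      s'.out = s.out ++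
        ((List.range r).map fun q => levelPiece V (run V n t q)).flatMap encodeNats
  refine Runs.seq (Q := A 0) (runs_of_wp hn ?_) fun s₁ hs₁ => Runs.seq (Q := A m) ?_ ?_
  · refine ⟨⟨hs.1, ?_⟩, hS.congr ?_, ?_, ?_⟩
    · simpa [IExpr.eval] using hs.2
    · intro a h4 h5 h6 h7
      simp [IExpr.eval, h7]
    · simp [IExpr.eval]
    · simp
  · refine runs_while hn hm ?_ ?_ hs₁
    · intro r hr s₂ ⟨hr₂, hS₂, h7, ho⟩
      refine ⟨by simp [Test.eval, IExpr.eval, h7, hS₂.1, hr], ?_⟩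
      refine wp_seq (wp_loadState hr₂.1 hr₂.2 hS₂ h7 hr) fun s₃ ⟨hl₃, ha₃, ho₃⟩ => ?_
      refine wp_seq (wp_writeLevel hl₃) fun s₄ ⟨hR, ha₄, ho₄⟩ => ?_
      refine ⟨⟨?_, ?_⟩, hS₂.congr ?_, ?_, ?_⟩
      · intro k
        simp only [hR]
        exact hl₃.points k
      · simp [IExpr.eval, ha₄ 1, hl₃.apex]
      · intro a h4 h5 h6 h7
        simp [IExpr.eval, h7, ha₄ a h6, ha₃ a h4]
      · simp [IExpr.eval, ha₄ 7, ha₃ 7, h7]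
      · simp only [ho₄, ho₃, ho, List.range_succ]
        simp
    · intro s₂ ⟨_, hS₂, h7, _⟩
      simp [Test.eval, IExpr.eval, h7, hS₂.1]
  · intro s₂ ⟨hr₂, hS₂, h7, ho⟩
    refine runs_of_wp hn ?_
    rw [wp_writeList]
    simp [ho, pieces, IExpr.eval, hr₂.2]

theorem runs_funnelProgram {m : ℕ} (htn : t ≤ n) (ht : 0 < t)
    (hlt : ∀ k, k + 1 < t → 0 < orient (V k) (V (k + 1)) (V (k + 2)))
    (hlast : ¬ 0 < orient (V (t - 1)) (V t) (V (t + 1))) (hm : m ≤ n)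
    (h : ∀ r < m, Continues t (run V n t r)) (hend : ¬ Continues t (run V n t m)) {s : State}
    (hs : HoldsPoints V s) (h0 : s.I 0 = n) (h2 : s.I 2 = 0) (h4 : s.I 4 = 0) (ho : s.out = []) :
    Runs funnelProgram (bound funnelProgram * n) s fun s' => s'.out =
      encodeNats (t :: picks V (run V n t) m true) ++ (pieces V n t m).flatMap encodeNats := by
  have hn : 0 < n := by omega
  refine (runs_findApex htn ht hlt hlast hs).seq fun s₁ ⟨hp₁, h1, ha, ho₁⟩ => ?_
  refine (runs_partition hn hm h hend ⟨hp₁, h1⟩ ((ha 0 (by omega)).trans h0)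
    ((ha 2 (by omega)).trans h2) ((ha 4 (by omega)).trans h4)).seq fun s₂ ⟨hr₂, hS₂, ho₂⟩ => ?_
  refine (runs_writeHidden hn hm hr₂ hS₂).seq fun s₃ ⟨hr₃, hS₃, ho₃⟩ => ?_
  obtain ⟨k, s', hk, hkc, h'⟩ := runs_writeCover hn hm hr₃ hS₃
  exact ⟨k, s', hk, hkc, h'.trans (by rw [ho₃, ho₂, ho₁, ho, List.nil_append])⟩

end

theorem encodeNats_map_val {n : ℕ} (l : List (Fin n)) :
    encodeNats (l.map Fin.val) = encodeList l := by
  simp [encodeNats, encodeList, ← List.map_eq_flatMap]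

theorem encodeOutput_eq {n : ℕ} (H : List (Fin n)) (C : List (List (Fin n))) :
    encodeOutput H C =
      encodeNats (H.map Fin.val) ++ (C.map (List.map Fin.val)).flatMap encodeNats := by
  simp only [encodeOutput, List.flatMap_map, encodeNats_map_val]

end RealRAM

namespace Funnel

/-! ### Hidden set and cover by the program -/

/-- The boundary turns right at the apex. -/
theorem IsFunnel.orient_apex_neg {n : ℕ} [NeZero n] {v : Fin n → Plane} {t : ℕ} (hv : IsFunnel v)
    (ht : IsApex v t) : orient (vert v (t - 1)) (vert v t) (vert v (t + 1)) < 0 := by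
  have hp := hv.chainPair ht
  have htn := ht.lt
  obtain ⟨s, rfl⟩ : ∃ s, t = s + 1 := ⟨t - 1, by have := ht.pos; omega⟩
  have h := hp.line_last_lt (i := s) (j := n - 1 - (s + 1 + 1)) rfl (by omega)
  have e : n - 1 - (n - 1 - (s + 1 + 1)) = s + 1 + 1 := by omega
  have := (orient_left_neg_iff hv ht (i := s) (by omega) (vert v (s + 1 + 1))).2 (by
    simpa only [rightX, rightY, e] using h)
  simpa using this

theorem exists_exec_funnelProgram {n : ℕ} [NeZero n] {v : Fin n → Plane} (hv : IsFunnel v) :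
    ∃ (k : ℕ) (s : RealRAM.State)
      (H : List (Fin n)) (C : List (List (Fin n))),
      RealRAM.Exec RealRAM.funnelProgram (RealRAM.initState v) k s ∧
      k ≤ RealRAM.bound RealRAM.funnelProgram * n ∧
      s.out = RealRAM.encodeOutput H C ∧ H.Nodup ∧ IsHiddenVertexSet v H.toFinset ∧
      (C.map (piece v)).Nodup ∧ IsVertexConvexCover v {S | S ∈ C.map (piece v)} ∧
      H.length = C.length := by
  obtain ⟨t, ht⟩ := hv.exists_isApex
  obtain ⟨m, hmn, hm, hend⟩ := exists_run_end hv ht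
  obtain ⟨H, C, hH, hC, h⟩ := exists_hidden_cover hv ht hm hend
  have htn := ht.lt
  obtain ⟨k, s, hk, hkc, ho⟩ := RealRAM.runs_funnelProgram (by omega) ht.pos
    (fun k hk => ht.reflex k (by omega) (by omega)) (hv.orient_apex_neg ht).not_gt hmn hm hend
    (RealRAM.holdsPoints_initState v) (by simp [RealRAM.initState]) (by simp [RealRAM.initState])
    (by simp [RealRAM.initState]) rfl
  exact ⟨k, s, H, C, hk, hkc, by rw [ho, RealRAM.encodeOutput_eq, hH, hC], h⟩

end Funnel

theorem theorem2 :
    -- one program computes, in linear time, a hidden vertex set `H` and a convex cover `C` of the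
    -- vertices with `|H| = |C|` (both listed without repetition) for every funnel polygon
    (∃ (P : RealRAM.Prog) (c : ℕ), ∀ (n : ℕ) [NeZero n] (v : Fin n → Funnel.Plane),
      Funnel.IsFunnel v →
        ∃ (k : ℕ) (s : RealRAM.State) (H : List (Fin n)) (C : List (List (Fin n))),
          RealRAM.Exec P (RealRAM.initState v) k s ∧ k ≤ c * n ∧
          s.out = RealRAM.encodeOutput H C ∧
          H.Nodup ∧ Funnel.IsHiddenVertexSet v H.toFinset ∧
          (C.map (Funnel.piece v)).Nodup ∧
          Funnel.IsVertexConvexCover v {S | S ∈ C.map (Funnel.piece v)} ∧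
          H.length = C.length) ∧
    -- the maximum size of a hidden vertex set equals the minimum size of a convex cover
    (∀ (n : ℕ) [NeZero n] (v : Fin n → Funnel.Plane), Funnel.IsFunnel v →
      ∃ m : ℕ,
        IsGreatest {k | ∃ H : Finset (Fin n), Funnel.IsHiddenVertexSet v H ∧ H.card = k} m ∧
        IsLeast {k | ∃ C : Set (Set Funnel.Plane),
          Funnel.IsVertexConvexCover v C ∧ C.ncard = k} m) := by
  refine ⟨⟨RealRAM.funnelProgram, RealRAM.bound RealRAM.funnelProgram, fun n _ v hv =>
    Funnel.exists_exec_funnelProgram hv⟩, fun n _ v hv => ?_⟩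
  classical
  obtain ⟨-, -, H, C, -, -, -, hnd, hH, hCnd, hC, hlen⟩ := Funnel.exists_exec_funnelProgram hv
  have hcard : {S | S ∈ C.map (Funnel.piece v)}.ncard = H.toFinset.card := by
    have e : {S | S ∈ C.map (Funnel.piece v)} =
        ((C.map (Funnel.piece v)).toFinset : Set (Set Funnel.Plane)) := by
      ext S; simp
    rw [e, Set.ncard_coe_finset, List.toFinset_card_of_nodup hCnd,
      List.toFinset_card_of_nodup hnd, List.length_map, hlen]
  refine ⟨H.toFinset.card, ⟨⟨_, hH, rfl⟩, ?_⟩, ⟨_, hC, hcard⟩, ?_⟩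
  · rintro _ ⟨H', hH', rfl⟩
    exact hcard ▸ Funnel.card_le_ncard hH' hC
  · rintro _ ⟨C', hC', rfl⟩
    exact Funnel.card_le_ncard hH hC'
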